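/- Let $n\ge 1$ and let $\mathcal H(n)$ be the rank $n$ Heisenberg vertex algebra over $\mathbb C$, generated by even fields $\alpha^1,\dots,\alpha^n$ with operator product expansions $\alpha^i(z)\alpha^k(w)\sim\delta_{i,k}(z-w)^{-2}$ (realized as fields on its Fock space). The complex orthogonal group $O(n)$ acts on $\mathcal H(n)$ by vertex algebra automorphisms, acting linearly in the standard way on the span of $\alpha^1,\dots,\alpha^n$; let $\mathcal H(n)^{O(n)}$ be the vertex subalgebra of invariants. For $m\ge 0$ put $$j^{2m}=\sum_{i=1}^n :\alpha^i\,\partial^{2m}\alpha^i:\ \in\ \mathcal H(n)^{O(n)} .$$ Here $:ab:$ is the Wick product, and iterated Wick products are nested to the right, $:a_1a_2\cdots a_s:\,=\,:a_1(:a_2\cdots a_s:):$, the empty one being $1$. A normally ordered polynomial in fields $a_1,\dots,a_d$ and their derivatives is a linear combination of iterated Wick products $:\partial^{k_1}a_{i_1}\cdots\partial^{k_s}a_{i_s}:$ with $s\ge 0$ and $k_1,\dots,k_s\ge 0$. A set $S$ of fields strongly generates a vertex algebra $\mathcal A$ if the iterated Wick products of elements of $S$ and their derivatives span $\mathcal A$;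 it is a minimal strong generating set if, in addition, no proper subset of $S$ strongly generates $\mathcal A$. **Theorem.** Suppose that there is a decoupling relation $$j^{n^2+3n}=P(j^0,j^2,\dots,j^{n^2+3n-2}),$$ where $P$ is a normally ordered polynomial in $j^0,j^2,\dots,j^{n^2+3n-2}$ and their derivatives. Then for every integer $r\ge\frac12(n^2+3n)$ there is a decoupling relation $$j^{2r}=Q_{2r}(j^0,j^2,\dots,j^{n^2+3n-2}),$$ where $Q_{2r}$ is a normally ordered polynomial in $j^0,j^2,\dots,j^{n^2+3n-2}$ and their derivatives. Moreover, $\{j^0,j^2,\dots,j^{n^2+3n-2}\}$ is then a minimal strong generating set for $\mathcal H(n)^{O(n)}$. -/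

import Mathlib

noncomputable section

namespace Heisenberg

section Fields

variable {V : Type*} [AddCommGroup V] [Module ℂ V]

/-- The `m`-th Fourier mode `a(m)` of `a(z) = ∑ a(m) z^(-m-1)` in `QO(V)`. -/
abbrev mode (a : VertexOperator ℂ V) (m : ℤ) : Module.End ℂ V := VertexOperator.ncoeff a m

theorem exists_truncation (a : VertexOperator ℂ V) (v : V) :
    ∃ N : ℤ, ∀ m ≥ N, mode a m v = 0 :=
  ⟨-HahnSeries.order ((HahnModule.of ℂ).symm (a v)), fun m hm =>
    VertexOperator.ncoeff_eq_zero_of_lt_order a m v (by linarith)⟩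

/-- The field `∑ f(m) z^(-m-1)` in `QO(V)` with prescribed Fourier modes `f(m)`, which for every
vector `v` have to satisfy `f(m) v = 0` for all large `m`. -/
def ofModes (f : ℤ → Module.End ℂ V) (hf : ∀ v, ∃ N : ℤ, ∀ m ≥ N, f m v = 0) :
    VertexOperator ℂ V :=
  VertexOperator.of_coeff (fun y => f (-y - 1)) fun v => by
    obtain ⟨N, hN⟩ := hf v
    refine ⟨-N, fun y hy => ?_⟩
    by_contra h
    exact hy (hN _ (by linarith))

@[simp]
theorem ncoeff_ofModes (f : ℤ → Module.End ℂ V) (hf : ∀ v, ∃ N : ℤ, ∀ m ≥ N, f m v = 0)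
    (m : ℤ) : mode (ofModes f hf) m = f m := by
  simp [ofModes]

/-- The identity field `1`. -/
def vac : VertexOperator ℂ V :=
  ofModes (fun m => if m = -1 then 1 else 0) fun v => ⟨0, fun m hm => by
    have : m ≠ -1 := by intro h; subst h; norm_num at hm
    simp [this]⟩

/-- Formal differentiation `∂ = d/dz`: `(∂a)(m) = -m a(m-1)`. -/
def deriv (a : VertexOperator ℂ V) : VertexOperator ℂ V :=
  ofModes (fun m => (-(m : ℂ)) • mode a (m - 1)) fun v => by
    obtain ⟨N, hN⟩ := exists_truncation a v
    refine ⟨N + 1, fun m hm => ?_⟩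
    change (-(m : ℂ)) • mode a (m - 1) v = 0
    rw [hN (m - 1) (by linarith), smul_zero]

/-- The `j`-th term of the `m`-th Fourier mode of `a ∘ₙ b`, an operator on `V`. -/
def circleTerm (n : ℤ) (a b : VertexOperator ℂ V) (m : ℤ) (j : ℕ) : Module.End ℂ V :=
  ((-1 : ℂ) ^ j * ((Ring.choose n j : ℤ) : ℂ)) •
    (mode a (n - j) * mode b (m + j) - ((-1 : ℂ) ^ n) • (mode b (m + n - j) * mode a (j : ℤ)))

theorem circleTerm_eventually (n : ℤ) (a b : VertexOperator ℂ V) (m : ℤ) (v : V) :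
    ∃ K : ℕ, ∀ j ≥ K, circleTerm n a b m j v = 0 := by
  obtain ⟨N, hN⟩ := exists_truncation a v
  obtain ⟨M, hM⟩ := exists_truncation b v
  refine ⟨max N.toNat (M - m).toNat, fun j hj => ?_⟩
  have h1 : mode a (j : ℤ) v = 0 := hN _ (by omega)
  have h2 : mode b (m + j) v = 0 := hM _ (by omega)
  simp [circleTerm, h1, h2]

theorem circleTerm_support_finite (n : ℤ) (a b : VertexOperator ℂ V) (m : ℤ) (v : V) :
    (Function.support fun j => circleTerm n a b m j v).Finite := by
  obtain ⟨K, hK⟩ := circleTerm_eventually n a b m v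
  refine (Set.finite_lt_nat K).subset fun j hj => ?_
  by_contra h
  exact hj (hK j (not_lt.mp h))

/-- The `m`-th Fourier mode of `a ∘ₙ b`; the sum is finite on every vector. -/
def circleMode (n : ℤ) (a b : VertexOperator ℂ V) (m : ℤ) : Module.End ℂ V where
  toFun v := ∑ᶠ j : ℕ, circleTerm n a b m j v
  map_add' u v := by
    simp only [map_add]
    exact finsum_add_distrib (circleTerm_support_finite n a b m u)
      (circleTerm_support_finite n a b m v)
  map_smul' c v := by
    simp only [map_smul, RingHom.id_apply]
    exact (smul_finsum' c (circleTerm_support_finite n a b m v)).symm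

theorem circleMode_truncation (n : ℤ) (a b : VertexOperator ℂ V) (v : V) :
    ∃ N : ℤ, ∀ m ≥ N, circleMode n a b m v = 0 := by
  obtain ⟨K, hK⟩ := exists_truncation a v
  obtain ⟨M, hM⟩ := exists_truncation b v
  choose L hL using fun j : ℕ => exists_truncation b (mode a (j : ℤ) v)
  obtain ⟨B, hB⟩ := ((Finset.range K.toNat).image L).bddAbove
  refine ⟨max M (B + |n| + K.toNat), fun m hm => ?_⟩
  have key : ∀ j : ℕ, circleTerm n a b m j v = 0 := by
    intro j
    have h2 : mode b (m + j) v = 0 := hM _ (by have := le_max_left M (B + |n| + K.toNat); omega)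
    have h1 : mode b (m + n - j) (mode a (j : ℤ) v) = 0 := by
      by_cases hj : j < K.toNat
      · refine hL j _ ?_
        have h3 : L j ≤ B := hB (by
          simp only [Finset.coe_image, Set.mem_image, Finset.mem_coe, Finset.mem_range]
          exact ⟨j, hj, rfl⟩)
        have h4 := le_max_right M (B + |n| + K.toNat)
        have h5 := neg_abs_le n
        omega
      · rw [hK j (by omega), map_zero]
    simp [circleTerm, h1, h2]
  change ∑ᶠ j : ℕ, circleTerm n a b m j v = 0
  simp [key]

/-- The `n`-th circle product (`n ∈ ℤ`) on `QO(V)`, for purely even `V`: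
`a(w) ∘ₙ b(w) = Res_z a(z)b(w) ι_{|z|>|w|}(z-w)ⁿ - Res_z b(w)a(z) ι_{|w|>|z|}(z-w)ⁿ`.
Expanding the two binomials, its `m`-th Fourier mode is
`∑_{j ≥ 0} (-1)^j (n choose j) (a(n-j) b(m+j) - (-1)^n b(m+n-j) a(j))`. -/
def circle (n : ℤ) (a b : VertexOperator ℂ V) : VertexOperator ℂ V :=
  ofModes (circleMode n a b) (circleMode_truncation n a b)

/-- The Wick product `:ab: = a ∘₋₁ b`. -/
def wick (a b : VertexOperator ℂ V) : VertexOperator ℂ V := circle (-1) a b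

/-- The iterated Wick product `:a₁ a₂ ⋯ aₖ: = :a₁ (:a₂ ⋯ aₖ:):`, equal to `1` for `k = 0`. -/
def iteratedWick (l : List (VertexOperator ℂ V)) : VertexOperator ℂ V := l.foldr wick vac

/-- The normally ordered polynomials in the elements of `S` and their derivatives: the linear span
of all `:∂^{k₁} a₁ ⋯ ∂^{kₛ} aₛ:` with `s ≥ 0`, `kᵢ ≥ 0` and `aᵢ ∈ S`. -/
def normallyOrderedPolynomials (S : Set (VertexOperator ℂ V)) :
    Submodule ℂ (VertexOperator ℂ V) :=
  Submodule.span ℂ {x | ∃ l : List (ℕ × VertexOperator ℂ V), (∀ p ∈ l, p.2 ∈ S) ∧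
    x = iteratedWick (l.map fun p => deriv^[p.1] p.2)}

/-- `S` strongly generates the vertex algebra `A ⊆ QO(V)`: the iterated Wick products of elements
of `S` and their derivatives span `A`. -/
def StronglyGenerates (S : Set (VertexOperator ℂ V)) (A : Submodule ℂ (VertexOperator ℂ V)) :
    Prop :=
  normallyOrderedPolynomials S = A

/-- `S` strongly generates `A` and no proper subset of `S` does. -/
def IsMinimalStrongGeneratingSet (S : Set (VertexOperator ℂ V))
    (A : Submodule ℂ (VertexOperator ℂ V)) : Prop :=
  StronglyGenerates S A ∧ ∀ T, T ⊂ S → ¬ StronglyGenerates T A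

/-- The vertex algebra generated by `S`: the smallest linear subspace of `QO(V)` which contains `1`
and `S` and is closed under all circle products. -/
def generatedBy (S : Set (VertexOperator ℂ V)) : Submodule ℂ (VertexOperator ℂ V) :=
  sInf {A | vac ∈ A ∧ S ⊆ A ∧ ∀ a ∈ A, ∀ b ∈ A, ∀ n : ℤ, circle n a b ∈ A}

end Fields

/-- The rank `n` Fock space, the tensor product of `n` copies of `U(𝔥) ⊗_{U(𝔥_{≥0})} ℂ`. It is the
polynomial ring in the commuting operators `αⁱ(-k-1)`, `k ≥ 0`, which correspond to `X (i, k)`. -/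
abbrev Fock (n : ℕ) : Type := MvPolynomial (Fin n × ℕ) ℂ

/-- The operator `αⁱ(m)` on Fock space: multiplication by `X (i, -m-1)` for `m < 0`, and
`m ∂/∂X (i, m-1)` for `m > 0`, and `0` for `m = 0`. -/
def alphaMode (n : ℕ) (i : Fin n) (m : ℤ) : Module.End ℂ (Fock n) :=
  if m < 0 then LinearMap.mulLeft ℂ (MvPolynomial.X (i, (-m - 1).toNat))
  else (m : ℂ) • (MvPolynomial.pderiv (R := ℂ) (i, (m - 1).toNat)).toLinearMap

theorem alphaMode_truncation (n : ℕ) (i : Fin n) (p : Fock n) :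
    ∃ N : ℤ, ∀ m ≥ N, alphaMode n i m p = 0 := by
  obtain ⟨B, hB⟩ := (p.vars.image Prod.snd).bddAbove
  refine ⟨B + 2, fun m hm => ?_⟩
  have h0 : ¬ m < 0 := by omega
  have h1 : (i, (m - 1).toNat) ∉ p.vars := by
    intro h
    have : (m - 1).toNat ≤ B := hB (by
      simp only [Finset.coe_image, Set.mem_image, Finset.mem_coe]
      exact ⟨_, h, rfl⟩)
    omega
  have h2 : MvPolynomial.pderiv (i, (m - 1).toNat) p = 0 :=
    MvPolynomial.pderiv_eq_zero_of_notMem_vars h1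
  rw [alphaMode, if_neg h0]
  change (m : ℂ) • MvPolynomial.pderiv (i, (m - 1).toNat) p = 0
  rw [h2, smul_zero]

/-- The field `αⁱ(z) = ∑ αⁱ(m) z^(-m-1)`. -/
def alpha (n : ℕ) (i : Fin n) : VertexOperator ℂ (Fock n) :=
  ofModes (alphaMode n i) (alphaMode_truncation n i)

/-- The rank `n` Heisenberg vertex algebra `𝓗(n)`. -/
def heisenbergVA (n : ℕ) : Submodule ℂ (VertexOperator ℂ (Fock n)) :=
  generatedBy (Set.range (alpha n))

/-- The action of a matrix `g` on Fock space: `αⁱ(-k-1) ↦ ∑ₗ g l i αˡ(-k-1)`, extended to an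
algebra homomorphism. -/
def fockAction (n : ℕ) (g : Matrix (Fin n) (Fin n) ℂ) : Fock n →ₐ[ℂ] Fock n :=
  MvPolynomial.aeval fun p => ∑ l, MvPolynomial.C (g l p.1) * MvPolynomial.X (l, p.2)

/-- The invariant vertex algebra `𝓗(n)^{O(n)}` under the complex orthogonal group. An orthogonal
matrix `g` acts on `𝓗(n)` by conjugating Fourier modes by `fockAction n g`, that is, by the
automorphism with `αⁱ ↦ ∑ₗ g l i αˡ`; so a field is invariant if its modes commute with all
`fockAction n g`. -/
def invariantVA (n : ℕ) : Submodule ℂ (VertexOperator ℂ (Fock n)) where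
  carrier := {a | a ∈ heisenbergVA n ∧ ∀ g : Matrix (Fin n) (Fin n) ℂ, g.transpose * g = 1 →
    ∀ (m : ℤ) (p : Fock n), fockAction n g (mode a m p) = mode a m (fockAction n g p)}
  add_mem' := by
    rintro a b ⟨ha, ha'⟩ ⟨hb, hb'⟩
    refine ⟨add_mem ha hb, fun g hg m p => ?_⟩
    have h : mode (a + b) m = mode a m + mode b m :=
      congrFun (map_add VertexOperator.ncoeff a b) m
    rw [h, LinearMap.add_apply, LinearMap.add_apply, map_add, ha' g hg m p, hb' g hg m p]
  zero_mem' := by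
    refine ⟨zero_mem _, fun g _ m p => ?_⟩
    have h : mode (0 : VertexOperator ℂ (Fock n)) m = 0 :=
      congrFun (map_zero VertexOperator.ncoeff) m
    rw [h, LinearMap.zero_apply, LinearMap.zero_apply, map_zero]
  smul_mem' := by
    rintro c a ⟨ha, ha'⟩
    refine ⟨Submodule.smul_mem _ c ha, fun g hg m p => ?_⟩
    have h : mode (c • a) m = c • mode a m :=
      congrFun (map_smul VertexOperator.ncoeff c a) m
    rw [h, LinearMap.smul_apply, LinearMap.smul_apply, map_smul, ha' g hg m p]

/-- `ω_{a,b} = ∑ᵢ :∂ᵃαⁱ ∂ᵇαⁱ:`. -/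
def omega (n a b : ℕ) : VertexOperator ℂ (Fock n) :=
  ∑ i, wick (deriv^[a] (alpha n i)) (deriv^[b] (alpha n i))

/-- `j^k = ω_{0,k}`, used for even `k`. -/
def j (n k : ℕ) : VertexOperator ℂ (Fock n) := omega n 0 k

/-- The set `{j⁰, j², …, j^{n²+3n-2}}`; note that `n² + 3n` is even. -/
def jSet (n : ℕ) : Set (VertexOperator ℂ (Fock n)) :=
  {x | ∃ m : ℕ, 2 * m < n ^ 2 + 3 * n ∧ x = j n (2 * m)}

/-- There is a decoupling relation `j^k = P(j⁰, j², …, j^{n²+3n-2})`, where `P` is a normally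
ordered polynomial in `j⁰, j², …, j^{n²+3n-2}` and their derivatives. -/
def HasDecouplingRelation (n k : ℕ) : Prop :=
  j n k ∈ normallyOrderedPolynomials (jSet n)

end Heisenberg

end

/-! A field of 𝓗(n) is determined by its state a(-1)1: Dong's lemma makes all these fields local
with the αⁱ, and locality with translation covariance gives uniqueness (`eq_of_state_eq`). So
identities between normally ordered polynomials become identities between vectors, and a Wick
monomial in the ∂ᵏj^{2l} becomes, up to a product of factorials, a word in the creation modes
j^{2l}(-k-1) applied to 1. By the first fundamental theorem for O(n)
(`mem_quadAlgebra_of_invariant`) the invariant vectors are the polynomials in the scalar products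
`quad n a b`. Each creation mode is multiplication by a quadratic invariant plus a derivation, so
words in all the j^{2l} span the invariants.

A mode of j^{2l} that raises the weight by r ≥ 1 is encoded by a polynomial of degree 2l symmetric
about r/2 (`mode_j`), and symmetric polynomials of degree < 2l are spanned by those of the lower
j's. Counting degrees in the commutator formula `quadOp_bracket` gives two facts. A commutator of
creation modes only involves modes of proper derivatives (`gen_bracket`), and commuting with the
mode j²(1), which raises the weight by two and kills 1, raises the index l by at most one
(`raise_gen`).

Now let j^{2L} decouple, 2L = n² + 3n. By induction on R, all invariants of weight at most R are
words in the modes with l < L (`DecouplesUpTo.succ`). In weight R + 1 only quadratic invariants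
matter, and modulo translates from weight R they are multiples of `quad n 0 (R - 1)`. Applying j²(1)
to `quad n 0 (R - 3)`, written as a word with l < L, yields a nonzero multiple of it modulo
translates; the commutators produce at worst modes of j^{2L}, and these are removed because the
decoupling relation is an identity of fields, hence of all their modes. Thus the j^{2l} with l < L
strongly generate the invariants, and in particular every j^{2r} decouples.

For minimality, the scalar products of n vectors satisfy no relation of weight below (n + 1)(n + 2)
(`VanishesOnGram.eq_zero_of_weight`), while the generators have weight at most n² + 3n. Words are
noncommutative, but their symbols of top degree are products of quadratic invariants, and reordering
never creates the one-letter word j^{2m}(-1)1. A relation expressing one generator through the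
others would therefore give a relation in forbidden weight (`gen_one_notMem_wordSpan`). -/

noncomputable section

namespace Heisenberg

/-! ### Formal distributions, locality, and circle products as residues. -/

section Locality

variable {V : Type*} [AddCommGroup V] [Module ℂ V]

/-- Multiplication by the first variable of a formal distribution in two variables. -/
def shiftFst (W : Type*) [AddCommGroup W] [Module ℂ W] : Module.End ℂ (ℤ → ℤ → W) where
  toFun F p q := F (p + 1) q
  map_add' _ _ := rfl
  map_smul' _ _ := rfl

/-- Multiplication by the second variable of a formal distribution in two variables. -/
def shiftSnd (W : Type*) [AddCommGroup W] [Module ℂ W] : Module.End ℂ (ℤ → ℤ → W) where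
  toFun F p q := F p (q + 1)
  map_add' _ _ := rfl
  map_smul' _ _ := rfl

/-- Multiplication by `z - w` of a formal distribution in `z` and `w`. -/
def diffShift (W : Type*) [AddCommGroup W] [Module ℂ W] : Module.End ℂ (ℤ → ℤ → W) :=
  shiftFst W - shiftSnd W

theorem diffShift_apply {W : Type*} [AddCommGroup W] [Module ℂ W] (F : ℤ → ℤ → W) (p q : ℤ) :
    diffShift W F p q = F (p + 1) q - F p (q + 1) := rfl

theorem diffShift_pow_succ {W : Type*} [AddCommGroup W] [Module ℂ W] (N : ℕ) (F : ℤ → ℤ → W)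
    (p q : ℤ) : (diffShift W ^ (N + 1)) F p q =
      (diffShift W ^ N) F (p + 1) q - (diffShift W ^ N) F p (q + 1) := by
  rw [pow_succ', Module.End.mul_apply, diffShift_apply]

theorem diffShift_pow_map {W W' : Type*} [AddCommGroup W] [Module ℂ W] [AddCommGroup W']
    [Module ℂ W'] (L : W →ₗ[ℂ] W') (F : ℤ → ℤ → W) (N : ℕ) (p q : ℤ) :
    (diffShift W' ^ N) (fun p q => L (F p q)) p q = L ((diffShift W ^ N) F p q) := by
  induction N generalizing p q with
  | zero => rfl
  | succ N ih => rw [diffShift_pow_succ, diffShift_pow_succ, ih, ih, map_sub]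

theorem diffShift_pow_swap {W : Type*} [AddCommGroup W] [Module ℂ W] (F : ℤ → ℤ → W) (N : ℕ)
    (p q : ℤ) :
    (diffShift W ^ N) (fun p q => F q p) p q = (-1 : ℂ) ^ N • (diffShift W ^ N) F q p := by
  induction N generalizing p q with
  | zero => simp
  | succ N ih =>
    rw [diffShift_pow_succ, diffShift_pow_succ, ih, ih, pow_succ, ← smul_sub]
    rw [mul_smul, neg_one_smul, neg_sub]

/-- The commutator of two fields as a formal distribution. -/
def bracket (a b : VertexOperator ℂ V) : ℤ → ℤ → Module.End ℂ V :=
  fun p q => mode a p * mode b q - mode b q * mode a p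

/-- Two fields are local if some power `(z-w)^N` annihilates their commutator. -/
def IsLocal (a b : VertexOperator ℂ V) : Prop :=
  ∃ N : ℕ, (diffShift (Module.End ℂ V) ^ N) (bracket a b) = 0

theorem IsLocal.symm {a b : VertexOperator ℂ V} (h : IsLocal a b) : IsLocal b a := by
  obtain ⟨N, hN⟩ := h
  refine ⟨N, ?_⟩
  have : bracket b a = fun p q => (-LinearMap.id : Module.End ℂ V →ₗ[ℂ] _) (bracket a b q p) := by
    funext p q; simp [bracket]
  funext p q
  rw [this, diffShift_pow_map, diffShift_pow_swap, hN]
  simp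

theorem diffShift_pow_of_le {W : Type*} [AddCommGroup W] [Module ℂ W] {F : ℤ → ℤ → W} {N M : ℕ}
    (h : (diffShift W ^ N) F = 0) (hNM : N ≤ M) : (diffShift W ^ M) F = 0 := by
  rw [← Nat.sub_add_cancel hNM, pow_add, Module.End.mul_apply, h, map_zero]

theorem mode_add (a b : VertexOperator ℂ V) (m : ℤ) : mode (a + b) m = mode a m + mode b m :=
  congrFun (map_add VertexOperator.ncoeff a b) m

theorem mode_smul (c : ℂ) (a : VertexOperator ℂ V) (m : ℤ) : mode (c • a) m = c • mode a m :=
  congrFun (map_smul VertexOperator.ncoeff c a) m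

theorem mode_zero (m : ℤ) : mode (0 : VertexOperator ℂ V) m = 0 :=
  congrFun (map_zero VertexOperator.ncoeff) m

theorem mode_sum {ι : Type*} (s : Finset ι) (f : ι → VertexOperator ℂ V) (m : ℤ) :
    mode (∑ i ∈ s, f i) m = ∑ i ∈ s, mode (f i) m := by
  rw [mode, map_sum, Finset.sum_apply]

theorem ext_mode {a b : VertexOperator ℂ V} (h : ∀ m, mode a m = mode b m) : a = b := by
  apply HVertexOperator.coeff_inj
  funext m
  have := h (-m - 1)
  rwa [mode, mode, VertexOperator.ncoeff_apply, VertexOperator.ncoeff_apply,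
    show -(-m - 1) - 1 = m by ring] at this

theorem IsLocal.add_left {a b c : VertexOperator ℂ V} (h1 : IsLocal a c) (h2 : IsLocal b c) :
    IsLocal (a + b) c := by
  obtain ⟨N, hN⟩ := h1
  obtain ⟨M, hM⟩ := h2
  refine ⟨max N M, ?_⟩
  have : bracket (a + b) c = bracket a c + bracket b c := by
    funext p q
    simp only [bracket, mode_add, Pi.add_apply]
    noncomm_ring
  rw [this, map_add, diffShift_pow_of_le hN (le_max_left _ _),
    diffShift_pow_of_le hM (le_max_right _ _), add_zero]

theorem IsLocal.smul_left {a c : VertexOperator ℂ V} (h1 : IsLocal a c) (x : ℂ) :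
    IsLocal (x • a) c := by
  obtain ⟨N, hN⟩ := h1
  refine ⟨N, ?_⟩
  have : bracket (x • a) c = x • bracket a c := by
    funext p q
    simp [bracket, mode_smul, smul_sub]
  rw [this, map_smul, hN, smul_zero]

theorem isLocal_zero_left (c : VertexOperator ℂ V) : IsLocal 0 c :=
  ⟨0, by funext p q; simp [bracket, mode_zero]⟩

theorem mode_vac (m : ℤ) : mode (vac : VertexOperator ℂ V) m = if m = -1 then 1 else 0 :=
  ncoeff_ofModes _ _ m

theorem isLocal_vac_left (c : VertexOperator ℂ V) : IsLocal vac c :=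
  ⟨0, by
    funext p q
    by_cases h : p = -1 <;> simp [bracket, mode_vac, h]⟩

/-- The coefficient `(-1)^t (n choose t)` in the binomial expansion of `(z-w)^n`. -/
def binomCoeff (n : ℤ) (t : ℕ) : ℂ := (-1) ^ t * ((Ring.choose n t : ℤ) : ℂ)

theorem binomCoeff_zero (n : ℤ) : binomCoeff n 0 = 1 := by
  simp [binomCoeff]

theorem binomCoeff_succ (n : ℤ) (t : ℕ) :
    binomCoeff (n + 1) (t + 1) = binomCoeff n (t + 1) - binomCoeff n t := by
  simp only [binomCoeff, Ring.choose_succ_succ]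
  push_cast
  ring

theorem binomCoeff_mul_succ (n : ℤ) (t : ℕ) :
    ((t : ℂ) + 1) * binomCoeff n (t + 1) = -(((n : ℂ) - t) * binomCoeff n t) := by
  have h : (t + 1 : ℤ) * Ring.choose n (t + 1) = (n - t) * Ring.choose n t := by
    have := Ring.choose_smul_choose n (Nat.le_succ t)
    rw [Nat.succ_eq_add_one, Nat.choose_succ_self_right, Nat.add_sub_cancel_left,
      Ring.choose_one_right, nsmul_eq_mul] at this
    push_cast at this
    rw [this, mul_comm]
  have h' := congrArg (Int.cast : ℤ → ℂ) h
  push_cast at h'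
  simp only [binomCoeff, pow_succ]
  linear_combination (-(-1) ^ t) * h'

theorem finsum_eq_sum_range {W : Type*} [AddCommMonoid W] {f : ℕ → W} {K : ℕ}
    (h : ∀ t ≥ K, f t = 0) : ∑ᶠ t, f t = ∑ t ∈ Finset.range K, f t := by
  apply finsum_eq_sum_of_support_subset
  intro t ht
  by_contra h'
  exact ht (h t (by simpa using h'))

/-- Residue of `ι_{|z|>|w|} (z-w)^n F(z,w)`. -/
def resFst (n : ℤ) (F : ℤ → ℤ → V) (q : ℤ) : V :=
  ∑ᶠ t : ℕ, binomCoeff n t • F (n - t) (q + t)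

/-- Residue of `(-1)^n ι_{|w|>|z|} (z-w)^n F(z,w)`. -/
def resSnd (n : ℤ) (F : ℤ → ℤ → V) (q : ℤ) : V :=
  ∑ᶠ t : ℕ, binomCoeff n t • F t (q + n - t)

/-- The formal distributions in `z, w` with only finitely many negative powers of `w`. -/
def truncSnd (V : Type*) [AddCommGroup V] [Module ℂ V] : Submodule ℂ (ℤ → ℤ → V) where
  carrier := {F | ∃ Q : ℤ, ∀ q ≥ Q, ∀ p, F p q = 0}
  add_mem' := by
    rintro F G ⟨Q, hQ⟩ ⟨Q', hQ'⟩
    refine ⟨max Q Q', fun q hq p => ?_⟩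
    simp [hQ q (by omega) p, hQ' q (by omega) p]
  zero_mem' := ⟨0, fun _ _ _ => rfl⟩
  smul_mem' := by
    rintro c F ⟨Q, hQ⟩
    exact ⟨Q, fun q hq p => by simp [hQ q hq p]⟩

/-- The formal distributions in `z, w` with only finitely many negative powers of `z`. -/
def truncFst (V : Type*) [AddCommGroup V] [Module ℂ V] : Submodule ℂ (ℤ → ℤ → V) where
  carrier := {F | ∃ P : ℤ, ∀ p ≥ P, ∀ q, F p q = 0}
  add_mem' := by
    rintro F G ⟨Q, hQ⟩ ⟨Q', hQ'⟩
    refine ⟨max Q Q', fun q hq p => ?_⟩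
    simp [hQ q (by omega) p, hQ' q (by omega) p]
  zero_mem' := ⟨0, fun _ _ _ => rfl⟩
  smul_mem' := by
    rintro c F ⟨Q, hQ⟩
    exact ⟨Q, fun q hq p => by simp [hQ q hq p]⟩

theorem resFst_eq_sum {F : ℤ → ℤ → V} (hF : F ∈ truncSnd V) (n q : ℤ) :
    ∃ K : ℕ, ∀ K' ≥ K, resFst n F q =
      ∑ t ∈ Finset.range K', binomCoeff n t • F (n - t) (q + t) := by
  obtain ⟨Q, hQ⟩ := hF
  refine ⟨(Q - q).toNat, fun K' hK' => finsum_eq_sum_range fun t ht => ?_⟩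
  rw [hQ _ (by omega), smul_zero]

theorem resSnd_eq_sum {F : ℤ → ℤ → V} (hF : F ∈ truncFst V) (n q : ℤ) :
    ∃ K : ℕ, ∀ K' ≥ K, resSnd n F q =
      ∑ t ∈ Finset.range K', binomCoeff n t • F t (q + n - t) := by
  obtain ⟨Q, hQ⟩ := hF
  refine ⟨Q.toNat, fun K' hK' => finsum_eq_sum_range fun t ht => ?_⟩
  rw [hQ _ (by omega), smul_zero]

theorem resFst_sub {F G : ℤ → ℤ → V} (hF : F ∈ truncSnd V) (hG : G ∈ truncSnd V) (n q : ℤ) :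
    resFst n (F - G) q = resFst n F q - resFst n G q := by
  obtain ⟨K1, h1⟩ := resFst_eq_sum hF n q
  obtain ⟨K2, h2⟩ := resFst_eq_sum hG n q
  obtain ⟨K3, h3⟩ := resFst_eq_sum (Submodule.sub_mem _ hF hG) n q
  rw [h1 (K1 + K2 + K3) (by omega), h2 (K1 + K2 + K3) (by omega), h3 (K1 + K2 + K3) (by omega),
    ← Finset.sum_sub_distrib]
  exact Finset.sum_congr rfl fun t _ => smul_sub _ _ _

theorem resSnd_sub {F G : ℤ → ℤ → V} (hF : F ∈ truncFst V) (hG : G ∈ truncFst V) (n q : ℤ) :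
    resSnd n (F - G) q = resSnd n F q - resSnd n G q := by
  obtain ⟨K1, h1⟩ := resSnd_eq_sum hF n q
  obtain ⟨K2, h2⟩ := resSnd_eq_sum hG n q
  obtain ⟨K3, h3⟩ := resSnd_eq_sum (Submodule.sub_mem _ hF hG) n q
  rw [h1 (K1 + K2 + K3) (by omega), h2 (K1 + K2 + K3) (by omega), h3 (K1 + K2 + K3) (by omega),
    ← Finset.sum_sub_distrib]
  exact Finset.sum_congr rfl fun t _ => smul_sub _ _ _

/-- Coefficient form of (z-w)(z-w)ⁿ = (z-w)ⁿ⁺¹, by Pascal's rule. The second sum is one term shorter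
because its terms are shifted by one. -/
theorem sum_binomCoeff_telescope (n : ℤ) (G : ℕ → V) (K : ℕ) :
    ∑ t ∈ Finset.range (K + 1), binomCoeff n t • G t -
      ∑ t ∈ Finset.range K, binomCoeff n t • G (t + 1) =
      ∑ t ∈ Finset.range (K + 1), binomCoeff (n + 1) t • G t := by
  rw [Finset.sum_range_succ', Finset.sum_range_succ' (fun t => binomCoeff (n + 1) t • G t),
    add_sub_right_comm, ← Finset.sum_sub_distrib]
  simp only [binomCoeff_zero, binomCoeff_succ, sub_smul]

theorem shiftFst_mem_truncSnd {F : ℤ → ℤ → V} (hF : F ∈ truncSnd V) :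
    shiftFst V F ∈ truncSnd V := by
  obtain ⟨Q, hQ⟩ := hF
  exact ⟨Q, fun q hq p => hQ q hq (p + 1)⟩

theorem shiftSnd_mem_truncSnd {F : ℤ → ℤ → V} (hF : F ∈ truncSnd V) :
    shiftSnd V F ∈ truncSnd V := by
  obtain ⟨Q, hQ⟩ := hF
  exact ⟨Q, fun q hq p => hQ (q + 1) (by omega) p⟩

theorem shiftFst_mem_truncFst {F : ℤ → ℤ → V} (hF : F ∈ truncFst V) :
    shiftFst V F ∈ truncFst V := by
  obtain ⟨Q, hQ⟩ := hF
  exact ⟨Q, fun q hq p => hQ (q + 1) (by omega) p⟩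

theorem shiftSnd_mem_truncFst {F : ℤ → ℤ → V} (hF : F ∈ truncFst V) :
    shiftSnd V F ∈ truncFst V := by
  obtain ⟨Q, hQ⟩ := hF
  exact ⟨Q, fun q hq p => hQ q hq (p + 1)⟩

theorem resFst_diffShift {F : ℤ → ℤ → V} (hF : F ∈ truncSnd V) (n q : ℤ) :
    resFst n (diffShift V F) q = resFst (n + 1) F q := by
  obtain ⟨K1, h1⟩ := resFst_eq_sum (shiftFst_mem_truncSnd hF) n q
  obtain ⟨K2, h2⟩ := resFst_eq_sum (shiftSnd_mem_truncSnd hF) n q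
  obtain ⟨K3, h3⟩ := resFst_eq_sum hF (n + 1) q
  rw [diffShift, LinearMap.sub_apply,
    resFst_sub (shiftFst_mem_truncSnd hF) (shiftSnd_mem_truncSnd hF),
    h1 (K1 + K2 + K3 + 1) (by omega), h2 (K1 + K2 + K3) (by omega),
    h3 (K1 + K2 + K3 + 1) (by omega),
    ← sum_binomCoeff_telescope n fun t => F (n + 1 - t) (q + t)]
  congr 1
  · refine Finset.sum_congr rfl fun t _ => ?_
    change binomCoeff n t • F (n - t + 1) (q + t) = _
    rw [show n - (t : ℤ) + 1 = n + 1 - t by ring]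
  · refine Finset.sum_congr rfl fun t _ => ?_
    change binomCoeff n t • F (n - t) (q + t + 1) = _
    push_cast
    rw [show n + 1 - ((t : ℤ) + 1) = n - t by ring, add_assoc]

/-- The minus sign comes from the factor (-1)ⁿ in the normalisation of `resSnd`, which changes sign
when n becomes n + 1. -/
theorem resSnd_diffShift {F : ℤ → ℤ → V} (hF : F ∈ truncFst V) (n q : ℤ) :
    resSnd n (diffShift V F) q = -resSnd (n + 1) F q := by
  obtain ⟨K1, h1⟩ := resSnd_eq_sum (shiftFst_mem_truncFst hF) n q
  obtain ⟨K2, h2⟩ := resSnd_eq_sum (shiftSnd_mem_truncFst hF) n q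
  obtain ⟨K3, h3⟩ := resSnd_eq_sum hF (n + 1) q
  rw [diffShift, LinearMap.sub_apply,
    resSnd_sub (shiftFst_mem_truncFst hF) (shiftSnd_mem_truncFst hF),
    h1 (K1 + K2 + K3) (by omega), h2 (K1 + K2 + K3 + 1) (by omega),
    h3 (K1 + K2 + K3 + 1) (by omega),
    ← sum_binomCoeff_telescope n fun t => F t (q + (n + 1) - t), neg_sub]
  congr 1
  · refine Finset.sum_congr rfl fun t _ => ?_
    change binomCoeff n t • F (t + 1) (q + n - t) = _
    push_cast
    rw [show q + (n + 1) - ((t : ℤ) + 1) = q + n - t by ring]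
  · refine Finset.sum_congr rfl fun t _ => ?_
    change binomCoeff n t • F t (q + n - t + 1) = _
    rw [show q + n - (t : ℤ) + 1 = q + (n + 1) - t by ring]

theorem circleMode_apply (n : ℤ) (a b : VertexOperator ℂ V) (m : ℤ) (v : V) :
    circleMode n a b m v = resFst n (fun p q => mode a p (mode b q v)) m -
      (-1 : ℂ) ^ n • resSnd n (fun p q => mode b q (mode a p v)) m := by
  obtain ⟨N, hN⟩ := exists_truncation a v
  obtain ⟨M, hM⟩ := exists_truncation b v
  obtain ⟨K, hK⟩ := circleTerm_eventually n a b m v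
  obtain ⟨K1, h1⟩ := resFst_eq_sum (F := fun p q => mode a p (mode b q v))
    ⟨M, fun q hq p => by simp [hM q hq]⟩ n m
  obtain ⟨K2, h2⟩ := resSnd_eq_sum (F := fun p q => mode b q (mode a p v))
    ⟨N, fun q hq p => by simp [hN q hq]⟩ n m
  rw [h1 (K + K1 + K2) (by omega), h2 (K + K1 + K2) (by omega)]
  change ∑ᶠ j : ℕ, circleTerm n a b m j v = _
  rw [finsum_eq_sum_range (K := K + K1 + K2) fun t ht => hK t (by omega), Finset.smul_sum,
    ← Finset.sum_sub_distrib]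
  refine Finset.sum_congr rfl fun t _ => ?_
  simp only [circleTerm, binomCoeff, LinearMap.smul_apply, LinearMap.sub_apply,
    Module.End.mul_apply, smul_sub]
  rw [smul_comm ((-1 : ℂ) ^ n)]

theorem mode_circle (n : ℤ) (a b : VertexOperator ℂ V) (m : ℤ) :
    mode (circle n a b) m = circleMode n a b m :=
  ncoeff_ofModes _ _ m

theorem exists_mode_circle_apply (n : ℤ) (a b : VertexOperator ℂ V) (m : ℤ) (v : V) :
    ∃ K : ℕ, ∀ K' ≥ K, mode (circle n a b) m v = ∑ t ∈ Finset.range K', binomCoeff n t •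
      (mode a (n - t) (mode b (m + t) v) -
        (-1 : ℂ) ^ n • mode b (m + n - t) (mode a (t : ℤ) v)) := by
  obtain ⟨K, hK⟩ := circleTerm_eventually n a b m v
  refine ⟨K, fun K' h => ?_⟩
  rw [mode_circle]
  change ∑ᶠ j : ℕ, circleTerm n a b m j v = _
  exact finsum_eq_sum_range fun t ht => hK t (by omega)

end Locality

/-! ### Dong's lemma. -/

section Dong

variable {V : Type*} [AddCommGroup V] [Module ℂ V]

/-- Multiplication by `z - w` of a formal distribution in `z, w, u`. -/
def diffFstSnd (V : Type*) [AddCommGroup V] [Module ℂ V] : Module.End ℂ (ℤ → ℤ → ℤ → V) where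
  toFun F p q r := F (p + 1) q r - F p (q + 1) r
  map_add' F G := by funext p q r; simp only [Pi.add_apply]; abel
  map_smul' c F := by funext p q r; simp [smul_sub]

/-- Multiplication by `z - u` of a formal distribution in `z, w, u`. -/
def diffFstThd (V : Type*) [AddCommGroup V] [Module ℂ V] : Module.End ℂ (ℤ → ℤ → ℤ → V) where
  toFun F p q r := F (p + 1) q r - F p q (r + 1)
  map_add' F G := by funext p q r; simp only [Pi.add_apply]; abel
  map_smul' c F := by funext p q r; simp [smul_sub]

/-- Multiplication by `w - u` of a formal distribution in `z, w, u`. -/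
def diffSndThd (V : Type*) [AddCommGroup V] [Module ℂ V] : Module.End ℂ (ℤ → ℤ → ℤ → V) where
  toFun F p q r := F p (q + 1) r - F p q (r + 1)
  map_add' F G := by funext p q r; simp only [Pi.add_apply]; abel
  map_smul' c F := by funext p q r; simp [smul_sub]

theorem diffSndThd_eq : diffSndThd V = diffFstThd V - diffFstSnd V := by
  ext F p q r
  simp only [diffSndThd, diffFstThd, diffFstSnd, LinearMap.coe_mk, AddHom.coe_mk,
    LinearMap.sub_apply, Pi.sub_apply]
  abel

theorem commute_diffFstSnd_diffFstThd : Commute (diffFstSnd V) (diffFstThd V) := by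
  ext F p q r
  simp only [diffFstThd, diffFstSnd, Module.End.mul_apply, LinearMap.coe_mk, AddHom.coe_mk]
  abel

theorem commute_diffFstSnd_diffSndThd : Commute (diffFstSnd V) (diffSndThd V) := by
  rw [diffSndThd_eq]
  exact commute_diffFstSnd_diffFstThd.sub_right (Commute.refl _)

theorem commute_diffFstThd_diffSndThd : Commute (diffFstThd V) (diffSndThd V) := by
  rw [diffSndThd_eq]
  exact (Commute.refl _).sub_right commute_diffFstSnd_diffFstThd.symm

theorem diffFstSnd_pow_apply (F : ℤ → ℤ → ℤ → V) (N : ℕ) (p q r : ℤ) :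
    (diffFstSnd V ^ N) F p q r = (diffShift V ^ N) (fun p q => F p q r) p q := by
  induction N generalizing p q with
  | zero => rfl
  | succ N ih => rw [diffShift_pow_succ, ← ih, ← ih, pow_succ']; rfl

theorem diffFstThd_pow_apply (F : ℤ → ℤ → ℤ → V) (N : ℕ) (p q r : ℤ) :
    (diffFstThd V ^ N) F p q r = (diffShift V ^ N) (fun p r => F p q r) p r := by
  induction N generalizing p r with
  | zero => rfl
  | succ N ih => rw [diffShift_pow_succ, ← ih, ← ih, pow_succ']; rfl

theorem diffSndThd_pow_apply (F : ℤ → ℤ → ℤ → V) (N : ℕ) (p q r : ℤ) :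
    (diffSndThd V ^ N) F p q r = (diffShift V ^ N) (fun q r => F p q r) q r := by
  induction N generalizing q r with
  | zero => rfl
  | succ N ih => rw [diffShift_pow_succ, ← ih, ← ih, pow_succ']; rfl

/-- Pairs of formal distributions in `z, w, u` for which the residue in `z` of their product with
the two expansions of `(z-w)^n` is defined. -/
def residuePairs (V : Type*) [AddCommGroup V] [Module ℂ V] :
    Submodule ℂ ((ℤ → ℤ → ℤ → V) × (ℤ → ℤ → ℤ → V)) where
  carrier := {X | ∀ r, (fun p q => X.1 p q r) ∈ truncSnd V ∧ (fun p q => X.2 p q r) ∈ truncFst V}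
  add_mem' hX hY r := ⟨add_mem (hX r).1 (hY r).1, add_mem (hX r).2 (hY r).2⟩
  zero_mem' _ := ⟨zero_mem _, zero_mem _⟩
  smul_mem' c _ hX r := ⟨Submodule.smul_mem _ c (hX r).1, Submodule.smul_mem _ c (hX r).2⟩

theorem diffFstSnd_mem_residuePairs {X : (ℤ → ℤ → ℤ → V) × (ℤ → ℤ → ℤ → V)}
    (hX : X ∈ residuePairs V) : (diffFstSnd V X.1, diffFstSnd V X.2) ∈ residuePairs V :=
  fun r => ⟨sub_mem (shiftFst_mem_truncSnd (hX r).1) (shiftSnd_mem_truncSnd (hX r).1),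
    sub_mem (shiftFst_mem_truncFst (hX r).2) (shiftSnd_mem_truncFst (hX r).2)⟩

theorem diffFstThd_mem_residuePairs {X : (ℤ → ℤ → ℤ → V) × (ℤ → ℤ → ℤ → V)}
    (hX : X ∈ residuePairs V) : (diffFstThd V X.1, diffFstThd V X.2) ∈ residuePairs V :=
  fun r => ⟨sub_mem (shiftFst_mem_truncSnd (hX r).1) (hX (r + 1)).1,
    sub_mem (shiftFst_mem_truncFst (hX r).2) (hX (r + 1)).2⟩

theorem diffSndThd_mem_residuePairs {X : (ℤ → ℤ → ℤ → V) × (ℤ → ℤ → ℤ → V)}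
    (hX : X ∈ residuePairs V) : (diffSndThd V X.1, diffSndThd V X.2) ∈ residuePairs V :=
  fun r => ⟨sub_mem (shiftSnd_mem_truncSnd (hX r).1) (hX (r + 1)).1,
    sub_mem (shiftSnd_mem_truncFst (hX r).2) (hX (r + 1)).2⟩

theorem pow_mem_residuePairs {f : Module.End ℂ (ℤ → ℤ → ℤ → V)}
    (hf : ∀ X ∈ residuePairs V, (f X.1, f X.2) ∈ residuePairs V) (N : ℕ)
    {X : (ℤ → ℤ → ℤ → V) × (ℤ → ℤ → ℤ → V)} (hX : X ∈ residuePairs V) :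
    ((f ^ N) X.1, (f ^ N) X.2) ∈ residuePairs V := by
  induction N with
  | zero => exact hX
  | succ N ih =>
    rw [pow_succ']
    exact hf _ ih

/-- The residue in `z` of `(z-w)^n X`, for the two expansions of `(z-w)^n`. -/
def residue (n : ℤ) (X : (ℤ → ℤ → ℤ → V) × (ℤ → ℤ → ℤ → V)) (q r : ℤ) : V :=
  resFst n (fun p q => X.1 p q r) q - (-1 : ℂ) ^ n • resSnd n (fun p q => X.2 p q r) q

theorem residue_sub {X Y : (ℤ → ℤ → ℤ → V) × (ℤ → ℤ → ℤ → V)} (hX : X ∈ residuePairs V)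
    (hY : Y ∈ residuePairs V) (n : ℤ) : residue n (X - Y) = residue n X - residue n Y := by
  funext q r
  have h1 := resFst_sub (hX r).1 (hY r).1 n q
  have h2 := resSnd_sub (hX r).2 (hY r).2 n q
  change resFst n ((fun p q => X.1 p q r) - fun p q => Y.1 p q r) q -
    (-1 : ℂ) ^ n • resSnd n ((fun p q => X.2 p q r) - fun p q => Y.2 p q r) q = _
  rw [h1, h2, Pi.sub_apply, Pi.sub_apply, residue, residue, smul_sub]
  abel

theorem residue_diffFstSnd {X : (ℤ → ℤ → ℤ → V) × (ℤ → ℤ → ℤ → V)} (hX : X ∈ residuePairs V)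
    (n : ℤ) : residue n (diffFstSnd V X.1, diffFstSnd V X.2) = residue (n + 1) X := by
  funext q r
  have h1 := resFst_diffShift (hX r).1 n q
  have h2 := resSnd_diffShift (hX r).2 n q
  change resFst n (diffShift V fun p q => X.1 p q r) q -
    (-1 : ℂ) ^ n • resSnd n (diffShift V fun p q => X.2 p q r) q = _
  rw [h1, h2, residue, zpow_add_one₀ (by norm_num)]
  simp

theorem residue_diffFstSnd_pow {X : (ℤ → ℤ → ℤ → V) × (ℤ → ℤ → ℤ → V)} (hX : X ∈ residuePairs V)
    (n : ℤ) (s : ℕ) :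
    residue n ((diffFstSnd V ^ s) X.1, (diffFstSnd V ^ s) X.2) = residue (n + s) X := by
  induction s generalizing n with
  | zero => simp
  | succ s ih =>
    have := residue_diffFstSnd (pow_mem_residuePairs (fun X hX => diffFstSnd_mem_residuePairs hX)
      s hX) n
    rw [pow_succ', Module.End.mul_apply, Module.End.mul_apply, this, ih]
    push_cast
    rw [add_assoc, add_comm 1]

theorem binomCoeff_zero_left (t : ℕ) : binomCoeff 0 t = if t = 0 then 1 else 0 := by
  rw [binomCoeff, Ring.choose_zero_ite]
  split_ifs with h <;> simp [h]

theorem residue_zero (X : (ℤ → ℤ → ℤ → V) × (ℤ → ℤ → ℤ → V)) (q r : ℤ) :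
    residue 0 X q r = X.1 0 q r - X.2 0 q r := by
  rw [residue, resFst, resSnd, finsum_eq_single _ 0, finsum_eq_single _ 0]
  · simp [binomCoeff_zero_left]
  · intro t ht; simp [binomCoeff_zero_left, ht]
  · intro t ht; simp [binomCoeff_zero_left, ht]

/-- For a nonnegative exponent n + s both expansions of (z-w)ⁿ⁺ˢ are the same polynomial, so the
residue only sees the difference of the two components, which (z-w)ᴺ kills. -/
theorem residue_eq_zero_of_le {X : (ℤ → ℤ → ℤ → V) × (ℤ → ℤ → ℤ → V)} (hX : X ∈ residuePairs V)
    {N : ℕ} (h : (diffFstSnd V ^ N) (X.1 - X.2) = 0) {n : ℤ} {s : ℕ} (hs : N ≤ n + s) :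
    residue n ((diffFstSnd V ^ s) X.1, (diffFstSnd V ^ s) X.2) = 0 := by
  rw [residue_diffFstSnd_pow hX]
  obtain ⟨k, hk⟩ : ∃ k : ℕ, n + s = 0 + (k : ℤ) := ⟨(n + s).toNat, by omega⟩
  rw [hk, ← residue_diffFstSnd_pow hX]
  funext q r
  rw [residue_zero]
  change ((diffFstSnd V ^ k) X.1 - (diffFstSnd V ^ k) X.2) 0 q r = 0
  rw [← map_sub, ← Nat.sub_add_cancel (show N ≤ k by omega), pow_add, Module.End.mul_apply, h,
    map_zero]
  rfl

theorem residue_diffSndThd {X : (ℤ → ℤ → ℤ → V) × (ℤ → ℤ → ℤ → V)} (hX : X ∈ residuePairs V)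
    (n : ℤ) : residue n (diffSndThd V X.1, diffSndThd V X.2) = diffShift V (residue n X) := by
  funext q r
  have h1 := resFst_sub (shiftSnd_mem_truncSnd (hX r).1) (hX (r + 1)).1 n q
  have h2 := resSnd_sub (shiftSnd_mem_truncFst (hX r).2) (hX (r + 1)).2 n q
  change resFst n (shiftSnd V (fun p q => X.1 p q r) - fun p q => X.1 p q (r + 1)) q -
    (-1 : ℂ) ^ n • resSnd n (shiftSnd V (fun p q => X.2 p q r) - fun p q => X.2 p q (r + 1)) q = _
  rw [h1, h2]
  have h3 : ∀ F : ℤ → ℤ → V, resFst n (shiftSnd V F) q = resFst n F (q + 1) := by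
    intro F
    refine finsum_congr fun t => ?_
    change binomCoeff n t • F (n - t) (q + t + 1) = _
    rw [add_right_comm]
  have h4 : ∀ F : ℤ → ℤ → V, resSnd n (shiftSnd V F) q = resSnd n F (q + 1) := by
    intro F
    refine finsum_congr fun t => ?_
    change binomCoeff n t • F t (q + n - t + 1) = _
    rw [show q + n - (t : ℤ) + 1 = q + 1 + n - t by ring]
  rw [h3, h4, diffShift_apply, residue, residue, smul_sub]
  abel

theorem residue_diffSndThd_pow {X : (ℤ → ℤ → ℤ → V) × (ℤ → ℤ → ℤ → V)} (hX : X ∈ residuePairs V)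
    (n : ℤ) (s : ℕ) : residue n ((diffSndThd V ^ s) X.1, (diffSndThd V ^ s) X.2) =
      (diffShift V ^ s) (residue n X) := by
  induction s with
  | zero => rfl
  | succ s ih =>
    have := residue_diffSndThd (pow_mem_residuePairs (fun X hX => diffSndThd_mem_residuePairs hX)
      s hX) n
    rw [pow_succ', Module.End.mul_apply, Module.End.mul_apply, this, ih, pow_succ',
      Module.End.mul_apply]

/-- The core of Dong's lemma. -/
theorem exists_diffShift_pow_residue_eq_zero {X : (ℤ → ℤ → ℤ → V) × (ℤ → ℤ → ℤ → V)}
    (hX : X ∈ residuePairs V) {N : ℕ} (h12 : (diffFstSnd V ^ N) (X.1 - X.2) = 0)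
    (h1 : (diffFstThd V ^ N) ((diffSndThd V ^ N) X.1) = 0)
    (h2 : (diffFstThd V ^ N) ((diffSndThd V ^ N) X.2) = 0) (n : ℤ) :
    (diffShift V ^ (N + (N + (N - n).toNat))) (residue n X) = 0 := by
  -- The product (z-w)ⁱ(z-u)ʲ(w-u)ᵏ is treated by induction on k, trading w-u for (z-u) - (z-w). At
  -- k = 0, either j ≥ N and `h1`, `h2` apply, or j < N forces n + i ≥ N and `h12` applies. The
  -- extra factor (w-u)ᴺ is what `h1` and `h2` need.
  have key : ∀ k i j : ℕ, N + (N - n).toNat ≤ i + j + k →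
      residue n ((diffFstSnd V ^ i * diffFstThd V ^ j * diffSndThd V ^ k * diffSndThd V ^ N) X.1,
        (diffFstSnd V ^ i * diffFstThd V ^ j * diffSndThd V ^ k * diffSndThd V ^ N) X.2) = 0 := by
    intro k
    induction k with
    | zero =>
      intro i j hij
      by_cases hj : N ≤ j
      · have h0 : ∀ F, (diffFstThd V ^ N) ((diffSndThd V ^ N) F) = 0 →
            (diffFstSnd V ^ i * diffFstThd V ^ j * diffSndThd V ^ 0 * diffSndThd V ^ N) F = 0 := by
          intro F hF
          rw [pow_zero, mul_one, ← Nat.sub_add_cancel hj, pow_add]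
          simp only [Module.End.mul_apply, hF, map_zero]
        rw [h0 _ h1, h0 _ h2]
        funext q r
        simp [residue, resFst, resSnd]
      · have hX' := pow_mem_residuePairs (fun X hX => diffFstThd_mem_residuePairs hX) j
          (pow_mem_residuePairs (fun X hX => diffSndThd_mem_residuePairs hX) N hX)
        simp only [pow_zero, mul_one, mul_assoc, Module.End.mul_apply]
        refine residue_eq_zero_of_le hX' (N := N) ?_ (by omega)
        rw [← map_sub, ← map_sub, ← Module.End.mul_apply, ← Module.End.mul_apply,
          ((commute_diffFstSnd_diffFstThd (V := V)).pow_pow N j).eq, mul_assoc,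
          ((commute_diffFstSnd_diffSndThd (V := V)).pow_pow N N).eq]
        simp only [Module.End.mul_apply, h12, map_zero]
    | succ k ih =>
      intro i j hij
      have hc1 : Commute (diffFstThd V) (diffSndThd V ^ k) :=
        commute_diffFstThd_diffSndThd.pow_right k
      have hc2 : Commute (diffFstSnd V) (diffFstThd V ^ j * diffSndThd V ^ k) :=
        (commute_diffFstSnd_diffFstThd.pow_right j).mul_right
          (commute_diffFstSnd_diffSndThd.pow_right k)
      have hsplit : diffFstSnd V ^ i * diffFstThd V ^ j * diffSndThd V ^ (k + 1) *
          diffSndThd V ^ N =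
          diffFstSnd V ^ i * diffFstThd V ^ (j + 1) * diffSndThd V ^ k * diffSndThd V ^ N -
          diffFstSnd V ^ (i + 1) * diffFstThd V ^ j * diffSndThd V ^ k * diffSndThd V ^ N := by
        have e1 : diffFstThd V ^ (j + 1) * diffSndThd V ^ k =
            diffFstThd V ^ j * diffSndThd V ^ k * diffFstThd V := by
          rw [pow_succ, mul_assoc, hc1.eq, mul_assoc]
        have e2 : diffFstSnd V ^ (i + 1) * diffFstThd V ^ j * diffSndThd V ^ k =
            diffFstSnd V ^ i * (diffFstThd V ^ j * diffSndThd V ^ k * diffFstSnd V) := by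
          rw [pow_succ, mul_assoc, mul_assoc, hc2.eq]
        rw [e2, mul_assoc (diffFstSnd V ^ i) _ (diffSndThd V ^ k), e1, pow_succ]
        nth_rw 2 [diffSndThd_eq]
        simp only [mul_assoc, mul_sub, sub_mul]
      have hmem : ∀ i j, ((diffFstSnd V ^ i * diffFstThd V ^ j * diffSndThd V ^ k *
          diffSndThd V ^ N) X.1, (diffFstSnd V ^ i * diffFstThd V ^ j * diffSndThd V ^ k *
          diffSndThd V ^ N) X.2) ∈ residuePairs V := fun i j =>
        pow_mem_residuePairs (fun X hX => diffFstSnd_mem_residuePairs hX) i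
          (pow_mem_residuePairs (fun X hX => diffFstThd_mem_residuePairs hX) j
            (pow_mem_residuePairs (fun X hX => diffSndThd_mem_residuePairs hX) k
              (pow_mem_residuePairs (fun X hX => diffSndThd_mem_residuePairs hX) N hX)))
      have := residue_sub (hmem i (j + 1)) (hmem (i + 1) j) n
      rw [ih i (j + 1) (by omega), ih (i + 1) j (by omega), sub_zero] at this
      rw [hsplit]
      exact this
  have := key (N + (N - n).toNat) 0 0 (by omega)
  rw [← residue_diffSndThd_pow hX, ← this]
  simp only [pow_zero, one_mul, ← pow_add, add_comm N (N + (N - n).toNat)]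

theorem map_resFst {W : Type*} [AddCommGroup W] [Module ℂ W] (L : V →ₗ[ℂ] W) {F : ℤ → ℤ → V}
    (hF : F ∈ truncSnd V) (n q : ℤ) :
    L (resFst n F q) = resFst n (fun p q => L (F p q)) q := by
  obtain ⟨K1, h1⟩ := resFst_eq_sum hF n q
  have hF' : (fun p q => L (F p q)) ∈ truncSnd W := by
    obtain ⟨Q, hQ⟩ := hF
    exact ⟨Q, fun q hq p => by simp [hQ q hq p]⟩
  obtain ⟨K2, h2⟩ := resFst_eq_sum hF' n q
  rw [h1 (K1 + K2) (by omega), h2 (K1 + K2) (by omega), map_sum]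
  simp only [map_smul]

theorem map_resSnd {W : Type*} [AddCommGroup W] [Module ℂ W] (L : V →ₗ[ℂ] W) {F : ℤ → ℤ → V}
    (hF : F ∈ truncFst V) (n q : ℤ) :
    L (resSnd n F q) = resSnd n (fun p q => L (F p q)) q := by
  obtain ⟨K1, h1⟩ := resSnd_eq_sum hF n q
  have hF' : (fun p q => L (F p q)) ∈ truncFst W := by
    obtain ⟨Q, hQ⟩ := hF
    exact ⟨Q, fun q hq p => by simp [hQ q hq p]⟩
  obtain ⟨K2, h2⟩ := resSnd_eq_sum hF' n q
  rw [h1 (K1 + K2) (by omega), h2 (K1 + K2) (by omega), map_sum]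
  simp only [map_smul]

theorem mode_mode_mem_truncSnd (a b : VertexOperator ℂ V) (v : V) :
    (fun p q => mode a p (mode b q v)) ∈ truncSnd V := by
  obtain ⟨M, hM⟩ := exists_truncation b v
  exact ⟨M, fun q hq p => by simp [hM q hq]⟩

theorem mode_mode_mem_truncFst (a b : VertexOperator ℂ V) (v : V) :
    (fun p q => mode b q (mode a p v)) ∈ truncFst V := by
  obtain ⟨M, hM⟩ := exists_truncation a v
  exact ⟨M, fun q hq p => by simp [hM q hq]⟩

theorem bracket_pow_apply {a b : VertexOperator ℂ V} {N : ℕ}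
    (h : (diffShift (Module.End ℂ V) ^ N) (bracket a b) = 0)
    (L : Module.End ℂ V →ₗ[ℂ] V) (p q : ℤ) :
    (diffShift V ^ N) (fun p q => L (bracket a b p q)) p q = 0 := by
  rw [diffShift_pow_map, h]
  simp

/-- **Dong's lemma**. -/
theorem IsLocal.circle {a b c : VertexOperator ℂ V} (hab : IsLocal a b) (hac : IsLocal a c)
    (hbc : IsLocal b c) (n : ℤ) : IsLocal (circle n a b) c := by
  obtain ⟨N1, h1⟩ := hab
  obtain ⟨N2, h2⟩ := hac
  obtain ⟨N3, h3⟩ := hbc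
  obtain ⟨N, hN1, hN2, hN3⟩ : ∃ N, N1 ≤ N ∧ N2 ≤ N ∧ N3 ≤ N := ⟨N1 + N2 + N3, by omega⟩
  replace h1 := diffShift_pow_of_le h1 hN1
  replace h2 := diffShift_pow_of_le h2 hN2
  replace h3 := diffShift_pow_of_le h3 hN3
  refine ⟨N + (N + (N - n).toNat), ?_⟩
  funext q r
  ext v
  -- The components are [ab, c] and [ba, c] applied to v. Their difference only involves [a, b],
  -- while the Leibniz rule splits each one into a term with [a, c] and a term with [b, c].
  let X : (ℤ → ℤ → ℤ → V) × (ℤ → ℤ → ℤ → V) :=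
    (fun p q r => mode a p (mode b q (mode c r v)) - mode c r (mode a p (mode b q v)),
      fun p q r => mode b q (mode a p (mode c r v)) - mode c r (mode b q (mode a p v)))
  have hmem1 : ∀ r, (fun p q => mode c r (mode a p (mode b q v))) ∈ truncSnd V := by
    intro r
    obtain ⟨M, hM⟩ := exists_truncation b v
    exact ⟨M, fun q hq p => by simp [hM q hq]⟩
  have hmem2 : ∀ r, (fun p q => mode c r (mode b q (mode a p v))) ∈ truncFst V := by
    intro r
    obtain ⟨M, hM⟩ := exists_truncation a v
    exact ⟨M, fun q hq p => by simp [hM q hq]⟩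
  have hX : X ∈ residuePairs V := fun r =>
    ⟨sub_mem (mode_mode_mem_truncSnd a b (mode c r v)) (hmem1 r),
      sub_mem (mode_mode_mem_truncFst a b (mode c r v)) (hmem2 r)⟩
  have hres : (fun q r => LinearMap.applyₗ v (bracket (Heisenberg.circle n a b) c q r)) =
      residue n X := by
    funext q r
    change mode (Heisenberg.circle n a b) q (mode c r v) -
      mode c r (mode (Heisenberg.circle n a b) q v) = _
    rw [mode_circle, circleMode_apply, circleMode_apply, map_sub, map_smul,
      map_resFst _ (mode_mode_mem_truncSnd a b v), map_resSnd _ (mode_mode_mem_truncFst a b v)]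
    have e1 := resFst_sub (mode_mode_mem_truncSnd a b (mode c r v)) (hmem1 r) n q
    have e2 := resSnd_sub (mode_mode_mem_truncFst a b (mode c r v)) (hmem2 r) n q
    change _ = resFst n _ q - (-1 : ℂ) ^ n • resSnd n _ q
    erw [e1, e2]
    rw [smul_sub]
    abel
  have := exists_diffShift_pow_residue_eq_zero hX (N := N) ?_ ?_ ?_ n
  · rw [← hres] at this
    have h := congrFun (congrFun this q) r
    rw [diffShift_pow_map] at h
    exact h
  · have : X.1 - X.2 = (fun p q r => LinearMap.applyₗ (mode c r v) (bracket a b p q)) -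
        fun p q r => ((mode c r) ∘ₗ LinearMap.applyₗ v) (bracket a b p q) := by
      funext p q r
      simp only [X, bracket, Pi.sub_apply, LinearMap.applyₗ_apply_apply, LinearMap.comp_apply,
        Module.End.mul_apply, map_sub]
      abel
    rw [this, map_sub]
    funext p q r
    rw [Pi.sub_apply, Pi.sub_apply, Pi.sub_apply, diffFstSnd_pow_apply, diffFstSnd_pow_apply,
      bracket_pow_apply h1, bracket_pow_apply h1]
    simp
  · have : X.1 = (fun p q r => LinearMap.applyₗ (mode b q v) (bracket a c p r)) +
        fun p q r => ((mode a p) ∘ₗ LinearMap.applyₗ v) (bracket b c q r) := by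
      funext p q r
      simp only [X, bracket, Pi.add_apply, LinearMap.applyₗ_apply_apply, LinearMap.comp_apply,
        Module.End.mul_apply, map_sub]
      abel
    rw [← Module.End.mul_apply, this, map_add,
      ((commute_diffFstThd_diffSndThd (V := V)).pow_pow N N).eq, Module.End.mul_apply,
      ← ((commute_diffFstThd_diffSndThd (V := V)).pow_pow N N).eq, Module.End.mul_apply]
    have z1 : (diffFstThd V ^ N) (fun p q r => LinearMap.applyₗ (mode b q v) (bracket a c p r)) =
        0 := by
      funext p q r
      rw [diffFstThd_pow_apply, bracket_pow_apply h2]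
      rfl
    have z2 : (diffSndThd V ^ N) (fun p q r =>
        ((mode a p) ∘ₗ LinearMap.applyₗ v) (bracket b c q r)) = 0 := by
      funext p q r
      rw [diffSndThd_pow_apply, bracket_pow_apply h3]
      rfl
    rw [z1, z2, map_zero, map_zero, add_zero]
  · have : X.2 = (fun p q r => LinearMap.applyₗ (mode a p v) (bracket b c q r)) +
        fun p q r => ((mode b q) ∘ₗ LinearMap.applyₗ v) (bracket a c p r) := by
      funext p q r
      simp only [X, bracket, Pi.add_apply, LinearMap.applyₗ_apply_apply, LinearMap.comp_apply,
        Module.End.mul_apply, map_sub]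
      abel
    rw [← Module.End.mul_apply, this, map_add, Module.End.mul_apply,
      ((commute_diffFstThd_diffSndThd (V := V)).pow_pow N N).eq, Module.End.mul_apply]
    have z1 : (diffFstThd V ^ N) (fun p q r =>
        ((mode b q) ∘ₗ LinearMap.applyₗ v) (bracket a c p r)) = 0 := by
      funext p q r
      rw [diffFstThd_pow_apply, bracket_pow_apply h2]
      rfl
    have z2 : (diffSndThd V ^ N) (fun p q r =>
        LinearMap.applyₗ (mode a p v) (bracket b c q r)) = 0 := by
      funext p q r
      rw [diffSndThd_pow_apply, bracket_pow_apply h3]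
      rfl
    rw [z1, z2, map_zero, map_zero, add_zero]

end Dong

/-! ### Commutation relations and mutual locality in the Heisenberg algebra. -/

section HeisenbergFields

variable {n : ℕ}

theorem heisenbergVA_induction {P : VertexOperator ℂ (Fock n) → Prop}
    (alpha : ∀ i, P (alpha n i)) (vac : P vac) (zero : P 0) (add : ∀ a b, P a → P b → P (a + b))
    (smul : ∀ (c : ℂ) a, P a → P (c • a)) (circle : ∀ a b m, P a → P b → P (circle m a b))
    {a : VertexOperator ℂ (Fock n)} (ha : a ∈ heisenbergVA n) : P a := by
  let A : Submodule ℂ (VertexOperator ℂ (Fock n)) :=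
    { carrier := {a | P a}
      add_mem' := fun ha hb => add _ _ ha hb
      zero_mem' := zero
      smul_mem' := fun c _ ha => smul c _ ha }
  have hA : heisenbergVA n ≤ A := sInf_le
    ⟨vac, by rintro _ ⟨i, rfl⟩; exact alpha i, fun a ha b hb m => circle a b m ha hb⟩
  exact hA ha

theorem vac_mem_heisenbergVA : vac ∈ heisenbergVA n :=
  Submodule.mem_sInf.mpr fun _ hA => hA.1

theorem alpha_mem_heisenbergVA (i : Fin n) : alpha n i ∈ heisenbergVA n :=
  Submodule.mem_sInf.mpr fun _ hA => hA.2.1 ⟨i, rfl⟩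

theorem circle_mem_heisenbergVA {a b : VertexOperator ℂ (Fock n)} (ha : a ∈ heisenbergVA n)
    (hb : b ∈ heisenbergVA n) (m : ℤ) : circle m a b ∈ heisenbergVA n :=
  Submodule.mem_sInf.mpr fun _ hA =>
    hA.2.2 _ (Submodule.mem_sInf.mp ha _ hA) _ (Submodule.mem_sInf.mp hb _ hA) m

theorem mode_alpha (i : Fin n) (m : ℤ) : mode (alpha n i) m = alphaMode n i m :=
  ncoeff_ofModes _ _ m

theorem alphaMode_of_neg (i : Fin n) {m : ℤ} (hm : m < 0) (p : Fock n) :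
    alphaMode n i m p = MvPolynomial.X (i, (-m - 1).toNat) * p := by
  rw [alphaMode, if_pos hm]; rfl

theorem alphaMode_of_nonneg (i : Fin n) {m : ℤ} (hm : 0 ≤ m) (p : Fock n) :
    alphaMode n i m p = (m : ℂ) • MvPolynomial.pderiv (i, (m - 1).toNat) p := by
  rw [alphaMode, if_neg (by omega)]; rfl

theorem alphaMode_neg_succ (i : Fin n) (d : ℕ) (p : Fock n) :
    alphaMode n i (-d - 1) p = MvPolynomial.X (i, d) * p := by
  rw [alphaMode_of_neg i (by omega)]
  simp

theorem alphaMode_zero (i : Fin n) (p : Fock n) : alphaMode n i 0 p = 0 := by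
  rw [alphaMode_of_nonneg i le_rfl]
  simp

theorem Derivation.comm_of_X {σ : Type*} {D₁ D₂ : Derivation ℂ (MvPolynomial σ ℂ) (MvPolynomial σ ℂ)}
    (h : ∀ i, D₁ (D₂ (MvPolynomial.X i)) = D₂ (D₁ (MvPolynomial.X i))) (p : MvPolynomial σ ℂ) :
    D₁ (D₂ p) = D₂ (D₁ p) := by
  have : ⁅D₁, D₂⁆ = 0 := MvPolynomial.derivation_ext fun i => by
    rw [Derivation.commutator_apply, h, sub_self]; rfl
  have h' := congrArg (fun D => D p) this
  rwa [Derivation.commutator_apply, Derivation.zero_apply, sub_eq_zero] at h'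

theorem pderiv_comm {σ : Type*} (s t : σ) (p : MvPolynomial σ ℂ) :
    MvPolynomial.pderiv s (MvPolynomial.pderiv t p) =
      MvPolynomial.pderiv t (MvPolynomial.pderiv s p) := by
  classical
  refine Derivation.comm_of_X (fun i => ?_) p
  simp only [MvPolynomial.pderiv_X, Pi.single_apply]
  split_ifs <;> simp

/-- The canonical commutation relations. -/
theorem alphaMode_comm (i k : Fin n) (l m : ℤ) (p : Fock n) :
    alphaMode n i l (alphaMode n k m p) - alphaMode n k m (alphaMode n i l p) =
      if i = k ∧ l + m = 0 then (l : ℂ) • p else 0 := by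
  classical
  have key : ∀ (i k : Fin n) {l m : ℤ}, 0 ≤ l → m < 0 →
      alphaMode n i l (alphaMode n k m p) - alphaMode n k m (alphaMode n i l p) =
      if i = k ∧ l + m = 0 then (l : ℂ) • p else 0 := by
    intro i k l m hl hm
    rw [alphaMode_of_nonneg i hl, alphaMode_of_nonneg i hl, alphaMode_of_neg k hm,
      alphaMode_of_neg k hm, Derivation.leibniz, MvPolynomial.pderiv_X, Pi.single_apply]
    rcases hl.eq_or_lt with rfl | hl
    · simp
    · have : (k, (-m - 1).toNat) = (i, (l - 1).toNat) ↔ i = k ∧ l + m = 0 := by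
        rw [Prod.mk.injEq]
        constructor
        · rintro ⟨h1, h2⟩; exact ⟨h1.symm, by omega⟩
        · rintro ⟨h1, h2⟩; exact ⟨h1.symm, by omega⟩
      simp only [this]
      split_ifs <;> simp [smul_add]
  rcases lt_or_ge l 0 with hl | hl <;> rcases lt_or_ge m 0 with hm | hm
  · rw [alphaMode_of_neg i hl, alphaMode_of_neg i hl, alphaMode_of_neg k hm,
      alphaMode_of_neg k hm, if_neg (by omega)]
    ring
  · rw [← neg_sub, key k i hm hl]
    by_cases h : i = k ∧ l + m = 0
    · rw [if_pos h, if_pos ⟨h.1.symm, by omega⟩, show m = -l by omega]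
      push_cast
      rw [neg_smul, neg_neg]
    · rw [if_neg h, if_neg (fun h' => h ⟨h'.1.symm, by omega⟩), neg_zero]
  · exact key i k hl hm
  · rw [alphaMode_of_nonneg i hl, alphaMode_of_nonneg i hl, alphaMode_of_nonneg k hm,
      alphaMode_of_nonneg k hm, Derivation.map_smul, Derivation.map_smul, pderiv_comm, smul_comm, sub_self]
    split_ifs with h
    · have : l = 0 := by omega
      simp [this]
    · rfl

theorem isLocal_alpha (i k : Fin n) : IsLocal (alpha n i) (alpha n k) := by
  refine ⟨2, ?_⟩
  have hb : ∀ p q, bracket (alpha n i) (alpha n k) p q =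
      if i = k ∧ p + q = 0 then (p : ℂ) • (1 : Module.End ℂ (Fock n)) else 0 := by
    intro p q
    apply LinearMap.ext
    intro v
    rw [bracket, mode_alpha, mode_alpha]
    refine (alphaMode_comm i k p q v).trans ?_
    split_ifs <;> rfl
  funext p q
  rw [diffShift_pow_succ, diffShift_pow_succ, diffShift_pow_succ]
  simp only [pow_zero, Module.End.one_apply, hb]
  by_cases h : i = k ∧ p + q + 2 = 0
  · rw [if_pos ⟨h.1, by omega⟩, if_pos ⟨h.1, by omega⟩, if_pos ⟨h.1, by omega⟩]
    change _ = (0 : Module.End ℂ (Fock n))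
    push_cast
    module
  · rw [if_neg (fun h' => h ⟨h'.1, by omega⟩), if_neg (fun h' => h ⟨h'.1, by omega⟩),
      if_neg (fun h' => h ⟨h'.1, by omega⟩)]
    simp

/-- The fields which are local with respect to all `αⁱ`. -/
def IsLocalToAlpha (c : VertexOperator ℂ (Fock n)) : Prop := ∀ i, IsLocal (alpha n i) c

/-- Quantifying over all fields local to the αⁱ makes the induction close up. For a circle product
of a and b, Dong's lemma also needs a and b to be mutually local: the hypothesis on b, applied to
the αⁱ, shows that b is such a field, so the hypothesis on a applies to it. -/
theorem isLocal_of_isLocalToAlpha {a : VertexOperator ℂ (Fock n)} (ha : a ∈ heisenbergVA n) :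
    ∀ c, IsLocalToAlpha c → IsLocal a c := by
  have h : ∀ a : VertexOperator ℂ (Fock n), (∀ c, IsLocalToAlpha c → IsLocal a c) →
      IsLocalToAlpha a := fun a ha i => (ha _ fun k => isLocal_alpha k i).symm
  exact heisenbergVA_induction (P := fun a => ∀ c, IsLocalToAlpha c → IsLocal a c)
    (fun i c hc => hc i) (fun c _ => isLocal_vac_left c) (fun c _ => isLocal_zero_left c)
    (fun a b ha hb c hc => (ha c hc).add_left (hb c hc))
    (fun x a ha c hc => (ha c hc).smul_left x)
    (fun a b m ha hb c hc => (ha b (h b hb)).circle (ha c hc) (hb c hc) m) ha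

theorem isLocal_heisenbergVA_alpha {a : VertexOperator ℂ (Fock n)} (ha : a ∈ heisenbergVA n)
    (i : Fin n) : IsLocal a (alpha n i) :=
  isLocal_of_isLocalToAlpha ha _ fun k => isLocal_alpha k i

/-- The infinitesimal translation on Fock space. -/
def translation (n : ℕ) : Derivation ℂ (Fock n) (Fock n) :=
  MvPolynomial.mkDerivation ℂ fun p => ((p.2 : ℂ) + 1) • MvPolynomial.X (p.1, p.2 + 1)

theorem translation_X (p : Fin n × ℕ) :
    translation n (MvPolynomial.X p) = ((p.2 : ℂ) + 1) • MvPolynomial.X (p.1, p.2 + 1) :=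
  MvPolynomial.mkDerivation_X _ _ _

end HeisenbergFields

/-! ### Translation covariance, creativity, and propagation of vanishing by locality. -/

section Covariance

variable {V W : Type*} [AddCommGroup V] [Module ℂ V]

/-- Expresses (∂_z + ∂_w)(z-w)ⁿ = 0 on coefficients; this is why circle products respect the
derivation. The condition at K removes the boundary term. -/
theorem sum_binomCoeff_shift (n : ℤ) (G G' : ℕ → V) (K : ℕ) (hK : G K = 0)
    (h : ∀ t, G' (t + 1) = G t) :
    ∑ t ∈ Finset.range (K + 1), ((n - t : ℂ) * binomCoeff n t) • G t +
      ∑ t ∈ Finset.range (K + 1), ((t : ℂ) * binomCoeff n t) • G' t = 0 := by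
  rw [Finset.sum_range_succ, Finset.sum_range_succ' (fun t => ((t : ℂ) * binomCoeff n t) • G' t),
    hK]
  simp only [smul_zero, add_zero, Nat.cast_zero, zero_mul, zero_smul, h]
  rw [← Finset.sum_add_distrib]
  refine Finset.sum_eq_zero fun t _ => ?_
  push_cast
  rw [← add_smul, binomCoeff_mul_succ, add_neg_cancel, zero_smul]

/-- The field `a` is covariant: `[D, a(z)] = ∂a(z)`. -/
def IsCovariant (D : V →ₗ[ℂ] V) (a : VertexOperator ℂ V) : Prop :=
  ∀ m v, D (mode a m v) = mode a m (D v) - (m : ℂ) • mode a (m - 1) v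

theorem IsCovariant.circle {D : V →ₗ[ℂ] V} {a b : VertexOperator ℂ V} (ha : IsCovariant D a)
    (hb : IsCovariant D b) (n : ℤ) : IsCovariant D (circle n a b) := by
  intro m v
  obtain ⟨K1, h1⟩ := exists_mode_circle_apply n a b m v
  obtain ⟨K2, h2⟩ := exists_mode_circle_apply n a b m (D v)
  obtain ⟨K3, h3⟩ := exists_mode_circle_apply n a b (m - 1) v
  obtain ⟨A, hA⟩ := exists_truncation a v
  obtain ⟨B, hB⟩ := exists_truncation b v
  obtain ⟨K, e1, e2, e3, e4, e5⟩ : ∃ K : ℕ, K1 ≤ K + 1 ∧ K2 ≤ K + 1 ∧ K3 ≤ K + 1 ∧ A ≤ K ∧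
    B ≤ m + K := ⟨K1 + K2 + K3 + A.toNat + (B - m).toNat, by omega⟩
  have s1 := sum_binomCoeff_shift n (fun t => mode a (n - t - 1) (mode b (m + t) v))
    (fun t => mode a (n - t) (mode b (m + t - 1) v)) K (by simp [hB _ e5]) (fun t => by
      push_cast
      rw [show n - ((t : ℤ) + 1) = n - t - 1 by ring, show m + ((t : ℤ) + 1) - 1 = m + t by ring])
  have s2 := sum_binomCoeff_shift n (fun t => mode b (m + n - t - 1) (mode a (t : ℤ) v))
    (fun t => mode b (m + n - t) (mode a ((t : ℤ) - 1) v)) K (by simp [hA _ e4]) (fun t => by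
      push_cast
      rw [show m + n - ((t : ℤ) + 1) = m + n - t - 1 by ring, show ((t : ℤ) + 1) - 1 = t by ring])
  rw [h1 _ e1, h2 _ e2, h3 _ e3, map_sum, ← sub_eq_zero, ← neg_eq_zero]
  have s3 := congrArg₂ (· - ·) s1 (congrArg (fun x => (-1 : ℂ) ^ n • x) s2)
  simp only [smul_zero, sub_zero] at s3
  rw [← s3, Finset.smul_sum, ← Finset.sum_sub_distrib, ← Finset.sum_sub_distrib,
    ← Finset.sum_neg_distrib, ← Finset.sum_add_distrib, ← Finset.sum_add_distrib, Finset.smul_sum,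
    ← Finset.sum_sub_distrib]
  refine Finset.sum_congr rfl fun t _ => ?_
  rw [map_smul, map_sub, map_smul, ha, hb, hb, ha, map_sub, map_sub, map_smul, map_smul]
  push_cast
  rw [show m - 1 + (t : ℤ) = m + t - 1 by ring, show m - 1 + n - (t : ℤ) = m + n - t - 1 by ring]
  module

theorem binomCoeff_neg_one (t : ℕ) : binomCoeff (-1) t = 1 := by
  induction t with
  | zero => exact binomCoeff_zero _
  | succ t ih =>
    have := binomCoeff_mul_succ (-1) t
    rw [ih] at this
    push_cast at this
    have h0 : (t : ℂ) + 1 ≠ 0 := by exact_mod_cast Nat.succ_ne_zero t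
    exact mul_left_cancel₀ h0 (by rw [this]; ring)

theorem mode_wick_apply (a b : VertexOperator ℂ V) (m : ℤ) (v : V) :
    ∃ K : ℕ, ∀ K' ≥ K, mode (wick a b) m v = ∑ t ∈ Finset.range K',
      (mode a (-t - 1) (mode b (m + t) v) + mode b (m - 1 - t) (mode a (t : ℤ) v)) := by
  obtain ⟨K, hK⟩ := exists_mode_circle_apply (-1) a b m v
  refine ⟨K, fun K' h => ?_⟩
  rw [wick, hK K' h]
  refine Finset.sum_congr rfl fun t _ => ?_
  rw [binomCoeff_neg_one, one_smul, zpow_neg_one, show (-1 : ℤ) - t = -t - 1 by ring,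
    show m + -1 - (t : ℤ) = m - 1 - t by ring]
  norm_num

theorem mode_deriv (a : VertexOperator ℂ V) (m : ℤ) :
    mode (deriv a) m = (-(m : ℂ)) • mode a (m - 1) :=
  ncoeff_ofModes _ _ m

/-- Makes whatever is closed under circle products and contains 1 closed under differentiation. -/
theorem deriv_eq_circle (a : VertexOperator ℂ V) : deriv a = circle (-2) a vac := by
  apply ext_mode
  intro m
  apply LinearMap.ext
  intro v
  obtain ⟨K, hK⟩ := exists_mode_circle_apply (-2) a vac m v
  have hc : ∀ t : ℕ, binomCoeff (-2) t = t + 1 := by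
    intro t
    induction t with
    | zero => simp [binomCoeff_zero]
    | succ t ih =>
      have := binomCoeff_mul_succ (-2) t
      rw [ih] at this
      push_cast at this
      have h0 : (t : ℂ) + 1 ≠ 0 := by exact_mod_cast Nat.succ_ne_zero t
      refine mul_left_cancel₀ h0 ?_
      rw [this]
      push_cast
      ring
  rw [hK (K + m.toNat + (-m).toNat + 1) (by omega), mode_deriv]
  simp only [mode_vac, hc]
  -- Only the mode -1 of the identity field is nonzero. It selects one term of the first half of the
  -- sum if m < 0, one term of the second half if m > 0, and none if m = 0.
  rcases lt_or_ge m 0 with hm | hm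
  · rw [Finset.sum_eq_single (-m - 1).toNat]
    · rw [if_pos (by omega), if_neg (by omega)]
      have e1 : ((-m - 1).toNat : ℤ) = -m - 1 := by omega
      have e2 : (((-m - 1).toNat : ℕ) : ℂ) = -m - 1 := by exact_mod_cast e1
      rw [e1, e2, show -2 - (-m - 1) = m - 1 by ring]
      simp
    · intro t _ ht
      rw [if_neg (by omega), if_neg (by omega)]
      simp
    · intro h
      exact absurd (Finset.mem_range.mpr (by omega)) h
  · rcases hm.eq_or_lt with rfl | hm
    · rw [Finset.sum_eq_zero]
      · simp
      · intro t _
        rw [if_neg (by omega), if_neg (by omega)]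
        simp
    · rw [Finset.sum_eq_single (m - 1).toNat]
      · rw [if_neg (by omega), if_pos (by omega)]
        have e1 : ((m - 1).toNat : ℤ) = m - 1 := by omega
        have e2 : (((m - 1).toNat : ℕ) : ℂ) = m - 1 := by exact_mod_cast e1
        rw [e1, e2]
        simp
      · intro t _ ht
        rw [if_neg (by omega), if_neg (by omega)]
        simp
      · intro h
        exact absurd (Finset.mem_range.mpr (by omega)) h

/-- The field `a` creates from `v`: its modes `a(m)`, `m ≥ 0`, kill `v`. -/
def IsCreative (v : V) (a : VertexOperator ℂ V) : Prop := ∀ m ≥ 0, mode a m v = 0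

theorem IsCreative.circle {v : V} {a b : VertexOperator ℂ V} (ha : IsCreative v a)
    (hb : IsCreative v b) (n : ℤ) : IsCreative v (circle n a b) := by
  intro m hm
  obtain ⟨K, hK⟩ := exists_mode_circle_apply n a b m v
  rw [hK K le_rfl]
  refine Finset.sum_eq_zero fun t _ => ?_
  rw [ha t (by omega), hb (m + t) (by omega)]
  simp

theorem IsCreative.mode_wick {v : V} {a b : VertexOperator ℂ V} (ha : IsCreative v a)
    (hb : IsCreative v b) : mode (wick a b) (-1) v = mode a (-1) (mode b (-1) v) := by
  obtain ⟨K, hK⟩ := mode_wick_apply a b (-1) v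
  rw [hK (K + 1) (by omega), Finset.sum_eq_single 0]
  · simp [ha 0 le_rfl]
  · intro t _ ht
    rw [ha t (by omega), hb (-1 + t) (by omega)]
    simp
  · intro h
    exact absurd (Finset.mem_range.mpr (by omega)) h

/-- Since a kills v, locality gives (z-w)ᴺ a(z)b(w)v = 0. The modes b(q)v vanish for large q, so one
can descend in q: when all larger modes contribute nothing, only the term zᴺ of (z-w)ᴺ survives at
q, and it isolates a(p)b(q)v. -/
theorem IsLocal.eq_zero_on {a b : VertexOperator ℂ V} (h : IsLocal a b) {v : V}
    (ha : ∀ m, mode a m v = 0) (k m : ℤ) : mode a m (mode b k v) = 0 := by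
  obtain ⟨N, hN⟩ := h
  have hF : ∀ p q, (diffShift V ^ N) (fun p q => mode a p (mode b q v)) p q = 0 := by
    intro p q
    have : (fun p q => mode a p (mode b q v)) =
        fun p q => LinearMap.applyₗ v (bracket a b p q) := by
      funext p q
      simp [bracket, ha]
    rw [this, diffShift_pow_map, hN]
    simp
  obtain ⟨Q, hQ⟩ := exists_truncation b v
  have hexp : ∀ (F : ℤ → ℤ → V) (q₀ : ℤ), (∀ q > q₀, ∀ p, F p q = 0) → ∀ (N : ℕ) (p : ℤ),
      (diffShift V ^ N) F p q₀ = F (p + N) q₀ ∧ ∀ q > q₀, (diffShift V ^ N) F p q = 0 := by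
    intro F q₀ hF N
    induction N with
    | zero => exact fun p => ⟨by simp, fun q hq => hF q hq p⟩
    | succ N ih =>
      intro p
      refine ⟨?_, fun q hq => ?_⟩
      · rw [diffShift_pow_succ, (ih p).2 _ (by omega), sub_zero, (ih _).1]
        push_cast
        rw [add_assoc, add_comm 1 (N : ℤ)]
      · rw [diffShift_pow_succ, (ih p).2 _ (by omega), (ih _).2 _ hq, sub_zero]
  have key : ∀ d : ℕ, ∀ q, Q - d ≤ q → ∀ p, mode a p (mode b q v) = 0 := by
    intro d
    induction d with
    | zero => exact fun q hq p => by rw [hQ q (by simpa using hq), map_zero]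
    | succ d ih =>
      intro q hq p
      have := (hexp (fun p q => mode a p (mode b q v)) q (fun q' hq' p => ih q' (by omega) p) N
        (p - N)).1
      rw [hF, sub_add_cancel] at this
      exact this.symm
  exact key (Q - k).toNat k (by omega) m

end Covariance

/-! ### Fields of the Heisenberg vertex algebra are determined by their states. -/

section StateField

variable {n : ℕ}

theorem isCreative_of_mem {a : VertexOperator ℂ (Fock n)} (ha : a ∈ heisenbergVA n) :
    IsCreative 1 a := by
  refine heisenbergVA_induction (P := IsCreative 1) (fun i m hm => ?_) (fun m hm => ?_)
    (fun m _ => by rw [mode_zero]; rfl) (fun a b ha hb m hm => ?_) (fun c a ha m hm => ?_)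
    (fun a b m ha hb => ha.circle hb m) ha
  · rw [mode_alpha, alphaMode_of_nonneg i hm, MvPolynomial.pderiv_one, smul_zero]
  · rw [mode_vac, if_neg (by omega)]; rfl
  · rw [mode_add, LinearMap.add_apply, ha m hm, hb m hm, add_zero]
  · rw [mode_smul, LinearMap.smul_apply, ha m hm, smul_zero]

theorem isCovariant_of_mem {a : VertexOperator ℂ (Fock n)} (ha : a ∈ heisenbergVA n) :
    IsCovariant (translation n).toLinearMap a := by
  refine heisenbergVA_induction (P := IsCovariant (translation n).toLinearMap) (fun i m v => ?_)
    (fun m v => ?_) (fun m v => ?_) (fun a b ha hb m v => ?_) (fun c a ha m v => ?_)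
    (fun a b m ha hb => ha.circle hb m) ha
  · change translation n _ = mode _ _ (translation n v) - _
    rw [mode_alpha, mode_alpha]
    rcases lt_or_ge m 0 with hm | hm
    · rw [alphaMode_of_neg i hm, alphaMode_of_neg i hm, alphaMode_of_neg i (by omega),
        Derivation.leibniz, translation_X, show (-(m - 1) - 1).toNat = (-m - 1).toNat + 1 by omega]
      have e2 : (((-m - 1).toNat : ℕ) : ℂ) = -m - 1 := by
        have e1 : ((-m - 1).toNat : ℤ) = -m - 1 := by omega
        exact_mod_cast e1
      simp only [e2, smul_eq_mul, MvPolynomial.smul_eq_C_mul, map_add, map_sub, map_neg, map_one]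
      ring
    -- For d = 0 the truncated index d - 1 is harmless, since its coefficient vanishes.
    · have hcomm : ∀ d : ℕ, translation n (MvPolynomial.pderiv (i, d) v) =
          MvPolynomial.pderiv (i, d) (translation n v) -
            (d : ℂ) • MvPolynomial.pderiv (i, d - 1) v := by
        intro d
        have : ⁅translation n, MvPolynomial.pderiv (i, d)⁆ =
            -((d : ℂ) • MvPolynomial.pderiv (R := ℂ) (i, d - 1)) := by
          refine MvPolynomial.derivation_ext fun p => ?_
          classical
          rw [Derivation.commutator_apply, translation_X, Derivation.map_smul,
            MvPolynomial.pderiv_X, MvPolynomial.pderiv_X, Derivation.neg_apply,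
            Derivation.smul_apply, MvPolynomial.pderiv_X]
          have h1 : translation n (Pi.single (M := fun _ => Fock n) (i, d) 1 p) = 0 := by
            rw [Pi.single_apply]; split_ifs <;> simp
          rw [h1, zero_sub]
          rcases Nat.eq_zero_or_pos d with rfl | hd
          · simp [Pi.single_apply]
          · by_cases hp : p = (i, d - 1)
            · subst hp
              have : (d - 1 + 1) = d := by omega
              simp only [this, Pi.single_eq_same]
              rw [Nat.cast_sub hd]
              simp
            · rw [Pi.single_eq_of_ne hp, Pi.single_eq_of_ne]
              · simp
              · rintro h
                rw [Prod.mk.injEq] at h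
                exact hp (Prod.ext h.1 (by simp only; omega))
        have h' := congrArg (fun D => D v) this
        simp only [Derivation.commutator_apply, Derivation.neg_apply, Derivation.smul_apply] at h'
        rw [← sub_eq_zero, ← sub_eq_zero.mpr h']
        abel
      rcases hm.eq_or_lt with rfl | hm
      · rw [alphaMode_zero, alphaMode_zero]
        simp
      · rw [alphaMode_of_nonneg i hm.le, alphaMode_of_nonneg i hm.le,
          alphaMode_of_nonneg i (by omega), Derivation.map_smul, hcomm,
          show (m - 1 - 1).toNat = (m - 1).toNat - 1 by omega]
        have e2 : (((m - 1).toNat : ℕ) : ℂ) = m - 1 := by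
          have e1 : ((m - 1).toNat : ℤ) = m - 1 := by omega
          exact_mod_cast e1
        rw [e2, smul_sub]
        push_cast
        rfl
  · rw [mode_vac, mode_vac]
    by_cases h : m = -1
    · subst h; simp
    · by_cases h' : m = 0
      · subst h'; simp
      · rw [if_neg h, if_neg (by omega)]; simp
  · simp [mode_zero]
  · rw [mode_add, mode_add, LinearMap.add_apply, LinearMap.add_apply, LinearMap.add_apply, map_add,
      ha, hb]
    module
  · rw [mode_smul, mode_smul, LinearMap.smul_apply, LinearMap.smul_apply, LinearMap.smul_apply,
      map_smul, ha]
    module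

/-- The state `a(-1)1` of a field. -/
def state (n : ℕ) : VertexOperator ℂ (Fock n) →ₗ[ℂ] Fock n where
  toFun a := mode a (-1) 1
  map_add' a b := by rw [mode_add]; rfl
  map_smul' c a := by rw [mode_smul]; rfl

theorem state_apply (a : VertexOperator ℂ (Fock n)) : state n a = mode a (-1) 1 := rfl

/-- A field of the Heisenberg vertex algebra is determined by its state. -/
theorem eq_zero_of_state_eq_zero {a : VertexOperator ℂ (Fock n)} (ha : a ∈ heisenbergVA n)
    (h : state n a = 0) : a = 0 := by
  -- The translation kills 1, so covariance turns the vanishing of a(m)1 into that of m a(m-1)1; for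
  -- negative m this propagates downwards from the state.
  have h1 : ∀ k : ℕ, mode a (-k - 1) 1 = 0 := by
    intro k
    induction k with
    | zero => simpa [state_apply] using h
    | succ k ih =>
      have := isCovariant_of_mem ha (-k - 1) 1
      rw [ih] at this
      change translation n 0 = mode a _ (translation n 1) - _ at this
      rw [map_zero, Derivation.map_one_eq_zero, map_zero, zero_sub, eq_comm, neg_eq_zero,
        smul_eq_zero] at this
      rcases this with h0 | h0
      · exfalso
        have : (-(k : ℤ) - 1) = 0 := by exact_mod_cast h0
        omega
      · push_cast
        rwa [show -((k : ℤ) + 1) - 1 = -k - 1 - 1 by ring]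
  have h2 : ∀ m, mode a m 1 = 0 := by
    intro m
    rcases lt_or_ge m 0 with hm | hm
    · have := h1 (-m - 1).toNat
      rwa [show -((-m - 1).toNat : ℤ) - 1 = m by omega] at this
    · exact isCreative_of_mem ha m hm
  -- Fock space arises from 1 by the creation modes of the αⁱ, to which a is local.
  have h3 : ∀ (v : Fock n) m, mode a m v = 0 := by
    intro v
    induction v using MvPolynomial.induction_on with
    | C c => exact fun m => by rw [MvPolynomial.C_eq_smul_one, map_smul, h2, smul_zero]
    | add p q hp hq => exact fun m => by rw [map_add, hp, hq, add_zero]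
    | mul_X p i hp =>
      intro m
      have := (isLocal_heisenbergVA_alpha ha i.1).eq_zero_on hp (-i.2 - 1) m
      rwa [mode_alpha, alphaMode_neg_succ, mul_comm] at this
  refine ext_mode fun m => LinearMap.ext fun v => ?_
  rw [h3, mode_zero]
  rfl

theorem eq_of_state_eq {a b : VertexOperator ℂ (Fock n)} (ha : a ∈ heisenbergVA n)
    (hb : b ∈ heisenbergVA n) (h : state n a = state n b) : a = b :=
  sub_eq_zero.mp (eq_zero_of_state_eq_zero (sub_mem ha hb) (by rw [map_sub, h, sub_self]))

theorem wick_mem {a b : VertexOperator ℂ (Fock n)} (ha : a ∈ heisenbergVA n)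
    (hb : b ∈ heisenbergVA n) : wick a b ∈ heisenbergVA n := circle_mem_heisenbergVA ha hb _

theorem deriv_mem {a : VertexOperator ℂ (Fock n)} (ha : a ∈ heisenbergVA n) :
    deriv a ∈ heisenbergVA n := by
  rw [deriv_eq_circle]; exact circle_mem_heisenbergVA ha vac_mem_heisenbergVA _

theorem iterate_deriv_mem {a : VertexOperator ℂ (Fock n)} (ha : a ∈ heisenbergVA n) (k : ℕ) :
    deriv^[k] a ∈ heisenbergVA n := by
  induction k with
  | zero => exact ha
  | succ k ih => rw [Function.iterate_succ_apply']; exact deriv_mem ih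

theorem state_wick {a b : VertexOperator ℂ (Fock n)} (ha : a ∈ heisenbergVA n)
    (hb : b ∈ heisenbergVA n) : state n (wick a b) = mode a (-1) (state n b) :=
  (isCreative_of_mem ha).mode_wick (isCreative_of_mem hb)

theorem mode_iterate_deriv (a : VertexOperator ℂ (Fock n)) (k : ℕ) (m : ℤ) :
    mode (deriv^[k] a) m = ((-1) ^ k * (descPochhammer ℂ k).eval (m : ℂ)) • mode a (m - k) := by
  induction k generalizing m with
  | zero => simp
  | succ k ih =>
    rw [Function.iterate_succ_apply', mode_deriv, ih, smul_smul, descPochhammer_succ_left]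
    congr 1
    · push_cast
      rw [Polynomial.eval_mul, Polynomial.eval_comp]
      simp only [Polynomial.eval_X, Polynomial.eval_sub, Polynomial.eval_one]
      ring
    · push_cast
      rw [sub_sub, add_comm 1]

end StateField

/-! ### First fundamental theorem for the orthogonal group. -/

section FirstFundamentalTheorem

open MvPolynomial

/-- The quadratic invariant `∑ᵢ X (i, a) * X (i, b)`. -/
def quad (n a b : ℕ) : Fock n := ∑ i, X (i, a) * X (i, b)

theorem quad_comm (n a b : ℕ) : quad n a b = quad n b a :=
  Finset.sum_congr rfl fun _ _ => mul_comm _ _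

/-- The algebra generated by the quadratic invariants. -/
def quadAlgebra (n : ℕ) : Subalgebra ℂ (Fock n) :=
  Algebra.adjoin ℂ (Set.range fun s : ℕ × ℕ => quad n s.1 s.2)

theorem quad_mem_quadAlgebra (n a b : ℕ) : quad n a b ∈ quadAlgebra n :=
  Algebra.subset_adjoin ⟨(a, b), rfl⟩

/-- The `quadAlgebra`-module of vector fields spanned by the vectors `X (·, a)`. -/
def vectorModule (n : ℕ) : Submodule (quadAlgebra n) (Fin n → Fock n) :=
  Submodule.span (quadAlgebra n) (Set.range fun a : ℕ => fun i => X (i, a))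

theorem sum_mul_mem_quadAlgebra {n : ℕ} {u v : Fin n → Fock n} (hu : u ∈ vectorModule n)
    (hv : v ∈ vectorModule n) : ∑ i, u i * v i ∈ quadAlgebra n := by
  induction hu using Submodule.span_induction with
  | zero => simp
  | add u u' _ _ h h' =>
    simp only [Pi.add_apply, add_mul, Finset.sum_add_distrib]
    exact add_mem h h'
  | smul c u _ h =>
    have : ∑ i, (c • u) i * v i = c.1 * ∑ i, u i * v i := by
      rw [Finset.mul_sum]
      refine Finset.sum_congr rfl fun i _ => ?_
      rw [Pi.smul_apply, Subalgebra.smul_def, smul_eq_mul, mul_assoc]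
    rw [this]
    exact mul_mem c.2 h
  | mem u hu =>
    obtain ⟨a, rfl⟩ := hu
    induction hv using Submodule.span_induction with
    | zero => simp
    | add u u' _ _ h h' =>
      simp only [Pi.add_apply, mul_add, Finset.sum_add_distrib]
      exact add_mem h h'
    | smul c u _ h =>
      have : ∑ i, X (i, a) * (c • u) i = c.1 * ∑ i, X (i, a) * u i := by
        rw [Finset.mul_sum]
        refine Finset.sum_congr rfl fun i _ => ?_
        rw [Pi.smul_apply, Subalgebra.smul_def, smul_eq_mul, mul_left_comm]
      rw [this]
      exact mul_mem c.2 h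
    | mem v hv =>
      obtain ⟨b, rfl⟩ := hv
      exact quad_mem_quadAlgebra n a b

theorem pderiv_quad {n : ℕ} (i : Fin n) (m a b : ℕ) : pderiv (i, m) (quad n a b) =
    (if a = m then X (i, b) else 0) + if b = m then X (i, a) else 0 := by
  classical
  rw [quad, map_sum, Finset.sum_eq_single i]
  · rw [Derivation.leibniz, pderiv_X, pderiv_X, Pi.single_apply, Pi.single_apply]
    simp only [Prod.mk.injEq, true_and, smul_eq_mul, mul_ite, mul_one, mul_zero]
    rw [add_comm]
  · intro k _ hk
    rw [Derivation.leibniz, pderiv_X_of_ne (by simp [hk]), pderiv_X_of_ne (by simp [hk])]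
    simp
  · simp

theorem gradient_mem_vectorModule {n : ℕ} {p : Fock n} (hp : p ∈ quadAlgebra n) (m : ℕ) :
    (fun i => pderiv (i, m) p) ∈ vectorModule n := by
  induction hp using Algebra.adjoin_induction with
  | mem p hp =>
    obtain ⟨⟨a, b⟩, rfl⟩ := hp
    have h : (fun i => pderiv (i, m) (quad n a b)) =
        (if a = m then (fun i => X (i, b)) else 0) + if b = m then (fun i => X (i, a)) else 0 := by
      funext i
      rw [pderiv_quad]
      split_ifs <;> rfl
    change (fun i => pderiv (i, m) (quad n a b)) ∈ _
    rw [h]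
    refine add_mem ?_ ?_
    · split_ifs
      · exact Submodule.subset_span ⟨b, rfl⟩
      · exact zero_mem _
    · split_ifs
      · exact Submodule.subset_span ⟨a, rfl⟩
      · exact zero_mem _
  | algebraMap c =>
    have : (fun i : Fin n => pderiv (i, m) (algebraMap ℂ (Fock n) c)) = 0 := by
      funext i
      rw [algebraMap_eq, pderiv_C]
      rfl
    rw [this]
    exact zero_mem _
  | add p r _ _ h h' =>
    simp only [map_add]
    exact add_mem h h'
  | mul p r hp hr h h' =>
    have : (fun i => pderiv (i, m) (p * r)) = (⟨p, hp⟩ : quadAlgebra n) • (fun i => pderiv (i, m) r) +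
        (⟨r, hr⟩ : quadAlgebra n) • fun i => pderiv (i, m) p := by
      funext i
      rw [Derivation.leibniz]
      rfl
    rw [this]
    exact add_mem (Submodule.smul_mem _ _ h') (Submodule.smul_mem _ _ h)

theorem divergence_mem_quadAlgebra {n : ℕ} {u : Fin n → Fock n} (hu : u ∈ vectorModule n) (m : ℕ) :
    ∑ i, pderiv (i, m) (u i) ∈ quadAlgebra n := by
  classical
  induction hu using Submodule.span_induction with
  | zero => simp
  | add u u' _ _ h h' =>
    simp only [Pi.add_apply, map_add, Finset.sum_add_distrib]
    exact add_mem h h'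
  | smul c u hu h =>
    have : ∑ i, pderiv (i, m) ((c • u) i) = c.1 * (∑ i, pderiv (i, m) (u i)) +
        ∑ i, u i * pderiv (i, m) c.1 := by
      rw [Finset.mul_sum, ← Finset.sum_add_distrib]
      refine Finset.sum_congr rfl fun i _ => ?_
      rw [Pi.smul_apply, Subalgebra.smul_def, smul_eq_mul, Derivation.leibniz]
      rfl
    rw [this]
    exact add_mem (mul_mem c.2 h) (sum_mul_mem_quadAlgebra hu (gradient_mem_vectorModule c.2 m))
  | mem u hu =>
    obtain ⟨a, rfl⟩ := hu
    refine sum_mem fun i _ => ?_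
    simp only [pderiv_X, Pi.single_apply]
    split_ifs
    · exact one_mem _
    · exact zero_mem _

/-- By the chain rule the gradient of a function of scalar products is a combination of the vectors
with coefficients in the algebra, and the divergence of such a combination is again a function of
scalar products. -/
theorem laplacian_mem_quadAlgebra {n : ℕ} {p : Fock n} (hp : p ∈ quadAlgebra n) (m : ℕ) :
    ∑ i, pderiv (i, m) (pderiv (i, m) p) ∈ quadAlgebra n :=
  divergence_mem_quadAlgebra (gradient_mem_vectorModule hp m) m

theorem laplacian_quad_pow_mul {n m : ℕ} {f : Fock n} (hf : ∀ i, pderiv (i, m) f = 0) (k : ℕ) :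
    ∑ i, pderiv (i, m) (pderiv (i, m) (quad n m m ^ (k + 1) * f)) =
      (2 * (k + 1) * (2 * k + n) : ℂ) • (quad n m m ^ k * f) := by
  have h1 : ∀ i : Fin n, pderiv (i, m) (pderiv (i, m) (quad n m m ^ (k + 1) * f)) =
      4 * ((k : Fock n) + 1) * ((k : Fock n) * quad n m m ^ (k - 1)) * f * (X (i, m) * X (i, m)) +
        2 * ((k : Fock n) + 1) * quad n m m ^ k * f := by
    intro i
    have hq : pderiv (i, m) (quad n m m) = 2 * X (i, m) := by
      rw [pderiv_quad, if_pos rfl]; ring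
    rw [pderiv_mul, hf, mul_zero, add_zero, pderiv_pow, hq, pderiv_mul, hf, mul_zero, add_zero,
      pderiv_mul, pderiv_mul, pderiv_mul, pderiv_X_self, Nat.add_sub_cancel, pderiv_pow, hq]
    have : pderiv (R := ℂ) (i, m) ((k + 1 : ℕ) : Fock n) = 0 := by
      simp
    rw [this]
    have h2 : pderiv (R := ℂ) (i, m) (2 : Fock n) = 0 := by
      exact Derivation.map_natCast (pderiv (R := ℂ) (i, m)) 2
    rw [h2]
    push_cast
    ring
  rw [Finset.sum_congr rfl fun i _ => h1 i, Finset.sum_add_distrib, ← Finset.mul_sum]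
  change _ * quad n m m + _ = _
  rw [Finset.sum_const, Finset.card_univ, Fintype.card_fin]
  simp only [smul_eq_C_mul, map_mul, map_add, map_ofNat, map_natCast, map_one, nsmul_eq_mul]
  rcases k with _ | k
  · simp
    ring
  · rw [Nat.add_sub_cancel]
    push_cast
    ring

/-- If f does not involve the m-th vector, its Laplacian sends |x_m|^{2(k+1)} f to a scalar multiple
of |x_m|^{2k} f. The scalar 2(k+1)(2k+n) is nonzero as n > 0, so powers of |x_m|² can be cancelled
inside the algebra. -/
theorem mem_quadAlgebra_of_quad_pow_mul_mem {n m : ℕ} (hn : n ≠ 0) {f : Fock n}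
    (hf : ∀ i, pderiv (i, m) f = 0) (k : ℕ) (h : quad n m m ^ k * f ∈ quadAlgebra n) :
    f ∈ quadAlgebra n := by
  induction k with
  | zero => simpa using h
  | succ k ih =>
    refine ih ?_
    have h1 := laplacian_mem_quadAlgebra h m
    rw [laplacian_quad_pow_mul hf] at h1
    have hc : (2 * (k + 1) * (2 * k + n) : ℂ) ≠ 0 := by
      have : 2 * (k + 1) * (2 * k + n) ≠ 0 := by positivity
      exact_mod_cast this
    have h2 := (quadAlgebra n).smul_mem h1 (2 * (k + 1) * (2 * k + n) : ℂ)⁻¹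
    rwa [inv_smul_smul₀ hc] at h2

/-- The reflection in w = u - e, with e the last basis vector, moves e to u; over ℂ it exists when
w·w = 2 - 2u_last is nonzero. In the remaining case u_last = 1, -u is used and the matrix is
negated. -/
theorem exists_orthogonal_col {n : ℕ} (u : Fin (n + 1) → ℂ) (hu : ∑ i, u i * u i = 1) :
    ∃ g : Matrix (Fin (n + 1)) (Fin (n + 1)) ℂ, g.transpose * g = 1 ∧ ∀ i, g i (Fin.last n) = u i := by
  classical
  have key : ∀ u : Fin (n + 1) → ℂ, ∑ i, u i * u i = 1 → u (Fin.last n) ≠ 1 →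
      ∃ g : Matrix (Fin (n + 1)) (Fin (n + 1)) ℂ, g.transpose * g = 1 ∧
        ∀ i, g i (Fin.last n) = u i := by
    intro u hu h1
    let w : Fin (n + 1) → ℂ := u - Pi.single (Fin.last n) 1
    have hw : w ⬝ᵥ w = 2 - 2 * u (Fin.last n) := by
      have : u ⬝ᵥ u = 1 := hu
      simp only [w, sub_dotProduct, dotProduct_sub, this, dotProduct_single, single_dotProduct,
        Pi.sub_apply, Pi.single_eq_same]
      ring
    have h0 : 2 - 2 * u (Fin.last n) ≠ 0 := fun h => h1 (by linear_combination -h / 2)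
    have hwl : w (Fin.last n) = u (Fin.last n) - 1 := by simp [w]
    let c : ℂ := 2 / (2 - 2 * u (Fin.last n))
    refine ⟨1 - c • Matrix.vecMulVec w w, ?_, ?_⟩
    · rw [Matrix.transpose_sub, Matrix.transpose_one, Matrix.transpose_smul,
        Matrix.transpose_vecMulVec, sub_mul, mul_sub, mul_sub, one_mul, one_mul, mul_one,
        Matrix.smul_mul, Matrix.mul_smul, Matrix.vecMulVec_mul_vecMulVec, hw]
      rw [Matrix.vecMulVec_smul, smul_smul, smul_smul]
      have : c * c * (2 - 2 * u (Fin.last n)) = 2 * c := by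
        simp only [c]; field_simp
      rw [this]
      module
    · intro i
      rw [Matrix.sub_apply, Matrix.smul_apply, Matrix.vecMulVec_apply, hwl, smul_eq_mul]
      have h2 : c * (u (Fin.last n) - 1) = -1 := by
        simp only [c]; field_simp; ring
      have : c * (w i * (u (Fin.last n) - 1)) = -w i := by
        rw [mul_left_comm, h2]; ring
      rw [this, Matrix.one_apply]
      simp [w, Pi.single_apply]
  by_cases h : u (Fin.last n) = 1
  · obtain ⟨g, hg, hgu⟩ := key (-u) (by simpa using hu) (by rw [Pi.neg_apply, h]; norm_num)
    exact ⟨-g, by simpa using hg, fun i => by simp [hgu]⟩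
  · exact key u hu h

theorem eval_fockAction {n : ℕ} (g : Matrix (Fin n) (Fin n) ℂ) (x : Fin n × ℕ → ℂ) (p : Fock n) :
    eval x (fockAction n g p) = eval (fun s => ∑ l, g l s.1 * x (l, s.2)) p := by
  have : (eval x).comp (fockAction n g).toRingHom = eval (fun s => ∑ l, g l s.1 * x (l, s.2)) := by
    refine ringHom_ext (fun c => ?_) fun s => ?_
    · simp [fockAction]
    · simp [fockAction]
  exact congrArg (fun F => F p) this

theorem fockAction_X {n : ℕ} (g : Matrix (Fin n) (Fin n) ℂ) (s : Fin n × ℕ) :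
    fockAction n g (X s) = ∑ l, C (g l s.1) * X (l, s.2) := aeval_X _ _

theorem eval_quad {n : ℕ} (x : Fin n × ℕ → ℂ) (a b : ℕ) :
    eval x (quad n a b) = ∑ i, x (i, a) * x (i, b) := by
  simp [quad]

theorem sum_orthogonal {n : ℕ} {g : Matrix (Fin n) (Fin n) ℂ} (hg : g.transpose * g = 1)
    (v w : Fin n → ℂ) :
    ∑ i, (∑ l, g l i * v l) * (∑ l, g l i * w l) = ∑ i, v i * w i := by
  have h1 : g * g.transpose = 1 := mul_eq_one_comm.mp hg
  have h2 : ∀ v : Fin n → ℂ, (fun i => ∑ l, g l i * v l) = g.transpose.mulVec v := fun v => rfl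
  change (fun i => ∑ l, g l i * v l) ⬝ᵥ (fun i => ∑ l, g l i * w l) = v ⬝ᵥ w
  rw [h2, h2, Matrix.dotProduct_mulVec, Matrix.vecMul_transpose, Matrix.mulVec_mulVec, h1,
    Matrix.one_mulVec]

/-- Fock space of rank `n + 1` as polynomials in the last coordinates. -/
def splitLast (n : ℕ) : Fock (n + 1) →ₐ[ℂ] MvPolynomial ℕ (Fock n) :=
  aeval fun s => Fin.lastCases (motive := fun _ => MvPolynomial ℕ (Fock n)) (X s.2)
    (fun i => C (X (i, s.2))) s.1

/-- The inverse of `splitLast`. -/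
def joinLast (n : ℕ) : MvPolynomial ℕ (Fock n) →+* Fock (n + 1) :=
  eval₂Hom (rename fun s : Fin n × ℕ => (s.1.castSucc, s.2)).toRingHom fun k => X (Fin.last n, k)

theorem joinLast_splitLast {n : ℕ} (p : Fock (n + 1)) : joinLast n (splitLast n p) = p := by
  have : (joinLast n).comp (splitLast n).toRingHom = RingHom.id _ := by
    refine ringHom_ext (fun c => ?_) fun s => ?_
    · simp [splitLast, joinLast, MvPolynomial.algebraMap_apply]
    · obtain ⟨i, k⟩ := s
      induction i using Fin.lastCases <;> simp [splitLast, joinLast]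
  exact congrArg (fun F => F p) this

/-- The block matrix with blocks `g` and `1`. -/
def extendLast {n : ℕ} (g : Matrix (Fin n) (Fin n) ℂ) : Matrix (Fin (n + 1)) (Fin (n + 1)) ℂ :=
  fun l i => Fin.lastCases (Fin.lastCases 1 (fun _ => 0) i)
    (fun l' => Fin.lastCases 0 (fun i' => g l' i') i) l

theorem extendLast_orthogonal {n : ℕ} {g : Matrix (Fin n) (Fin n) ℂ} (hg : g.transpose * g = 1) :
    (extendLast g).transpose * extendLast g = 1 := by
  ext i k
  have h := fun i k => congrFun (congrFun hg i) k
  simp only [Matrix.mul_apply, Matrix.transpose_apply] at h ⊢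
  rw [Fin.sum_univ_castSucc]
  induction i using Fin.lastCases <;> induction k using Fin.lastCases <;>
    simp [extendLast, h, Matrix.one_apply, Fin.castSucc_ne_last, (Fin.castSucc_ne_last _).symm]

theorem splitLast_fockAction {n : ℕ} (g : Matrix (Fin n) (Fin n) ℂ) (p : Fock (n + 1)) :
    splitLast n (fockAction (n + 1) (extendLast g) p) =
      MvPolynomial.map (fockAction n g).toRingHom (splitLast n p) := by
  have : (splitLast n).toRingHom.comp (fockAction (n + 1) (extendLast g)).toRingHom =
      (MvPolynomial.map (fockAction n g).toRingHom).comp (splitLast n).toRingHom := by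
    refine ringHom_ext (fun c => ?_) fun s => ?_
    · simp [splitLast, fockAction, MvPolynomial.algebraMap_apply]
    · obtain ⟨i, k⟩ := s
      have hC : ∀ (c : ℂ), splitLast n (C c) = C (C c) := fun c => by
        simp [splitLast, MvPolynomial.algebraMap_apply]
      have h1 : ∀ k, splitLast n (X (Fin.last n, k)) = X k := fun k => by simp [splitLast]
      have h2 : ∀ i k, splitLast n (X (Fin.castSucc i, k)) = C (X (i, k)) := fun i k => by
        simp [splitLast]
      simp only [RingHom.comp_apply, AlgHom.toRingHom_eq_coe, RingHom.coe_coe, fockAction_X,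
        map_sum, map_mul, hC]
      rw [Fin.sum_univ_castSucc]
      simp only [h1, h2]
      induction i using Fin.lastCases <;> simp [extendLast, h1, h2, fockAction_X]
  exact congrArg (fun F => F p) this

/-- The stabiliser of the last basis vector contains O(n). The coefficients of p with respect to the
last coordinates are therefore O(n)-invariants, and scalar products in rank n differ from those in
rank n + 1 by products of last coordinates. -/
theorem mem_adjoin_last {n : ℕ}
    (ih : ∀ p : Fock n, (∀ g : Matrix (Fin n) (Fin n) ℂ, g.transpose * g = 1 →
      fockAction n g p = p) → p ∈ quadAlgebra n)
    {p : Fock (n + 1)} (hp : ∀ g : Matrix (Fin (n + 1)) (Fin (n + 1)) ℂ, g.transpose * g = 1 →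
      fockAction (n + 1) g p = p) :
    p ∈ Algebra.adjoin ℂ (Set.range (Sum.elim (fun k : ℕ => (X (Fin.last n, k) : Fock (n + 1)))
      fun s : ℕ × ℕ => quad (n + 1) s.1 s.2)) := by
  set B := Algebra.adjoin ℂ (Set.range (Sum.elim (fun k : ℕ => (X (Fin.last n, k) : Fock (n + 1)))
      fun s : ℕ × ℕ => quad (n + 1) s.1 s.2)) with hB
  have hX : ∀ k, X (Fin.last n, k) ∈ B := fun k => Algebra.subset_adjoin ⟨Sum.inl k, rfl⟩
  have hQ : ∀ a b, quad (n + 1) a b ∈ B := fun a b => Algebra.subset_adjoin ⟨Sum.inr (a, b), rfl⟩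
  have hcoeff : ∀ d, coeff d (splitLast n p) ∈ quadAlgebra n := by
    intro d
    refine ih _ fun g hg => ?_
    have := splitLast_fockAction g p
    rw [hp _ (extendLast_orthogonal hg)] at this
    conv_rhs => rw [this]
    rw [coeff_map]
    rfl
  have hren : ∀ r ∈ quadAlgebra n, rename (fun s : Fin n × ℕ => (s.1.castSucc, s.2)) r ∈ B := by
    intro r hr
    induction hr using Algebra.adjoin_induction with
    | mem r hr =>
      obtain ⟨⟨a, b⟩, rfl⟩ := hr
      have : rename (fun s : Fin n × ℕ => (s.1.castSucc, s.2)) (quad n a b) =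
          quad (n + 1) a b - X (Fin.last n, a) * X (Fin.last n, b) := by
        rw [quad, quad, Fin.sum_univ_castSucc]
        simp
      change rename _ (quad n a b) ∈ B
      rw [this]
      exact sub_mem (hQ a b) (mul_mem (hX a) (hX b))
    | algebraMap c =>
      rw [AlgHom.commutes]
      exact B.algebraMap_mem c
    | add r s _ _ h h' => rw [map_add]; exact add_mem h h'
    | mul r s _ _ h h' => rw [map_mul]; exact mul_mem h h'
  rw [← joinLast_splitLast p, joinLast, coe_eval₂Hom, eval₂_eq]
  exact sum_mem fun d _ => mul_mem (hren _ (hcoeff d)) (prod_mem fun k _ => pow_mem (hX k) _)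

/-- Clears the denominators s⁻¹, where s is a square root of |x_m|². Since s² is itself a scalar
product, the result has only an even part G₀ and an odd part sG₁. -/
theorem exists_quad_pow_mul_eval {n : ℕ} (m : ℕ) (F : MvPolynomial (ℕ ⊕ ℕ × ℕ) ℂ) :
    ∃ N : ℕ, ∃ G₀ ∈ quadAlgebra n, ∃ G₁ ∈ quadAlgebra n, ∀ (x : Fin n × ℕ → ℂ) (s : ℂ), s ≠ 0 →
      s * s = eval x (quad n m m) →
      eval x (quad n m m) ^ N * eval (Sum.elim (fun k => s⁻¹ * eval x (quad n m k))
        fun t => eval x (quad n t.1 t.2)) F = eval x G₀ + s * eval x G₁ := by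
  induction F using MvPolynomial.induction_on with
  | C c =>
    exact ⟨0, C c, (quadAlgebra n).algebraMap_mem c, 0, zero_mem _, fun x s _ _ => by simp⟩
  | add F F' h h' =>
    obtain ⟨N, G₀, h₀, G₁, h₁, h⟩ := h
    obtain ⟨N', G₀', h₀', G₁', h₁', h'⟩ := h'
    refine ⟨N + N', quad n m m ^ N' * G₀ + quad n m m ^ N * G₀',
      add_mem (mul_mem (pow_mem (quad_mem_quadAlgebra n m m) _) h₀)
        (mul_mem (pow_mem (quad_mem_quadAlgebra n m m) _) h₀'),
      quad n m m ^ N' * G₁ + quad n m m ^ N * G₁',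
      add_mem (mul_mem (pow_mem (quad_mem_quadAlgebra n m m) _) h₁)
        (mul_mem (pow_mem (quad_mem_quadAlgebra n m m) _) h₁'), fun x s hs hs' => ?_⟩
    have e := h x s hs hs'
    have e' := h' x s hs hs'
    simp only [map_add, map_mul, map_pow]
    rw [pow_add]
    linear_combination (eval x (quad n m m)) ^ N' * e + (eval x (quad n m m)) ^ N * e'
  | mul_X F t h =>
    obtain ⟨N, G₀, h₀, G₁, h₁, h⟩ := h
    rcases t with k | ⟨a, b⟩
    · refine ⟨N + 1, quad n m m * G₁ * quad n m k,
        mul_mem (mul_mem (quad_mem_quadAlgebra n m m) h₁) (quad_mem_quadAlgebra n m k),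
        G₀ * quad n m k, mul_mem h₀ (quad_mem_quadAlgebra n m k), fun x s hs hs' => ?_⟩
      have e := h x s hs hs'
      simp only [map_mul, eval_X, Sum.elim_inl]
      rw [pow_succ]
      have hs2 : s⁻¹ * eval x (quad n m m) = s := by
        rw [← hs', inv_mul_cancel_left₀ hs]
      have hs3 : s * s * eval x G₁ = eval x (quad n m m) * eval x G₁ := by rw [hs']
      linear_combination (s⁻¹ * eval x (quad n m m) * eval x (quad n m k)) * e +
        eval x (quad n m k) * (eval x G₀ + s * eval x G₁) * hs2 + eval x (quad n m k) * hs3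
    · refine ⟨N, G₀ * quad n a b, mul_mem h₀ (quad_mem_quadAlgebra n a b), G₁ * quad n a b,
        mul_mem h₁ (quad_mem_quadAlgebra n a b), fun x s hs hs' => ?_⟩
      have e := h x s hs hs'
      simp only [map_mul, eval_X, Sum.elim_inr]
      linear_combination eval x (quad n a b) * e

/-- **First fundamental theorem of invariant theory** for the orthogonal group. -/
theorem mem_quadAlgebra_of_invariant (n : ℕ) (p : Fock n)
    (hp : ∀ g : Matrix (Fin n) (Fin n) ℂ, g.transpose * g = 1 → fockAction n g p = p) :
    p ∈ quadAlgebra n := by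
  induction n with
  | zero =>
    rw [eq_C_of_isEmpty p]
    exact (quadAlgebra 0).algebraMap_mem _
  | succ n ih =>
    have h1 := mem_adjoin_last ih hp
    rw [Algebra.adjoin_range_eq_range_aeval] at h1
    obtain ⟨F, hF⟩ := h1
    have hFp : ∀ x : Fin (n + 1) × ℕ → ℂ, eval x p =
        eval (Sum.elim (fun k => x (Fin.last n, k)) fun t => eval x (quad (n + 1) t.1 t.2)) F := by
      intro x
      rw [← hF]
      change eval x (aeval _ F) = _
      rw [← AlgHom.coe_toRingHom, ← RingHom.comp_apply]
      refine congrArg (fun G : _ →+* ℂ => G F) (ringHom_ext (fun c => ?_) fun t => ?_)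
      · simp
      · rcases t with k | t <;> simp
    -- An auxiliary vector x_m on which p does not depend: it serves as the direction to be rotated
    -- to the last axis and is eliminated by the Laplacian.
    obtain ⟨m, hm⟩ : ∃ m, m ∉ p.vars.image Prod.snd := Infinite.exists_notMem_finset _
    have hpm : ∀ i, pderiv (i, m) p = 0 := fun i =>
      pderiv_eq_zero_of_notMem_vars fun h => hm (Finset.mem_image_of_mem Prod.snd h)
    obtain ⟨N, G₀, h₀, G₁, h₁, hG⟩ := exists_quad_pow_mul_eval (n := n + 1) m F
    refine mem_quadAlgebra_of_quad_pow_mul_mem (m := m) n.succ_ne_zero hpm N ?_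
    -- An orthogonal matrix whose last column is x_m / s turns the last coordinate of the k-th
    -- vector into s⁻¹ x_m·x_k and preserves scalar products.
    have hunit : ∀ (x : Fin (n + 1) × ℕ → ℂ) (s : ℂ), s ≠ 0 → s * s = eval x (quad (n + 1) m m) →
        eval x p = eval (Sum.elim (fun k => s⁻¹ * eval x (quad (n + 1) m k))
          fun t => eval x (quad (n + 1) t.1 t.2)) F := by
      intro x s hs hs'
      obtain ⟨g, hg, hgu⟩ := exists_orthogonal_col (fun i => s⁻¹ * x (i, m)) (by
        have : ∀ i, s⁻¹ * x (i, m) * (s⁻¹ * x (i, m)) = (s * s)⁻¹ * (x (i, m) * x (i, m)) := by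
          intro i; rw [mul_inv]; ring
        simp only [this]
        rw [← Finset.mul_sum, ← eval_quad, ← hs', inv_mul_cancel₀ (mul_ne_zero hs hs)])
      rw [← hp g hg, eval_fockAction, hFp]
      congr 2
      funext t
      rcases t with k | ⟨a, b⟩
      · simp only [Sum.elim_inl, hgu]
        rw [eval_quad, Finset.mul_sum]
        exact Finset.sum_congr rfl fun i _ => mul_assoc _ _ _
      · simp only [Sum.elim_inr, eval_quad]
        exact sum_orthogonal hg (fun i => x (i, a)) fun i => x (i, b)
    -- Averaging over the two roots s and -s removes the odd part. The extra factor covers the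
    -- points where |x_m|² = 0 and no unit vector is available.
    have hmain : quad (n + 1) m m * (quad (n + 1) m m ^ N * p - G₀) = 0 := by
      refine MvPolynomial.funext fun x => ?_
      rw [map_mul, map_sub, map_mul, map_pow, map_zero]
      by_cases hx : eval x (quad (n + 1) m m) = 0
      · rw [hx, zero_mul]
      obtain ⟨s, hs⟩ : ∃ s : ℂ, s * s = eval x (quad (n + 1) m m) := by
        obtain ⟨s, hs⟩ := IsAlgClosed.exists_pow_nat_eq (eval x (quad (n + 1) m m)) two_pos
        exact ⟨s, by rw [← sq, hs]⟩
      have hs0 : s ≠ 0 := by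
        rintro rfl
        exact hx (by rw [← hs, mul_zero])
      have e1 := hG x s hs0 hs
      have e2 := hG x (-s) (neg_ne_zero.mpr hs0) (by rw [neg_mul_neg, hs])
      rw [← hunit x s hs0 hs] at e1
      rw [← hunit x (-s) (neg_ne_zero.mpr hs0) (by rw [neg_mul_neg, hs])] at e2
      have : eval x (quad (n + 1) m m) ^ N * eval x p - eval x G₀ = 0 := by
        linear_combination e1 / 2 + e2 / 2
      rw [this, mul_zero]
    have hq0 : quad (n + 1) m m ≠ 0 := by
      intro h
      have := congrArg (eval fun t : Fin (n + 1) × ℕ => if t.1 = Fin.last n then (1 : ℂ) else 0) h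
      rw [eval_quad] at this
      simp at this
    have := (mul_eq_zero.mp hmain).resolve_left hq0
    rw [sub_eq_zero] at this
    rwa [this]

end FirstFundamentalTheorem

/-! ### Relations among scalar products of n vectors: none in low weight. -/

section SecondFundamentalTheorem

open MvPolynomial

/-- The Gram matrix of the vectors `(v i a)ᵢ`, `a ∈ ℕ`. -/
def gram {n : ℕ} (v : Fin n → ℕ → ℂ) : Sym2 ℕ → ℂ :=
  Sym2.lift ⟨fun a b => ∑ i, v i a * v i b, fun _ _ => Finset.sum_congr rfl fun _ _ => mul_comm _ _⟩

theorem gram_mk {n : ℕ} (v : Fin n → ℕ → ℂ) (a b : ℕ) : gram v s(a, b) = ∑ i, v i a * v i b := rfl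

/-- The polynomial functions on symmetric matrices which vanish on the Gram matrices of vectors in
`ℂⁿ`. -/
def VanishesOnGram (n : ℕ) (f : MvPolynomial (Sym2 ℕ) ℂ) : Prop :=
  ∀ v : Fin n → ℕ → ℂ, eval (gram v) f = 0

theorem derivative_aeval_line {σ : Type*} (G W : σ → ℂ) (S : Finset σ) (hS : ∀ s ∉ S, W s = 0)
    (f : MvPolynomial σ ℂ) :
    (Polynomial.derivative (aeval (fun s => Polynomial.C (G s) + Polynomial.C (W s) * Polynomial.X)
      f)).eval 0 = ∑ s ∈ S, W s * eval G (pderiv s f) := by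
  classical
  induction f using MvPolynomial.induction_on with
  | C c => simp
  | add p q hp hq =>
    simp only [map_add, Polynomial.eval_add, hp, hq, mul_add, Finset.sum_add_distrib]
  | mul_X p t hp =>
    have h0 : (aeval (fun s => Polynomial.C (G s) + Polynomial.C (W s) * Polynomial.X) p).eval 0 =
        eval G p := by
      rw [← Polynomial.coe_evalRingHom, ← AlgHom.coe_toRingHom, ← RingHom.comp_apply]
      refine congrArg (fun F : _ →+* ℂ => F p) (ringHom_ext (fun c => ?_) fun s => ?_) <;> simp
    rw [map_mul, aeval_X, Polynomial.derivative_mul, Polynomial.eval_add, Polynomial.eval_mul, hp,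
      Polynomial.eval_mul, h0]
    simp only [pderiv_mul, pderiv_X, map_add, map_mul, eval_X, mul_add, Finset.sum_add_distrib]
    congr 1
    · rw [Finset.sum_mul]
      simp [mul_assoc]
    · rw [Finset.sum_eq_single t]
      · simp
        ring
      · intro s _ hs
        simp [Pi.single_eq_of_ne hs.symm]
      · intro ht
        rw [hS t ht, zero_mul]

theorem gram_cons {n : ℕ} (v : Fin n → ℕ → ℂ) (w : ℕ → ℂ) (s : Sym2 ℕ) :
    gram (Fin.cons w v : Fin (n + 1) → ℕ → ℂ) s = gram v s + gram (fun _ : Fin 1 => w) s := by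
  induction s using Sym2.ind with
  | _ a b =>
    rw [gram_mk, gram_mk, gram_mk, Fin.sum_univ_succ]
    simp [add_comm]

/-- Adding √τ w as an extra vector perturbs the Gram matrix by τ times the rank-one matrix of w. -/
theorem VanishesOnGram.aeval_line {n : ℕ} {f : MvPolynomial (Sym2 ℕ) ℂ}
    (hf : VanishesOnGram (n + 1) f) (v : Fin n → ℕ → ℂ) (w : ℕ → ℂ) :
    aeval (fun s => Polynomial.C (gram v s) +
      Polynomial.C (gram (fun _ : Fin 1 => w) s) * Polynomial.X) f = 0 := by
  refine Polynomial.funext fun τ => ?_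
  obtain ⟨t, ht⟩ := IsAlgClosed.exists_pow_nat_eq τ two_pos
  have := hf (Fin.cons (fun a => t * w a) v)
  rw [Polynomial.eval_zero, ← this, ← Polynomial.coe_evalRingHom, ← AlgHom.coe_toRingHom,
    ← RingHom.comp_apply]
  refine congrArg (fun F : _ →+* ℂ => F f) (ringHom_ext (fun c => ?_) fun s => ?_)
  · simp
  · induction s using Sym2.ind with
    | _ a b =>
      rw [RingHom.comp_apply, eval_X, gram_cons]
      simp [gram_mk, ← ht, Polynomial.eval_finsetSum]
      ring

/-- Differentiating at τ = 0 along the rank-one matrix of w gives a linear relation among the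
partial derivatives. Taking w = e_a yields the diagonal ones, and w = e_a + e_b then the others. -/
theorem VanishesOnGram.pderiv {n : ℕ} {f : MvPolynomial (Sym2 ℕ) ℂ}
    (hf : VanishesOnGram (n + 1) f) (s : Sym2 ℕ) : VanishesOnGram n (MvPolynomial.pderiv s f) := by
  classical
  intro v
  have key : ∀ (w : ℕ → ℂ) (S : Finset (Sym2 ℕ)),
      (∀ s ∉ S, gram (fun _ : Fin 1 => w) s = 0) →
      ∑ s ∈ S, gram (fun _ : Fin 1 => w) s * eval (gram v) (MvPolynomial.pderiv s f) = 0 := by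
    intro w S hS
    rw [← derivative_aeval_line _ _ S hS, hf.aeval_line]
    simp
  have hdiag : ∀ a, eval (gram v) (MvPolynomial.pderiv s(a, a) f) = 0 := by
    intro a
    have := key (Pi.single a 1) {s(a, a)} (by
      intro s hs
      induction s using Sym2.ind with
      | _ b c =>
        rw [gram_mk]
        by_cases hb : b = a
        · by_cases hc : c = a
          · exact absurd (by rw [hb, hc]; exact Finset.mem_singleton_self _) hs
          · simp [hc]
        · simp [hb])
    simpa [gram_mk] using this
  induction s using Sym2.ind with
  | _ a b =>
    by_cases hab : a = b
    · subst hab; exact hdiag a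
    · have := key (Pi.single a 1 + Pi.single b 1) {s(a, a), s(b, b), s(a, b)} (by
        intro s hs
        induction s using Sym2.ind with
        | _ c d =>
          rw [gram_mk]
          simp only [Finset.mem_insert, Finset.mem_singleton, Sym2.eq_iff, not_or] at hs
          by_cases hca : c = a <;> by_cases hda : d = a <;> by_cases hcb : c = b <;>
            by_cases hdb : d = b <;> simp_all)
      rw [Finset.sum_insert, Finset.sum_insert, Finset.sum_singleton, hdiag, hdiag] at this
      · have hba : b ≠ a := fun h => hab h.symm
        simpa [gram_mk, Pi.single_apply, hab, hba] using this
      · simpa using fun h : b = a => hab h.symm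
      · simp [hab]

/-- The first `n` rows of a symmetric matrix of rank `n` are arbitrary. -/
theorem VanishesOnGram.eq_zero_of_vars {n : ℕ} {f : MvPolynomial (Sym2 ℕ) ℂ}
    (hf : VanishesOnGram n f) (hv : ∀ s ∈ f.vars, ∃ a b, s = s(a, b) ∧ a < n) : f = 0 := by
  classical
  induction n generalizing f with
  | zero =>
    have h0 : f.vars = ∅ := by
      rw [Finset.eq_empty_iff_forall_notMem]
      intro s hs
      obtain ⟨a, b, _, h⟩ := hv s hs
      omega
    have hfC := vars_eq_empty_iff_eq_C.mp h0
    have := hf fun _ _ => 0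
    rw [hfC, eval_C] at this
    rw [hfC, this, C_0]
  | succ n ih =>
    -- Schur complement: with t² = Q(0,0) the row u = Q(0,·)/t accounts for row 0 of Q. The
    -- substitution freezes that row and shifts the remaining indices down by one, so it lands in
    -- the case of n vectors.
    have key : ∀ Q : Sym2 ℕ → ℂ, Q s(0, 0) ≠ 0 → eval Q f = 0 := by
      intro Q hQ
      obtain ⟨t, ht⟩ := IsAlgClosed.exists_pow_nat_eq (Q s(0, 0)) two_pos
      have ht0 : t ≠ 0 := by rintro rfl; exact hQ (by rw [← ht]; ring)
      let u : ℕ → ℂ := fun b => Q s(0, b) / t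
      let φ' : ℕ → ℕ → MvPolynomial (Sym2 ℕ) ℂ := fun a b =>
        if a = 0 ∨ b = 0 then C (Q s(a, b)) else X s(a - 1, b - 1) + C (u a * u b)
      let φ : Sym2 ℕ → MvPolynomial (Sym2 ℕ) ℂ := Sym2.lift ⟨φ', fun a b => by
        simp only [φ', or_comm (a := a = 0), Sym2.eq_swap (a := a), mul_comm (u a),
          Sym2.eq_swap (a := a - 1)]⟩
      have hzero : bind₁ φ f = 0 := by
        refine ih (fun v => ?_) fun s hs => ?_
        · let v' : Fin (n + 1) → ℕ → ℂ := Fin.cons u fun i b => if b = 0 then 0 else v i (b - 1)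
          rw [← hf v', ← AlgHom.coe_toRingHom, ← RingHom.comp_apply]
          refine congrArg (fun F : _ →+* ℂ => F f) (ringHom_ext (fun c => by simp) fun s => ?_)
          induction s using Sym2.ind with
          | _ a b =>
            simp only [RingHom.comp_apply, RingHom.coe_coe, bind₁_X_right,
              eval_X]
            change eval (gram v) (φ' a b) = _
            have hu0 : u 0 = t := by
              simp only [u]; rw [← ht]; field_simp
            have hu : ∀ b, t * u b = Q s(0, b) := fun b => by simp only [u]; field_simp
            rw [gram_mk, Fin.sum_univ_succ]
            simp only [v', Fin.cons_zero, Fin.cons_succ]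
            rcases Nat.eq_zero_or_pos a with rfl | ha
            · simp [φ', hu0, hu]
            · rcases Nat.eq_zero_or_pos b with rfl | hb
              · simp [φ', hu0, mul_comm (u a), hu, Sym2.eq_swap (a := a)]
              · simp [φ', ha.ne', hb.ne', gram_mk, add_comm]
        · obtain ⟨s', hs', hss'⟩ := Finset.mem_biUnion.mp (vars_bind₁ φ f hs)
          obtain ⟨a, b, rfl, hab⟩ := hv s' hs'
          change s ∈ (φ' a b).vars at hss'
          simp only [φ'] at hss'
          split_ifs at hss' with h0
          · simp at hss'
          · rw [not_or] at h0
            have := vars_add_subset _ _ hss'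
            simp only [vars_X, vars_C, Finset.union_empty, Finset.mem_singleton] at this
            exact ⟨a - 1, b - 1, this, by omega⟩
      have := congrArg (eval (Sym2.lift ⟨fun a b => Q s(a + 1, b + 1) - u (a + 1) * u (b + 1),
        fun a b => by simp only [Sym2.eq_swap (a := a + 1), mul_comm (u (a + 1))]⟩)) hzero
      rw [map_zero] at this
      rw [← this, ← AlgHom.coe_toRingHom, ← RingHom.comp_apply]
      refine congrArg (fun F : _ →+* ℂ => F f) (ringHom_ext (fun c => by simp) fun s => ?_)
      induction s using Sym2.ind with
      | _ a b =>
        simp only [RingHom.comp_apply, RingHom.coe_coe, bind₁_X_right,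
          eval_X]
        change _ = eval _ (φ' a b)
        rcases Nat.eq_zero_or_pos a with rfl | ha
        · simp [φ']
        · rcases Nat.eq_zero_or_pos b with rfl | hb
          · simp [φ']
          · have ha' : a - 1 + 1 = a := by omega
            have hb' : b - 1 + 1 = b := by omega
            simp [φ', ha.ne', hb.ne', ha', hb']
    have hmul : X s(0, 0) * f = 0 := by
      refine MvPolynomial.funext fun Q => ?_
      rw [map_mul, eval_X, map_zero]
      by_cases hQ : Q s(0, 0) = 0
      · rw [hQ, zero_mul]
      · rw [key Q hQ, mul_zero]
    exact (mul_eq_zero.mp hmul).resolve_left (X_ne_zero _)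

/-- The weight of the variable `s(a, b)`. -/
def symWeight : Sym2 ℕ → ℕ := Sym2.lift ⟨fun a b => a + b + 2, fun a b => by simp only [add_comm a]⟩

theorem symWeight_mk (a b : ℕ) : symWeight s(a, b) = a + b + 2 := rfl

theorem exists_coeff_ne_zero_of_mem_vars {σ : Type*} {f : MvPolynomial σ ℂ} {s : σ}
    (hs : s ∈ f.vars) : ∃ d, coeff (d + Finsupp.single s 1) f ≠ 0 := by
  obtain ⟨d, hd, hds⟩ := (mem_vars_iff_mem_support s).mp hs
  refine ⟨d - Finsupp.single s 1, ?_⟩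
  rw [tsub_add_cancel_of_le]
  · exact mem_support_iff.mp hd
  · rw [Finsupp.single_le_iff]
    exact Nat.one_le_iff_ne_zero.mpr (Finsupp.mem_support_iff.mp hds)

/-- The relations between the quadratic invariants start in weight `(n + 1) (n + 2)`. -/
theorem VanishesOnGram.eq_zero_of_weight {n W : ℕ} {f : MvPolynomial (Sym2 ℕ) ℂ}
    (hf : VanishesOnGram n f) (hW : IsWeightedHomogeneous symWeight f W)
    (hWn : W < (n + 1) * (n + 2)) : f = 0 := by
  have hweight : ∀ d s, coeff (d + Finsupp.single s 1) f ≠ 0 →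
      Finsupp.weight symWeight d + symWeight s = W := by
    intro d s h
    have := hW h
    rwa [map_add, Finsupp.weight_single, one_smul] at this
  induction n generalizing f W with
  | zero =>
    refine hf.eq_zero_of_vars fun s hs => ?_
    obtain ⟨d, hd⟩ := exists_coeff_ne_zero_of_mem_vars hs
    have := hweight d s hd
    induction s using Sym2.ind with
    | _ a b => rw [symWeight_mk] at this; omega
  | succ n ih =>
    -- One has to exclude variables s(a, b) with a, b ≥ n + 1. Such a variable has weight at least
    -- 2(n+2) = (n+2)(n+3) - (n+1)(n+2), so the derivative with respect to it satisfies the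
    -- inductive bound and vanishes; in characteristic zero the variable then does not occur.
    refine hf.eq_zero_of_vars fun s hs => ?_
    induction s using Sym2.ind with
    | _ a b =>
      by_contra hcon
      push Not at hcon
      have ha := hcon a b rfl
      have hb := hcon b a Sym2.eq_swap
      obtain ⟨d, hd⟩ := exists_coeff_ne_zero_of_mem_vars hs
      have hwt := hweight d _ hd
      have hpw : IsWeightedHomogeneous symWeight (MvPolynomial.pderiv s(a, b) f)
          (W - (a + b + 2)) := by
        intro e he
        rw [coeff_pderiv] at he
        have := hweight e _ (left_ne_zero_of_mul he)
        rw [symWeight_mk] at this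
        omega
      have h0 : MvPolynomial.pderiv s(a, b) f = 0 := by
        refine ih (hf.pderiv _) hpw ?_ fun d s h => ?_
        · have : (n + 1 + 1) * (n + 1 + 2) = (n + 1) * (n + 2) + 2 * (n + 2) := by ring
          rw [symWeight_mk] at hwt
          omega
        · have := hpw h
          rwa [map_add, Finsupp.weight_single, one_smul] at this
      have h1 := congrArg (coeff d) h0
      rw [coeff_pderiv, coeff_zero] at h1
      exact mul_ne_zero hd (Nat.cast_add_one_ne_zero _) h1

end SecondFundamentalTheorem

/-! ### Weight-raising quadratic operators encoded by polynomials, and their commutators. -/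

section QuadraticOperators

open MvPolynomial

theorem end_ext {n : ℕ} {A B : Module.End ℂ (Fock n)} (h1 : A 1 = B 1)
    (hX : ∀ (p : Fin n × ℕ) (v : Fock n), A (X p * v) - X p * A v = B (X p * v) - X p * B v) :
    A = B := by
  refine LinearMap.ext fun v => ?_
  induction v using MvPolynomial.induction_on with
  | C c => rw [C_eq_smul_one, map_smul, map_smul, h1]
  | add p q hp hq => rw [map_add, map_add, hp, hq]
  | mul_X v p hv =>
    have := hX p v
    rw [hv] at this
    rw [mul_comm, sub_left_inj.mp this]

/-- The quadratic invariant with the coefficients `χ`. -/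
def quadForm (n r : ℕ) (χ : Polynomial ℂ) : Fock n :=
  ∑ m ∈ Finset.range (r - 1), (χ.eval ((m : ℂ) + 1) / 2) • quad n m (r - 2 - m)

/-- The derivation of Fock space which raises the weight by `r`, with the coefficients `χ`. -/
def shiftDer (n r : ℕ) (χ : Polynomial ℂ) : Derivation ℂ (Fock n) (Fock n) :=
  mkDerivation ℂ fun p => (((p.2 : ℂ) + 1) * χ.eval (-(p.2 : ℂ) - 1)) • X (p.1, p.2 + r)

theorem shiftDer_X {n r : ℕ} (χ : Polynomial ℂ) (p : Fin n × ℕ) : shiftDer n r χ (X p) =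
    (((p.2 : ℂ) + 1) * χ.eval (-(p.2 : ℂ) - 1)) • X (p.1, p.2 + r) :=
  mkDerivation_X _ _ _

/-- The quadratic operator on Fock space which raises the weight by `r` and satisfies
`[α(m), A] = m χ(m) α(m - r)`. -/
def quadOp (n r : ℕ) : Polynomial ℂ →ₗ[ℂ] Module.End ℂ (Fock n) where
  toFun χ := LinearMap.mulLeft ℂ (quadForm n r χ) + (shiftDer n r χ).toLinearMap
  map_add' χ χ' := by
    refine end_ext ?_ fun p v => ?_
    · simp only [LinearMap.add_apply, LinearMap.mulLeft_apply, mul_one, quadForm,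
        Polynomial.eval_add, add_div, add_smul, Finset.sum_add_distrib]
      simp
    · simp only [LinearMap.add_apply, LinearMap.mulLeft_apply,
        Derivation.coeFn_coe, Derivation.leibniz, shiftDer_X, Polynomial.eval_add,
        smul_eq_mul, smul_eq_C_mul, map_add, map_mul]
      ring
  map_smul' c χ := by
    refine end_ext ?_ fun p v => ?_
    · simp only [LinearMap.add_apply, LinearMap.mulLeft_apply, mul_one, quadForm,
        Polynomial.eval_smul, mul_div_assoc, smul_eq_mul, mul_smul, ← Finset.smul_sum,
        RingHom.id_apply, LinearMap.smul_apply]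
      simp
    · simp only [LinearMap.add_apply, LinearMap.mulLeft_apply,
        Derivation.coeFn_coe, Derivation.leibniz, shiftDer_X, Polynomial.eval_smul,
        smul_eq_mul, smul_eq_C_mul, map_mul, RingHom.id_apply, LinearMap.smul_apply]
      ring

theorem quadOp_apply {n r : ℕ} (χ : Polynomial ℂ) (v : Fock n) :
    quadOp n r χ v = quadForm n r χ * v + shiftDer n r χ v := rfl

theorem quadOp_one {n r : ℕ} (χ : Polynomial ℂ) : quadOp n r χ (1 : Fock n) = quadForm n r χ := by
  rw [quadOp_apply, mul_one, Derivation.map_one_eq_zero, add_zero]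

theorem quadOp_X_mul {n r : ℕ} (χ : Polynomial ℂ) (p : Fin n × ℕ) (v : Fock n) :
    quadOp n r χ (X p * v) - X p * quadOp n r χ v =
      (((p.2 : ℂ) + 1) * χ.eval (-(p.2 : ℂ) - 1)) • (X (p.1, p.2 + r) * v) := by
  rw [quadOp_apply, quadOp_apply, Derivation.leibniz, shiftDer_X, smul_eq_mul, smul_eq_mul,
    ← smul_mul_assoc]
  ring

theorem shiftDer_quad {n r : ℕ} (χ : Polynomial ℂ) (a b : ℕ) : shiftDer n r χ (quad n a b) =
    (((a : ℂ) + 1) * χ.eval (-(a : ℂ) - 1)) • quad n (a + r) b +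
      (((b : ℂ) + 1) * χ.eval (-(b : ℂ) - 1)) • quad n a (b + r) := by
  rw [quad, map_sum, quad, quad, Finset.smul_sum, Finset.smul_sum, ← Finset.sum_add_distrib]
  refine Finset.sum_congr rfl fun i _ => ?_
  rw [Derivation.leibniz, shiftDer_X, shiftDer_X]
  simp only [smul_eq_mul, smul_eq_C_mul]
  ring

/-- The polynomial `χ` is symmetric about `r / 2`. -/
def IsSymmetricAbout (r : ℕ) (χ : Polynomial ℂ) : Prop :=
  χ.comp (Polynomial.C (r : ℂ) - Polynomial.X) = χ

theorem IsSymmetricAbout.eval {r : ℕ} {χ : Polynomial ℂ} (h : IsSymmetricAbout r χ) {x y : ℂ}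
    (hxy : x + y = r) : χ.eval x = χ.eval y := by
  conv_lhs => rw [← h]
  rw [Polynomial.eval_comp, Polynomial.eval_sub, Polynomial.eval_C, Polynomial.eval_X]
  congr 1
  linear_combination -hxy

/-- The Leibniz rule gives two sums, which the reflection m ↦ r' - 2 - m exchanges by the symmetry
of χ'. Their equality absorbs the factor 1/2. -/
theorem shiftDer_quadForm {n r r' : ℕ} (χ : Polynomial ℂ) {χ' : Polynomial ℂ}
    (h' : IsSymmetricAbout r' χ') : shiftDer n r χ (quadForm n r' χ') =
      ∑ m ∈ Finset.range (r' - 1), (((r' : ℂ) - m - 1) * χ'.eval ((m : ℂ) + 1) *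
        χ.eval ((m : ℂ) + 1 - r')) • quad n m (r + r' - 2 - m) := by
  have h1 : shiftDer n r χ (quadForm n r' χ') =
      ∑ m ∈ Finset.range (r' - 1), (χ'.eval ((m : ℂ) + 1) / 2 * (((m : ℂ) + 1) *
        χ.eval (-(m : ℂ) - 1))) • quad n (m + r) (r' - 2 - m) +
      ∑ m ∈ Finset.range (r' - 1), (((r' : ℂ) - m - 1) * χ'.eval ((m : ℂ) + 1) *
        χ.eval ((m : ℂ) + 1 - r') / 2) • quad n m (r + r' - 2 - m) := by
    rw [quadForm, map_sum, ← Finset.sum_add_distrib]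
    refine Finset.sum_congr rfl fun m hm => ?_
    rw [Finset.mem_range] at hm
    rw [Derivation.map_smul, shiftDer_quad, smul_add, smul_smul, smul_smul,
      show r' - 2 - m + r = r + r' - 2 - m by omega]
    have : ((r' - 2 - m : ℕ) : ℂ) = r' - 2 - m := by
      rw [Nat.cast_sub (by omega), Nat.cast_sub (by omega)]; norm_num
    rw [this]
    congr 2
    rw [show -((r' : ℂ) - 2 - m) - 1 = (m : ℂ) + 1 - r' by ring]
    ring
  have h2 : ∑ m ∈ Finset.range (r' - 1), (χ'.eval ((m : ℂ) + 1) / 2 * (((m : ℂ) + 1) *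
        χ.eval (-(m : ℂ) - 1))) • quad n (m + r) (r' - 2 - m) =
      ∑ m ∈ Finset.range (r' - 1), (((r' : ℂ) - m - 1) * χ'.eval ((m : ℂ) + 1) *
        χ.eval ((m : ℂ) + 1 - r') / 2) • quad n m (r + r' - 2 - m) := by
    rw [← Finset.sum_range_reflect]
    refine Finset.sum_congr rfl fun m hm => ?_
    rw [Finset.mem_range] at hm
    rw [show r' - 1 - 1 - m + r = r + r' - 2 - m by omega,
      show r' - 2 - (r' - 1 - 1 - m) = m by omega, quad_comm]
    have : ((r' - 1 - 1 - m : ℕ) : ℂ) = r' - 2 - m := by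
      rw [show r' - 1 - 1 - m = r' - (m + 2) by omega, Nat.cast_sub (by omega)]
      push_cast; ring
    rw [this, h'.eval (x := (r' : ℂ) - 2 - m + 1) (y := m + 1) (by ring),
      show -((r' : ℂ) - 2 - m) - 1 = (m : ℂ) + 1 - r' by ring]
    congr 1
    ring
  rw [h1, h2, ← Finset.sum_add_distrib]
  refine Finset.sum_congr rfl fun m _ => ?_
  rw [← add_smul, add_halves]

/-- The coefficients of a commutator of quadratic operators. -/
def bracketPoly (r r' : ℕ) (χ χ' : Polynomial ℂ) : Polynomial ℂ :=
  (Polynomial.C (r' : ℂ) - Polynomial.X) * χ' * χ.comp (Polynomial.X - Polynomial.C (r' : ℂ)) -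
    (Polynomial.C (r : ℂ) - Polynomial.X) * χ * χ'.comp (Polynomial.X - Polynomial.C (r : ℂ))

theorem eval_bracketPoly (r r' : ℕ) (χ χ' : Polynomial ℂ) (x : ℂ) :
    (bracketPoly r r' χ χ').eval x = (r' - x) * χ'.eval x * χ.eval (x - r') -
      (r - x) * χ.eval x * χ'.eval (x - r) := by
  simp [bracketPoly, Polynomial.eval_comp]

theorem IsSymmetricAbout.bracketPoly {r r' : ℕ} {χ χ' : Polynomial ℂ} (h : IsSymmetricAbout r χ)
    (h' : IsSymmetricAbout r' χ') :
    IsSymmetricAbout (r + r') (Heisenberg.bracketPoly r r' χ χ') := by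
  refine Polynomial.funext fun x => ?_
  rw [Polynomial.eval_comp, Polynomial.eval_sub, Polynomial.eval_C, Polynomial.eval_X,
    eval_bracketPoly, eval_bracketPoly]
  push_cast
  rw [h.eval (x := (r : ℂ) + r' - x - r') (y := x) (by ring),
    h'.eval (x := (r : ℂ) + r' - x) (y := x - r) (by ring),
    h.eval (x := (r : ℂ) + r' - x) (y := x - r') (by ring),
    h'.eval (x := (r : ℂ) + r' - x - r) (y := x) (by ring)]
  ring

/-- The two halves of the bracket polynomial contribute equally, by reflection in the full range of
m. The resulting sum is cut at m = r' - 1, where its term vanishes: below lies one derivation term,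
above lies the other after reflection, with a sign. -/
theorem quadForm_bracketPoly {n r r' : ℕ} (hr : 1 ≤ r) (hr' : 1 ≤ r') {χ χ' : Polynomial ℂ}
    (h : IsSymmetricAbout r χ) (h' : IsSymmetricAbout r' χ') :
    quadForm n (r + r') (bracketPoly r r' χ χ') =
      shiftDer n r χ (quadForm n r' χ') - shiftDer n r' χ' (quadForm n r χ) := by
  rw [shiftDer_quadForm χ h', shiftDer_quadForm χ' h]
  set T : ℕ → Fock n := fun m => (((r' : ℂ) - m - 1) * χ'.eval ((m : ℂ) + 1) *
        χ.eval ((m : ℂ) + 1 - r')) • quad n m (r + r' - 2 - m) with hT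
  set T' : ℕ → Fock n := fun m => (((r : ℂ) - m - 1) * χ.eval ((m : ℂ) + 1) *
        χ'.eval ((m : ℂ) + 1 - r)) • quad n m (r' + r - 2 - m) with hT'
  have hrefl : ∀ m, m + 2 ≤ r + r' → T (r + r' - 2 - m) = -T' m := by
    intro m hm
    simp only [hT, hT']
    have : ((r + r' - 2 - m : ℕ) : ℂ) = r + r' - 2 - m := by
      rw [Nat.cast_sub (by omega), Nat.cast_sub (by omega)]; push_cast; ring
    rw [this, show r + r' - 2 - (r + r' - 2 - m) = m by omega, quad_comm,
      h'.eval (x := (r : ℂ) + r' - 2 - m + 1) (y := (m : ℂ) + 1 - r) (by ring),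
      h.eval (x := (r : ℂ) + r' - 2 - m + 1 - r') (y := (m : ℂ) + 1) (by ring),
      add_comm r' r, ← neg_smul]
    congr 1
    ring
  have hsum : ∑ m ∈ Finset.range (r + r' - 1), T' m = -∑ m ∈ Finset.range (r + r' - 1), T m := by
    rw [← Finset.sum_range_reflect T, ← Finset.sum_neg_distrib]
    refine Finset.sum_congr rfl fun m hm => ?_
    rw [Finset.mem_range] at hm
    rw [show r + r' - 1 - 1 - m = r + r' - 2 - m by omega, hrefl m (by omega), neg_neg]
  have hlhs : quadForm n (r + r') (bracketPoly r r' χ χ') =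
      ∑ m ∈ Finset.range (r + r' - 1), T m := by
    have : quadForm n (r + r') (bracketPoly r r' χ χ') =
        (1 / 2 : ℂ) • (∑ m ∈ Finset.range (r + r' - 1), T m -
          ∑ m ∈ Finset.range (r + r' - 1), T' m) := by
      rw [← Finset.sum_sub_distrib, Finset.smul_sum, quadForm]
      refine Finset.sum_congr rfl fun m _ => ?_
      simp only [hT, hT', eval_bracketPoly]
      rw [add_comm r' r, ← sub_smul, smul_smul]
      congr 1
      ring
    rw [this, hsum]
    module
  have hmid : T (r' - 1) = 0 := by
    simp only [hT]
    rw [Nat.cast_sub hr']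
    simp
  rw [hlhs, show r + r' - 1 = (r' - 1 + 1) + (r - 1) by omega, Finset.sum_range_add,
    Finset.sum_range_succ, hmid, add_zero, sub_eq_add_neg, ← Finset.sum_neg_distrib]
  congr 1
  rw [← Finset.sum_range_reflect]
  refine Finset.sum_congr rfl fun m hm => ?_
  rw [Finset.mem_range] at hm
  rw [show r' - 1 + 1 + (r - 1 - 1 - m) = r + r' - 2 - m by omega, hrefl m (by omega)]

/-- The commutator of two quadratic operators. -/
theorem quadOp_bracket {n r r' : ℕ} (hr : 1 ≤ r) (hr' : 1 ≤ r') {χ χ' : Polynomial ℂ}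
    (h : IsSymmetricAbout r χ) (h' : IsSymmetricAbout r' χ') :
    quadOp n r χ * quadOp n r' χ' - quadOp n r' χ' * quadOp n r χ =
      quadOp n (r + r') (bracketPoly r r' χ χ') := by
  have hder : ∀ v, shiftDer n r χ (shiftDer n r' χ' v) - shiftDer n r' χ' (shiftDer n r χ v) =
      shiftDer n (r + r') (bracketPoly r r' χ χ') v := by
    have : ⁅shiftDer n r χ, shiftDer n r' χ'⁆ =
        shiftDer n (r + r') (bracketPoly r r' χ χ') := by
      refine derivation_ext fun p => ?_
      rw [Derivation.commutator_apply, shiftDer_X, shiftDer_X, shiftDer_X, Derivation.map_smul,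
        Derivation.map_smul, shiftDer_X, shiftDer_X, eval_bracketPoly, smul_smul, smul_smul]
      simp only
      rw [show p.2 + r' + r = p.2 + (r + r') by ring, show p.2 + r + r' = p.2 + (r + r') by ring,
        ← sub_smul]
      congr 1
      push_cast
      rw [show -((p.2 : ℂ) + r') - 1 = -(p.2 : ℂ) - 1 - r' by ring,
        show -((p.2 : ℂ) + r) - 1 = -(p.2 : ℂ) - 1 - r by ring]
      ring
    exact fun v => congrArg (fun D => D v) this
  refine LinearMap.ext fun v => ?_
  rw [LinearMap.sub_apply, Module.End.mul_apply, Module.End.mul_apply, quadOp_apply, quadOp_apply,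
    quadOp_apply, quadOp_apply, quadOp_apply, quadForm_bracketPoly hr hr' h h', ← hder]
  simp only [map_add, Derivation.leibniz, smul_eq_mul]
  ring

theorem neg_one_pow_mul_eval_descPochhammer (b : ℕ) (x : ℂ) :
    (-1) ^ b * (descPochhammer ℂ b).eval x = (descPochhammer ℂ b).eval (b - 1 - x) := by
  induction b with
  | zero => simp
  | succ b ih =>
    have h1 : (descPochhammer ℂ (b + 1)).eval ((b + 1 : ℕ) - 1 - x) =
        (b - x) * (descPochhammer ℂ b).eval (b - 1 - x) := by
      rw [descPochhammer_succ_left, Polynomial.eval_mul, Polynomial.eval_X, Polynomial.eval_comp,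
        Polynomial.eval_sub, Polynomial.eval_X, Polynomial.eval_one]
      push_cast
      rw [show (b : ℂ) + 1 - 1 - x = b - x by ring, show (b : ℂ) - x - 1 = b - 1 - x by ring]
    rw [h1, ← ih, descPochhammer_succ_right, Polynomial.eval_mul, Polynomial.eval_sub,
      Polynomial.eval_X, Polynomial.eval_natCast]
    ring

/-- The coefficients of the modes of `j^b` of weight `r`. -/
def jPoly (b r : ℕ) : Polynomial ℂ :=
  (descPochhammer ℂ b).comp (Polynomial.X - Polynomial.C 1) +
    (descPochhammer ℂ b).comp (Polynomial.C ((r : ℂ) - 1) - Polynomial.X)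

theorem eval_jPoly (b r : ℕ) (x : ℂ) : (jPoly b r).eval x =
    (descPochhammer ℂ b).eval (x - 1) + (descPochhammer ℂ b).eval (r - 1 - x) := by
  simp [jPoly, Polynomial.eval_comp]

theorem isSymmetricAbout_jPoly (b r : ℕ) : IsSymmetricAbout r (jPoly b r) := by
  refine Polynomial.funext fun x => ?_
  rw [Polynomial.eval_comp, Polynomial.eval_sub, Polynomial.eval_C, Polynomial.eval_X, eval_jPoly,
    eval_jPoly, add_comm]
  congr 2 <;> ring

end QuadraticOperators

/-! ### The weight-raising modes of the quadratic invariant fields. -/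

section ModesOfInvariants

open MvPolynomial

theorem mode_iterate_deriv_alpha {n : ℕ} (i : Fin n) (b : ℕ) (m : ℤ) (v : Fock n) :
    mode (deriv^[b] (alpha n i)) m v =
      (descPochhammer ℂ b).eval ((b : ℂ) - 1 - m) • alphaMode n i (m - b) v := by
  rw [mode_iterate_deriv, neg_one_pow_mul_eval_descPochhammer, mode_alpha, LinearMap.smul_apply]

/-- The terms of a mode of weight `r` of `:α ∂ᵇα:`. -/
def wickTerm {n : ℕ} (i : Fin n) (b r t : ℕ) (v : Fock n) : Fock n :=
  (descPochhammer ℂ b).eval ((r : ℂ) - 2 - t) •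
      alphaMode n i (-t - 1) (alphaMode n i (t + 1 - r) v) +
    (descPochhammer ℂ b).eval ((r : ℂ) + t - 1) •
      alphaMode n i (-r - t) (alphaMode n i t v)

theorem mode_wick_alpha_apply {n : ℕ} (i : Fin n) (b r : ℕ) (v : Fock n) :
    ∃ K : ℕ, ∀ K' ≥ K, mode (wick (alpha n i) (deriv^[b] (alpha n i))) ((b : ℤ) + 1 - r) v =
      ∑ t ∈ Finset.range K', wickTerm i b r t v := by
  obtain ⟨K, hK⟩ := mode_wick_apply (alpha n i) (deriv^[b] (alpha n i)) ((b : ℤ) + 1 - r) v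
  refine ⟨K, fun K' hK' => (hK K' hK').trans (Finset.sum_congr rfl fun t _ => ?_)⟩
  rw [mode_iterate_deriv_alpha, mode_iterate_deriv_alpha, mode_alpha, mode_alpha, map_smul,
    wickTerm]
  push_cast
  rw [show (b : ℂ) - 1 - (b + 1 - r + t) = r - 2 - t by ring,
    show (b : ℂ) - 1 - (b + 1 - r - 1 - t) = r + t - 1 by ring,
    show (b : ℤ) + 1 - r + t - b = t + 1 - r by ring,
    show (b : ℤ) + 1 - r - 1 - t - b = -r - t by ring]

theorem wickTerm_X_mul {n : ℕ} (i : Fin n) (b : ℕ) {r : ℕ} (hr : 1 ≤ r) (t : ℕ) (p : Fin n × ℕ)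
    (v : Fock n) : wickTerm i b r t (X p * v) - X p * wickTerm i b r t v =
      (if t = p.2 + r then (if p.1 = i then (((p.2 : ℂ) + 1) *
        (descPochhammer ℂ b).eval (-(p.2 : ℂ) - 2)) • (X (p.1, p.2 + r) * v) else 0) else 0) +
      (if t = p.2 + 1 then (if p.1 = i then (((p.2 : ℂ) + 1) *
        (descPochhammer ℂ b).eval ((p.2 : ℂ) + r)) • (X (p.1, p.2 + r) * v) else 0) else 0) := by
  obtain ⟨k, d⟩ := p
  have hc : ∀ (l : ℤ) (u : Fock n), alphaMode n i l (X (k, d) * u) =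
      X (k, d) * alphaMode n i l u + (if i = k ∧ l = d + 1 then ((d : ℂ) + 1) • u else 0) := by
    intro l u
    have := alphaMode_comm i k l (-(d : ℤ) - 1) u
    rw [alphaMode_neg_succ, alphaMode_neg_succ] at this
    rw [sub_eq_iff_eq_add.mp this, add_comm]
    congr 1
    by_cases h : l = d + 1
    · subst h
      simp
    · rw [if_neg, if_neg]
      · tauto
      · rintro ⟨-, h'⟩
        omega
  have h1 : (descPochhammer ℂ b).eval ((r : ℂ) - 2 - t) • alphaMode n i (-t - 1)
      (if i = k ∧ (t : ℤ) + 1 - r = d + 1 then ((d : ℂ) + 1) • v else 0) =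
      if t = d + r then (if k = i then (((d : ℂ) + 1) *
        (descPochhammer ℂ b).eval (-(d : ℂ) - 2)) • (X (k, d + r) * v) else 0) else 0 := by
    by_cases ht : t = d + r
    · subst ht
      by_cases hk : k = i
      · subst hk
        rw [if_pos ⟨rfl, by push_cast; ring⟩, if_pos rfl, if_pos rfl, map_smul,
          alphaMode_neg_succ, smul_smul, mul_comm]
        push_cast
        rw [show (r : ℂ) - 2 - (d + r) = -d - 2 by ring]
      · rw [if_neg (by tauto), if_pos rfl, if_neg hk, map_zero, smul_zero]
    · rw [if_neg (by omega), if_neg ht, map_zero, smul_zero]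
  have h2 : (descPochhammer ℂ b).eval ((r : ℂ) + t - 1) • alphaMode n i (-r - t)
      (if i = k ∧ (t : ℤ) = d + 1 then ((d : ℂ) + 1) • v else 0) =
      if t = d + 1 then (if k = i then (((d : ℂ) + 1) *
        (descPochhammer ℂ b).eval ((d : ℂ) + r)) • (X (k, d + r) * v) else 0) else 0 := by
    by_cases ht : t = d + 1
    · subst ht
      by_cases hk : k = i
      · subst hk
        rw [if_pos ⟨rfl, by push_cast; ring⟩, if_pos rfl, if_pos rfl, map_smul,
          show -(r : ℤ) - (d + 1 : ℕ) = -((d + r : ℕ) : ℤ) - 1 by push_cast; ring,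
          alphaMode_neg_succ, smul_smul, mul_comm]
        push_cast
        rw [show (r : ℂ) + (d + 1) - 1 = d + r by ring]
      · rw [if_neg (by tauto), if_pos rfl, if_neg hk, map_zero, smul_zero]
    · rw [if_neg (by omega), if_neg ht, map_zero, smul_zero]
  rw [← h1, ← h2, wickTerm, wickTerm, hc, map_add, hc, hc, map_add, hc,
    if_neg (c := i = k ∧ (-(t : ℤ) - 1) = d + 1) (by omega),
    if_neg (c := i = k ∧ (-(r : ℤ) - t) = d + 1) (by omega)]
  simp only [smul_add, mul_add, mul_smul_comm, add_zero]
  abel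

theorem mode_wick_alpha_X_mul {n : ℕ} (i : Fin n) (b : ℕ) {r : ℕ} (hr : 1 ≤ r) (p : Fin n × ℕ)
    (v : Fock n) :
    mode (wick (alpha n i) (deriv^[b] (alpha n i))) ((b : ℤ) + 1 - r) (X p * v) -
      X p * mode (wick (alpha n i) (deriv^[b] (alpha n i))) ((b : ℤ) + 1 - r) v =
      if p.1 = i then (((p.2 : ℂ) + 1) * (jPoly b r).eval (-(p.2 : ℂ) - 1)) •
        (X (p.1, p.2 + r) * v) else 0 := by
  obtain ⟨K, hK⟩ := mode_wick_alpha_apply i b r (X p * v)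
  obtain ⟨K', hK'⟩ := mode_wick_alpha_apply i b r v
  set M := K + K' + p.2 + r + 2
  rw [hK M (by omega), hK' M (by omega), Finset.mul_sum, ← Finset.sum_sub_distrib,
    Finset.sum_congr rfl fun t _ => wickTerm_X_mul i b hr t p v, Finset.sum_add_distrib,
    Finset.sum_ite_eq', Finset.sum_ite_eq', if_pos (Finset.mem_range.mpr (by omega)),
    if_pos (Finset.mem_range.mpr (by omega))]
  split_ifs
  · rw [← add_smul, eval_jPoly, mul_add, show -(p.2 : ℂ) - 1 - 1 = -p.2 - 2 by ring,
      show (r : ℂ) - 1 - (-p.2 - 1) = p.2 + r by ring]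
  · rw [add_zero]

theorem mode_wick_alpha_one {n : ℕ} (i : Fin n) (b r : ℕ) :
    mode (wick (alpha n i) (deriv^[b] (alpha n i))) ((b : ℤ) + 1 - r) (1 : Fock n) =
      ∑ t ∈ Finset.range (r - 1), (descPochhammer ℂ b).eval ((r : ℂ) - 2 - t) •
        (X (i, t) * X (i, r - 2 - t)) := by
  obtain ⟨K, hK⟩ := mode_wick_alpha_apply i b r (1 : Fock n)
  have h0 : ∀ l : ℤ, 0 ≤ l → alphaMode n i l (1 : Fock n) = 0 := fun l hl => by
    rw [alphaMode_of_nonneg i hl, Derivation.map_one_eq_zero, smul_zero]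
  rw [hK (r - 1 + K) (by omega), Finset.sum_range_add, Finset.sum_eq_zero (s := Finset.range K),
    add_zero]
  · refine Finset.sum_congr rfl fun t ht => ?_
    rw [Finset.mem_range] at ht
    rw [wickTerm, h0 t (by omega), map_zero, smul_zero, add_zero,
      show (t : ℤ) + 1 - r = -((r - 2 - t : ℕ) : ℤ) - 1 by omega, alphaMode_neg_succ,
      alphaMode_neg_succ, mul_one]
  · intro t _
    rw [wickTerm, h0 _ (by omega), h0 _ (by omega)]
    simp

/-- The modes of `j^b` are quadratic operators. -/
theorem mode_j (n b : ℕ) {r : ℕ} (hr : 1 ≤ r) :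
    mode (j n b) ((b : ℤ) + 1 - r) = quadOp n r (jPoly b r) := by
  rw [j, omega, mode_sum]
  -- Compare values at 1 and commutators with the variables. As r ≥ 1, no term consists of two
  -- annihilation operators, so these commutators are multiplications by variables. The index b + 1
  -- - r appears because j^b has weight b + 2.
  refine end_ext ?_ fun p v => ?_
  · rw [LinearMap.sum_apply, quadOp_one]
    simp only [Function.iterate_zero, id_eq, mode_wick_alpha_one]
    rw [Finset.sum_comm]
    simp only [← Finset.smul_sum]
    change ∑ t ∈ Finset.range (r - 1), (descPochhammer ℂ b).eval ((r : ℂ) - 2 - t) •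
      quad n t (r - 2 - t) = _
    set f : ℕ → Fock n := fun t => (descPochhammer ℂ b).eval ((r : ℂ) - 2 - t) •
      quad n t (r - 2 - t) with hf
    -- Symmetry of the scalar products allows averaging the coefficient with its reflection, which
    -- produces the two summands of `jPoly` and the factor 1/2.
    have h1 : ∑ t ∈ Finset.range (r - 1), f t = ∑ t ∈ Finset.range (r - 1),
        (descPochhammer ℂ b).eval (t : ℂ) • quad n t (r - 2 - t) := by
      rw [← Finset.sum_range_reflect]
      refine Finset.sum_congr rfl fun t ht => ?_
      rw [Finset.mem_range] at ht
      simp only [hf]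
      rw [show r - 1 - 1 - t = r - (t + 2) by omega, Nat.cast_sub (by omega),
        show r - 2 - (r - (t + 2)) = t by omega, quad_comm, Nat.sub_add_eq, Nat.sub_right_comm]
      push_cast
      rw [show (r : ℂ) - 2 - (r - (t + 2)) = t by ring]
    have h2 : ∑ t ∈ Finset.range (r - 1), f t = (1 / 2 : ℂ) • (∑ t ∈ Finset.range (r - 1), f t +
        ∑ t ∈ Finset.range (r - 1), f t) := by module
    rw [h2]
    nth_rewrite 1 [h1]
    rw [← Finset.sum_add_distrib, Finset.smul_sum, quadForm]
    refine Finset.sum_congr rfl fun t _ => ?_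
    simp only [hf]
    rw [← add_smul, smul_smul, eval_jPoly, show (t : ℂ) + 1 - 1 = t by ring,
      show (r : ℂ) - 1 - (t + 1) = r - 2 - t by ring]
    congr 1
    ring
  · rw [LinearMap.sum_apply, LinearMap.sum_apply, Finset.mul_sum, ← Finset.sum_sub_distrib,
      quadOp_X_mul]
    simp only [Function.iterate_zero, id_eq, mode_wick_alpha_X_mul _ _ hr]
    simp

end ModesOfInvariants

/-! ### Symmetric polynomials are spanned by those of the fields j^{2l}. -/

section SymmetricPolynomials

open Polynomial

theorem natDegree_X_sub_comp (p : ℂ[X]) (c : ℂ) : (p.comp (X - C c)).natDegree = p.natDegree := by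
  rw [natDegree_comp, natDegree_X_sub_C, mul_one]

theorem natDegree_C_sub_X (c : ℂ) : (C c - X : ℂ[X]).natDegree = 1 := by
  rw [← neg_sub, natDegree_neg, natDegree_X_sub_C]

theorem leadingCoeff_comp_C_sub_X (p : ℂ[X]) (c : ℂ) :
    (p.comp (C c - X)).leadingCoeff = p.leadingCoeff * (-1) ^ p.natDegree := by
  rw [leadingCoeff_comp (by rw [natDegree_C_sub_X]; exact one_ne_zero), ← neg_sub X (C c),
    leadingCoeff_neg, leadingCoeff_X_sub_C]

theorem natDegree_jPoly_le (b r : ℕ) : (jPoly b r).natDegree ≤ b := by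
  refine (natDegree_add_le _ _).trans (max_le ?_ ?_)
  · rw [natDegree_X_sub_comp, descPochhammer_natDegree]
  · rw [natDegree_comp, natDegree_C_sub_X, descPochhammer_natDegree, mul_one]

theorem coeff_jPoly (l r : ℕ) : (jPoly (2 * l) r).coeff (2 * l) = 2 := by
  rw [jPoly, coeff_add]
  have h1 : ((descPochhammer ℂ (2 * l)).comp (X - C 1)).coeff (2 * l) = 1 := by
    have := (monic_descPochhammer ℂ (2 * l)).comp (monic_X_sub_C 1)
      (by rw [natDegree_X_sub_C]; exact one_ne_zero)
    have h := this.coeff_natDegree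
    rwa [natDegree_X_sub_comp, descPochhammer_natDegree] at h
  have h2 : ((descPochhammer ℂ (2 * l)).comp (C ((r : ℂ) - 1) - X)).coeff (2 * l) = 1 := by
    have h := leadingCoeff_comp_C_sub_X (descPochhammer ℂ (2 * l)) ((r : ℂ) - 1)
    rw [leadingCoeff, natDegree_comp, natDegree_C_sub_X, descPochhammer_natDegree, mul_one,
      (monic_descPochhammer ℂ (2 * l)).leadingCoeff, one_mul, pow_mul] at h
    simpa using h
  rw [h1, h2]
  norm_num

/-- A reflection multiplies the leading coefficient by (-1)^deg, so a symmetric polynomial cannot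
have odd degree. -/
theorem IsSymmetricAbout.coeff_eq_zero {r l : ℕ} {χ : ℂ[X]} (h : IsSymmetricAbout r χ)
    (hd : χ.degree < ((2 * (l + 1) : ℕ) : WithBot ℕ)) : χ.coeff (2 * l + 1) = 0 := by
  by_contra hne
  have hle : χ.natDegree ≤ 2 * l + 1 := by
    have h0 : χ ≠ 0 := fun h0 => hne (by rw [h0, coeff_zero])
    have := (natDegree_lt_iff_degree_lt h0).mpr hd
    omega
  have hdeg : χ.natDegree = 2 * l + 1 := le_antisymm hle (le_natDegree_of_ne_zero hne)
  have h2 := leadingCoeff_comp_C_sub_X χ r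
  rw [show χ.comp (C (r : ℂ) - X) = χ from h, hdeg, pow_succ, pow_mul] at h2
  have h3 : χ.leadingCoeff = 0 := by
    have : χ.leadingCoeff = -χ.leadingCoeff := by simpa using h2
    exact self_eq_neg.mp this
  rw [leadingCoeff, hdeg] at h3
  exact hne h3

theorem IsSymmetricAbout.sub {r : ℕ} {χ χ' : ℂ[X]} (h : IsSymmetricAbout r χ)
    (h' : IsSymmetricAbout r χ') : IsSymmetricAbout r (χ - χ') := by
  rw [IsSymmetricAbout, sub_comp, show χ.comp _ = χ from h, show χ'.comp _ = χ' from h']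

theorem IsSymmetricAbout.smul {r : ℕ} {χ : ℂ[X]} (h : IsSymmetricAbout r χ) (c : ℂ) :
    IsSymmetricAbout r (c • χ) := by
  rw [IsSymmetricAbout, smul_comp, show χ.comp _ = χ from h]

/-- Elimination of leading terms: degrees are even, and `jPoly (2 * l) r` has leading coefficient 2
in degree 2l. -/
theorem IsSymmetricAbout.mem_span {r : ℕ} (l : ℕ) : ∀ {χ : ℂ[X]}, IsSymmetricAbout r χ →
    χ.degree < ((2 * l : ℕ) : WithBot ℕ) →
    χ ∈ Submodule.span ℂ {q | ∃ l' < l, q = jPoly (2 * l') r} := by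
  induction l with
  | zero =>
    intro χ _ hd
    have : χ = 0 := degree_eq_bot.mp (by
      rw [Nat.mul_zero, Nat.cast_zero] at hd
      exact Nat.WithBot.lt_zero_iff.mp hd)
    rw [this]
    exact zero_mem _
  | succ l ih =>
    intro χ h hd
    have hsymm := isSymmetricAbout_jPoly (2 * l) r
    set c := χ.coeff (2 * l) / 2
    have key : χ - c • jPoly (2 * l) r ∈
        Submodule.span ℂ {q | ∃ l' < l, q = jPoly (2 * l') r} := by
      refine ih (h.sub (hsymm.smul c)) ((degree_lt_iff_coeff_zero _ _).mpr fun m hm => ?_)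
      rw [coeff_sub, coeff_smul, smul_eq_mul]
      rcases hm.eq_or_lt with rfl | hm
      · rw [coeff_jPoly]
        simp [c]
      · rw [coeff_eq_zero_of_natDegree_lt ((natDegree_jPoly_le _ _).trans_lt hm), mul_zero,
          sub_zero]
        rcases (show 2 * l + 1 ≤ m from hm).eq_or_lt with rfl | hm
        · exact h.coeff_eq_zero hd
        · exact (degree_lt_iff_coeff_zero _ _).mp hd m (by omega)
    have h2 := Submodule.span_mono (R := ℂ)
      (t := {q : ℂ[X] | ∃ l' < l + 1, q = jPoly (2 * l') r})
      (by rintro _ ⟨l', hl', rfl⟩; exact ⟨l', by omega, rfl⟩) key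
    rw [← sub_add_cancel χ (c • jPoly (2 * l) r)]
    exact add_mem h2 (Submodule.smul_mem _ _ (Submodule.subset_span ⟨l, by omega, rfl⟩))

theorem natDegree_bracketPoly_le (r r' : ℕ) (χ χ' : ℂ[X]) :
    (bracketPoly r r' χ χ').natDegree ≤ χ.natDegree + χ'.natDegree + 1 := by
  refine (natDegree_sub_le _ _).trans (max_le ?_ ?_)
  · refine natDegree_mul_le.trans ((add_le_add_left natDegree_mul_le _).trans ?_)
    rw [natDegree_X_sub_comp, natDegree_C_sub_X]
    omega
  · refine natDegree_mul_le.trans ((add_le_add_left natDegree_mul_le _).trans ?_)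
    rw [natDegree_X_sub_comp, natDegree_C_sub_X]
    omega

end SymmetricPolynomials

/-! ### Creation modes of j^{2l}, their commutators, and the raising operator j²(1). -/

section Generators

open MvPolynomial

variable {n : ℕ}

/-- The weight `2 l + 2 + k` of `∂ᵏj^{2l}`. -/
def genWeight (i : ℕ × ℕ) : ℕ := 2 * i.1 + 2 + i.2

/-- The creation operators which are modes of the fields `j^{2l}`. -/
def gen (n : ℕ) (i : ℕ × ℕ) : Module.End ℂ (Fock n) := mode (j n (2 * i.1)) (-(i.2 : ℤ) - 1)

theorem gen_eq_quadOp (i : ℕ × ℕ) :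
    gen n i = quadOp n (genWeight i) (jPoly (2 * i.1) (genWeight i)) := by
  rw [gen, ← mode_j n (2 * i.1) (by rw [genWeight]; omega)]
  congr 1
  rw [genWeight]
  push_cast
  ring

/-- The bound 2l ≤ r guarantees that the modes of weight r of the lower fields are creation modes:
the number r - (2l' + 2) of derivatives is a true difference. -/
theorem quadOp_mem_span_gen {r l : ℕ} (hl : 2 * l ≤ r) {χ : Polynomial ℂ}
    (h : IsSymmetricAbout r χ) (hd : χ.degree < ((2 * l : ℕ) : WithBot ℕ)) :
    quadOp n r χ ∈ Submodule.span ℂ {A | ∃ i : ℕ × ℕ, genWeight i = r ∧ i.1 < l ∧ A = gen n i} := by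
  have := Submodule.mem_map_of_mem (f := quadOp n r) (h.mem_span l hd)
  rw [Submodule.map_span] at this
  refine Submodule.span_mono ?_ this
  rintro _ ⟨_, ⟨l', hl', rfl⟩, rfl⟩
  have hw : genWeight (l', r - (2 * l' + 2)) = r := by
    rw [genWeight]
    omega
  exact ⟨(l', r - (2 * l' + 2)), hw, hl', by rw [gen_eq_quadOp, hw]⟩

theorem degree_lt_of_natDegree_lt {χ : Polynomial ℂ} {m : ℕ} (h : χ.natDegree < m) :
    χ.degree < (m : WithBot ℕ) :=
  Polynomial.degree_le_natDegree.trans_lt (by exact_mod_cast h)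

/-- The bracket polynomial has degree at most 2i.1 + 2i'.1 + 1, so only fields of index at most i.1
+ i'.1 occur. Their weights are smaller than the total weight, which forces a derivative; this keeps
the bare letters j^{2m}(-1) out of all reorderings. -/
theorem gen_bracket (i i' : ℕ × ℕ) : gen n i * gen n i' - gen n i' * gen n i ∈
    Submodule.span ℂ {A | ∃ t : ℕ × ℕ, genWeight t = genWeight i + genWeight i' ∧ 1 ≤ t.2 ∧
      A = gen n t} := by
  rw [gen_eq_quadOp, gen_eq_quadOp, quadOp_bracket (by rw [genWeight]; omega)
    (by rw [genWeight]; omega) (isSymmetricAbout_jPoly _ _) (isSymmetricAbout_jPoly _ _)]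
  refine Submodule.span_mono ?_ (quadOp_mem_span_gen (l := i.1 + i'.1 + 1) ?_
    ((isSymmetricAbout_jPoly _ _).bracketPoly (isSymmetricAbout_jPoly _ _))
    (degree_lt_of_natDegree_lt ?_))
  · rintro _ ⟨t, ht, hl, rfl⟩
    exact ⟨t, ht, by simp only [genWeight] at ht; omega, rfl⟩
  · simp only [genWeight]
    omega
  · have h1 := natDegree_bracketPoly_le (genWeight i) (genWeight i')
      (jPoly (2 * i.1) (genWeight i)) (jPoly (2 * i'.1) (genWeight i'))
    have h2 := natDegree_jPoly_le (2 * i.1) (genWeight i)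
    have h3 := natDegree_jPoly_le (2 * i'.1) (genWeight i')
    omega

/-- The mode of `j²` which raises the weight by two. -/
def raise (n : ℕ) : Module.End ℂ (Fock n) := mode (j n 2) 1

theorem raise_eq_quadOp : raise n = quadOp n 2 (jPoly 2 2) := by
  rw [raise, ← mode_j n 2 (by norm_num)]
  congr 1

/-- The bracket polynomial has degree at most 2i.1 + 3, so the index grows by at most one. Hence
from indices below L one reaches at most j^{2L}, the field with a known relation. -/
theorem raise_gen (i : ℕ × ℕ) : raise n * gen n i - gen n i * raise n ∈
    Submodule.span ℂ {A | ∃ t : ℕ × ℕ, genWeight t = genWeight i + 2 ∧ t.1 ≤ i.1 + 1 ∧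
      A = gen n t} := by
  rw [raise_eq_quadOp, gen_eq_quadOp, quadOp_bracket (by norm_num)
    (by rw [genWeight]; omega) (isSymmetricAbout_jPoly _ _) (isSymmetricAbout_jPoly _ _)]
  refine Submodule.span_mono ?_ (quadOp_mem_span_gen (l := i.1 + 2) ?_
    ((isSymmetricAbout_jPoly _ _).bracketPoly (isSymmetricAbout_jPoly _ _))
    (degree_lt_of_natDegree_lt ?_))
  · rintro _ ⟨t, ht, hl, rfl⟩
    exact ⟨t, by omega, by omega, rfl⟩
  · simp only [genWeight]
    omega
  · have h1 := natDegree_bracketPoly_le 2 (genWeight i)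
      (jPoly 2 2) (jPoly (2 * i.1) (genWeight i))
    have h2 := natDegree_jPoly_le (2 * i.1) (genWeight i)
    have h3 := natDegree_jPoly_le 2 2
    omega

theorem eval_jPoly_two (x : ℂ) : (jPoly 2 2).eval x = 2 * (x - 1) ^ 2 := by
  rw [eval_jPoly, descPochhammer_succ_right]
  simp
  ring

theorem raise_one : raise n (1 : Fock n) = 0 := by
  rw [raise_eq_quadOp, quadOp_one, quadForm]
  simp [eval_jPoly_two]

theorem raise_quad (a b : ℕ) : raise n (quad n a b) =
    (2 * ((a : ℂ) + 1) * (a + 2) ^ 2) • quad n (a + 2) b +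
      (2 * ((b : ℂ) + 1) * (b + 2) ^ 2) • quad n a (b + 2) := by
  rw [raise_eq_quadOp, quadOp_apply, shiftDer_quad, eval_jPoly_two, eval_jPoly_two]
  have : quadForm n 2 (jPoly 2 2) = 0 := by rw [← quadOp_one, ← raise_eq_quadOp, raise_one]
  rw [this, zero_mul, zero_add]
  congr 2 <;> ring

theorem translation_quad (a b : ℕ) : translation n (quad n a b) =
    ((a : ℂ) + 1) • quad n (a + 1) b + ((b : ℂ) + 1) • quad n a (b + 1) := by
  rw [quad, map_sum, quad, quad, Finset.smul_sum, Finset.smul_sum, ← Finset.sum_add_distrib]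
  refine Finset.sum_congr rfl fun i _ => ?_
  rw [Derivation.leibniz, translation_X, translation_X]
  simp only [smul_eq_mul, smul_eq_C_mul]
  ring

theorem j_mem_heisenbergVA (b : ℕ) : j n b ∈ heisenbergVA n := by
  rw [j, omega]
  exact Submodule.sum_mem _ fun i _ => wick_mem (alpha_mem_heisenbergVA i)
    (iterate_deriv_mem (alpha_mem_heisenbergVA i) b)

theorem translation_gen (i : ℕ × ℕ) (v : Fock n) : translation n (gen n i v) =
    gen n i (translation n v) + ((i.2 : ℂ) + 1) • gen n (i.1, i.2 + 1) v := by
  have := isCovariant_of_mem (j_mem_heisenbergVA (2 * i.1)) (-(i.2 : ℤ) - 1) v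
  rw [gen, gen]
  refine this.trans ?_
  push_cast
  rw [show -(i.2 : ℤ) - 1 - 1 = -(i.2 + 1) - 1 by ring, sub_eq_add_neg, ← neg_smul]
  congr 2
  ring

theorem gen_one (i : ℕ × ℕ) :
    gen n i (1 : Fock n) = quadForm n (genWeight i) (jPoly (2 * i.1) (genWeight i)) := by
  rw [gen_eq_quadOp, quadOp_one]

/-- A symmetric polynomial with prescribed symmetric values at `1, …, r - 1`. -/
theorem exists_isSymmetricAbout {r : ℕ} (f : ℕ → ℂ)
    (hf : ∀ m < r - 1, f (r - 2 - m) = f m) :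
    ∃ χ : Polynomial ℂ, IsSymmetricAbout r χ ∧ χ.degree < ((r - 1 : ℕ) : WithBot ℕ) ∧
      ∀ m < r - 1, χ.eval ((m : ℂ) + 1) = f m := by
  set v : ℕ → ℂ := fun m => (m : ℂ) + 1
  have hv : Set.InjOn v (Finset.range (r - 1)) := fun a _ b _ hab => by
    exact_mod_cast add_right_cancel hab
  set χ₀ := Lagrange.interpolate (Finset.range (r - 1)) v f
  have hd : χ₀.degree < ((r - 1 : ℕ) : WithBot ℕ) := by
    have := Lagrange.degree_interpolate_lt f hv
    rwa [Finset.card_range] at this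
  have he : ∀ m < r - 1, χ₀.eval ((m : ℂ) + 1) = f m := fun m hm =>
    Lagrange.eval_interpolate_at_node f hv (Finset.mem_range.mpr hm)
  refine ⟨χ₀, ?_, hd, he⟩
  refine Polynomial.eq_of_degrees_lt_of_eval_index_eq (Finset.range (r - 1)) hv ?_ ?_ ?_
  · rw [Finset.card_range]
    by_cases h0 : χ₀ = 0
    · rw [h0, Polynomial.zero_comp]
      rwa [h0] at hd
    · refine degree_lt_of_natDegree_lt ?_
      rw [Polynomial.natDegree_comp, natDegree_C_sub_X, mul_one]
      exact (Polynomial.natDegree_lt_iff_degree_lt h0).mpr hd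
  · rwa [Finset.card_range]
  · intro m hm
    rw [Finset.mem_range] at hm
    have h1 := he (r - 2 - m) (by omega)
    rw [Nat.cast_sub (by omega), Nat.cast_sub (by omega), hf m hm, ← he m hm] at h1
    rw [Polynomial.eval_comp, ← h1]
    congr 1
    simp [v]
    ring

/-- Lagrange interpolation at 1, …, r - 1 with r = a + b + 2 gives a symmetric polynomial whose
quadratic form is the single scalar product. Its degree is below r - 1, so it is spanned by
polynomials of creation modes. -/
theorem quad_mem_span_gen (a b : ℕ) : quad n a b ∈
    Submodule.span ℂ {v | ∃ i : ℕ × ℕ, genWeight i = a + b + 2 ∧ v = gen n i (1 : Fock n)} := by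
  obtain ⟨χ, hs, hd, he⟩ := exists_isSymmetricAbout (r := a + b + 2)
    (fun m => (if m = a then 1 else 0) + if m = b then 1 else 0) (fun m hm => by
      rw [add_comm]
      congr 1 <;> refine if_congr (by omega) rfl rfl)
  have h1 : quadForm n (a + b + 2) χ = quad n a b := by
    rw [quadForm, Finset.sum_congr rfl fun m hm => by
      rw [he m (Finset.mem_range.mp hm), add_div, add_smul], Finset.sum_add_distrib]
    simp only [ite_div, zero_div, ite_smul, zero_smul]
    rw [Finset.sum_ite_eq', Finset.sum_ite_eq', if_pos (Finset.mem_range.mpr (by omega)),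
      if_pos (Finset.mem_range.mpr (by omega)), show a + b + 2 - 2 - a = b by omega,
      show a + b + 2 - 2 - b = a by omega, quad_comm n b a, ← add_smul, add_halves, one_smul]
  have h2 := quadOp_mem_span_gen (n := n) (r := a + b + 2) (l := (a + b + 2) / 2) (by omega) hs
    (hd.trans_le (by exact_mod_cast (by omega)))
  have h3 := Submodule.mem_map_of_mem (f := LinearMap.applyₗ (R := ℂ) (1 : Fock n)) h2
  rw [Submodule.map_span, LinearMap.applyₗ_apply_apply, quadOp_one, h1] at h3
  refine Submodule.span_mono ?_ h3
  rintro _ ⟨_, ⟨i, hi, -, rfl⟩, rfl⟩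
  exact ⟨i, hi, rfl⟩

end Generators

/-! ### Bilinearity of circle products and their compatibility with intertwiners. -/

section Intertwiners

variable {V : Type*} [AddCommGroup V] [Module ℂ V]

theorem circle_add_left (n : ℤ) (a a' b : VertexOperator ℂ V) :
    circle n (a + a') b = circle n a b + circle n a' b := by
  refine ext_mode fun m => LinearMap.ext fun v => ?_
  obtain ⟨K, hK⟩ := exists_mode_circle_apply n (a + a') b m v
  obtain ⟨K', hK'⟩ := exists_mode_circle_apply n a b m v
  obtain ⟨K'', hK''⟩ := exists_mode_circle_apply n a' b m v
  rw [mode_add, LinearMap.add_apply, hK (K + K' + K'') (by omega), hK' (K + K' + K'') (by omega),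
    hK'' (K + K' + K'') (by omega), ← Finset.sum_add_distrib]
  refine Finset.sum_congr rfl fun t _ => ?_
  simp only [mode_add, LinearMap.add_apply, map_add]
  module

theorem circle_add_right (n : ℤ) (a b b' : VertexOperator ℂ V) :
    circle n a (b + b') = circle n a b + circle n a b' := by
  refine ext_mode fun m => LinearMap.ext fun v => ?_
  obtain ⟨K, hK⟩ := exists_mode_circle_apply n a (b + b') m v
  obtain ⟨K', hK'⟩ := exists_mode_circle_apply n a b m v
  obtain ⟨K'', hK''⟩ := exists_mode_circle_apply n a b' m v
  rw [mode_add, LinearMap.add_apply, hK (K + K' + K'') (by omega), hK' (K + K' + K'') (by omega),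
    hK'' (K + K' + K'') (by omega), ← Finset.sum_add_distrib]
  refine Finset.sum_congr rfl fun t _ => ?_
  simp only [mode_add, LinearMap.add_apply, map_add]
  module

theorem circle_smul_left (n : ℤ) (c : ℂ) (a b : VertexOperator ℂ V) :
    circle n (c • a) b = c • circle n a b := by
  refine ext_mode fun m => LinearMap.ext fun v => ?_
  obtain ⟨K, hK⟩ := exists_mode_circle_apply n (c • a) b m v
  obtain ⟨K', hK'⟩ := exists_mode_circle_apply n a b m v
  rw [mode_smul, LinearMap.smul_apply, hK (K + K') (by omega), hK' (K + K') (by omega),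
    Finset.smul_sum]
  refine Finset.sum_congr rfl fun t _ => ?_
  simp only [mode_smul, LinearMap.smul_apply, map_smul]
  module

theorem circle_smul_right (n : ℤ) (c : ℂ) (a b : VertexOperator ℂ V) :
    circle n a (c • b) = c • circle n a b := by
  refine ext_mode fun m => LinearMap.ext fun v => ?_
  obtain ⟨K, hK⟩ := exists_mode_circle_apply n a (c • b) m v
  obtain ⟨K', hK'⟩ := exists_mode_circle_apply n a b m v
  rw [mode_smul, LinearMap.smul_apply, hK (K + K') (by omega), hK' (K + K') (by omega),
    Finset.smul_sum]
  refine Finset.sum_congr rfl fun t _ => ?_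
  simp only [mode_smul, LinearMap.smul_apply, map_smul]
  module

/-- The Wick product as a bilinear map. -/
def wickHom (V : Type*) [AddCommGroup V] [Module ℂ V] :
    VertexOperator ℂ V →ₗ[ℂ] VertexOperator ℂ V →ₗ[ℂ] VertexOperator ℂ V :=
  LinearMap.mk₂ ℂ wick (circle_add_left _) (circle_smul_left _) (circle_add_right _)
    (circle_smul_right _)

theorem wickHom_apply (a b : VertexOperator ℂ V) : wickHom V a b = wick a b := rfl

/-- The endomorphism `L` intertwines the modes of `a` and `a'`. -/
def Intertwines (L : V →ₗ[ℂ] V) (a a' : VertexOperator ℂ V) : Prop :=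
  ∀ m v, L (mode a m v) = mode a' m (L v)

theorem Intertwines.circle {L : V →ₗ[ℂ] V} {a a' b b' : VertexOperator ℂ V}
    (ha : Intertwines L a a') (hb : Intertwines L b b') (n : ℤ) :
    Intertwines L (circle n a b) (Heisenberg.circle n a' b') := by
  intro m v
  obtain ⟨K1, h1⟩ := exists_mode_circle_apply n a b m v
  obtain ⟨K2, h2⟩ := exists_mode_circle_apply n a' b' m (L v)
  rw [h1 (K1 + K2) (by omega), h2 (K1 + K2) (by omega), map_sum]
  refine Finset.sum_congr rfl fun t _ => ?_
  rw [map_smul, map_sub, map_smul, ha, hb, hb, ha]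

theorem Intertwines.sum {L : V →ₗ[ℂ] V} {ι : Type*} {s : Finset ι}
    {a a' : ι → VertexOperator ℂ V} (h : ∀ i ∈ s, Intertwines L (a i) (a' i)) :
    Intertwines L (∑ i ∈ s, a i) (∑ i ∈ s, a' i) := by
  intro m v
  rw [mode_sum, mode_sum, LinearMap.sum_apply, LinearMap.sum_apply, map_sum]
  exact Finset.sum_congr rfl fun i hi => h i hi m v

end Intertwiners

/-! ### Invariance of the fields j^b under the orthogonal group. -/

section InvariantFields

open MvPolynomial

variable {n : ℕ}

/-- For creation modes this is the definition of the action. For annihilation modes it is the chain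
rule, where orthogonality of the columns of g enters. -/
theorem Intertwines.alpha {g : Matrix (Fin n) (Fin n) ℂ} (hg : g.transpose * g = 1) (i : Fin n) :
    Intertwines (fockAction n g).toLinearMap (alpha n i) (∑ l, g l i • Heisenberg.alpha n l) := by
  intro m v
  have hs : ∀ v, mode (∑ l, g l i • Heisenberg.alpha n l) m v =
      ∑ l, g l i • alphaMode n l m v := fun v => by
    rw [mode_sum, LinearMap.sum_apply]
    exact Finset.sum_congr rfl fun l _ => by rw [mode_smul, mode_alpha, LinearMap.smul_apply]
  rw [hs, mode_alpha]
  change fockAction n g _ = ∑ l, g l i • alphaMode n l m (fockAction n g v)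
  rcases lt_or_ge m 0 with hm | hm
  · simp only [alphaMode_of_neg _ hm, map_mul, fockAction_X, Finset.sum_mul, smul_eq_C_mul,
      mul_assoc]
  · simp only [alphaMode_of_nonneg _ hm, map_smul]
    simp only [smul_comm _ (m : ℂ), ← Finset.smul_sum]
    congr 1
    generalize (m - 1).toNat = d
    induction v using MvPolynomial.induction_on with
    | C c => simp [fockAction]
    | add p q hp hq => simp only [map_add, smul_add, Finset.sum_add_distrib, hp, hq]
    | mul_X v p hv =>
      have hp : ∀ l, pderiv (l, d) (fockAction n g (X p)) =
          if p.2 = d then C (g l p.1) else 0 := by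
        intro l
        rw [fockAction_X, map_sum]
        simp only [Derivation.leibniz, pderiv_C, add_zero, smul_eq_mul, pderiv_X,
          Pi.single_apply, Prod.mk.injEq, mul_ite, mul_one, mul_zero]
        by_cases h : p.2 = d <;> simp [h]
      have h1 : ∑ l, g l i * g l p.1 = if i = p.1 then 1 else 0 := by
        have := congrFun (congrFun hg i) p.1
        rw [Matrix.mul_apply, Matrix.one_apply] at this
        exact this
      rw [Derivation.leibniz, map_add, smul_eq_mul, smul_eq_mul, map_mul, map_mul, hv, map_mul]
      simp only [Derivation.leibniz, hp, smul_add, Finset.sum_add_distrib, smul_eq_mul,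
        Finset.mul_sum, mul_smul_comm]
      rw [add_comm (∑ l, _) (∑ l, _), add_comm (_ * _) (∑ l, _)]
      congr 1
      rw [pderiv_X, Pi.single_apply]
      by_cases h : p.2 = d
      · simp only [h, if_true, smul_eq_C_mul]
        rw [show ∑ l, C (g l i) * (fockAction n g v * C (g l p.1)) =
          fockAction n g v * C (∑ l, g l i * g l p.1) by
            rw [map_sum, Finset.mul_sum]
            refine Finset.sum_congr rfl fun l _ => ?_
            rw [C_mul]
            ring, h1]
        by_cases h' : i = p.1
        · rw [if_pos (by rw [Prod.ext_iff]; exact ⟨h'.symm, h⟩), if_pos h']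
          simp
        · rw [if_neg (by rw [Prod.ext_iff]; exact fun h2 => h' h2.1.symm), if_neg h']
          simp
      · rw [if_neg (by rw [Prod.ext_iff]; exact fun h2 => h h2.2)]
        simp [h]

theorem Intertwines.iterate_deriv_alpha {g : Matrix (Fin n) (Fin n) ℂ}
    (hg : g.transpose * g = 1) (i : Fin n) (b : ℕ) :
    Intertwines (fockAction n g).toLinearMap (deriv^[b] (Heisenberg.alpha n i))
      (∑ l, g l i • deriv^[b] (Heisenberg.alpha n l)) := by
  intro m v
  have h := Intertwines.alpha hg i (m - b) v
  rw [mode_sum, LinearMap.sum_apply] at h ⊢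
  rw [mode_iterate_deriv, LinearMap.smul_apply, map_smul, h, Finset.smul_sum]
  refine Finset.sum_congr rfl fun l _ => ?_
  rw [mode_smul, mode_smul, mode_iterate_deriv, LinearMap.smul_apply, LinearMap.smul_apply,
    LinearMap.smul_apply, smul_comm]

theorem Intertwines.j {g : Matrix (Fin n) (Fin n) ℂ} (hg : g.transpose * g = 1) (b : ℕ) :
    Intertwines (fockAction n g).toLinearMap (j n b) (Heisenberg.j n b) := by
  have h1 : Intertwines (fockAction n g).toLinearMap (Heisenberg.j n b)
      (∑ i, wick (∑ l, g l i • Heisenberg.alpha n l)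
        (∑ l, g l i • deriv^[b] (Heisenberg.alpha n l))) := by
    rw [Heisenberg.j, omega]
    exact Intertwines.sum fun i _ =>
      (Intertwines.alpha hg i).circle (Intertwines.iterate_deriv_alpha hg i b) _
  have h2 : ∑ i, wick (∑ l, g l i • Heisenberg.alpha n l)
        (∑ l, g l i • deriv^[b] (Heisenberg.alpha n l)) = Heisenberg.j n b := by
    rw [Heisenberg.j, omega]
    have hgg : ∀ l l', ∑ i, g l i * g l' i = if l = l' then 1 else 0 := fun l l' => by
      have h0 : g * g.transpose = 1 := mul_eq_one_comm.mp hg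
      have := congrFun (congrFun h0 l) l'
      rw [Matrix.mul_apply, Matrix.one_apply] at this
      exact this
    simp only [← wickHom_apply, map_sum, map_smul, LinearMap.sum_apply, LinearMap.smul_apply]
    rw [Finset.sum_comm]
    refine Finset.sum_congr rfl fun l _ => ?_
    simp only [Finset.smul_sum, smul_smul]
    rw [Finset.sum_comm]
    simp only [← Finset.sum_smul, hgg]
    simp
  rwa [h2] at h1

theorem j_mem_invariantVA (b : ℕ) : j n b ∈ invariantVA n :=
  ⟨j_mem_heisenbergVA b, fun _ hg m p => Intertwines.j hg b m p⟩

theorem circle_mem_invariantVA {a b : VertexOperator ℂ (Fock n)} (ha : a ∈ invariantVA n)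
    (hb : b ∈ invariantVA n) (m : ℤ) : circle m a b ∈ invariantVA n :=
  ⟨circle_mem_heisenbergVA ha.1 hb.1 m, fun g hg =>
    Intertwines.circle (L := (fockAction n g).toLinearMap) (ha.2 g hg) (hb.2 g hg) m⟩

theorem vac_mem_invariantVA : vac ∈ invariantVA n := by
  refine ⟨vac_mem_heisenbergVA, fun g _ m p => ?_⟩
  rw [mode_vac]
  split_ifs <;> simp

theorem iterate_deriv_mem_invariantVA {a : VertexOperator ℂ (Fock n)} (ha : a ∈ invariantVA n)
    (k : ℕ) : deriv^[k] a ∈ invariantVA n := by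
  induction k with
  | zero => exact ha
  | succ k ih =>
    rw [Function.iterate_succ_apply', deriv_eq_circle]
    exact circle_mem_invariantVA ih vac_mem_invariantVA _

end InvariantFields

/-! ### Conformal weights, and words in creation modes spanning the invariants. -/

section Weights

open MvPolynomial

variable {n : ℕ}

/-- The vectors of weight `w` in Fock space. -/
def weightSpace (n : ℕ) (w : ℤ) : Submodule ℂ (Fock n) :=
  weightedHomogeneousSubmodule ℂ (fun p : Fin n × ℕ => (p.2 : ℤ) + 1) w

/-- The field `a` is homogeneous of conformal weight `h`. -/
def HasWeight (a : VertexOperator ℂ (Fock n)) (h : ℤ) : Prop :=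
  ∀ (m w : ℤ), ∀ v ∈ weightSpace n w, mode a m v ∈ weightSpace n (w + h - 1 - m)

theorem hasWeight_vac : HasWeight (vac : VertexOperator ℂ (Fock n)) 0 := by
  intro m w v hv
  rw [mode_vac]
  split_ifs with h
  · subst h
    rwa [show w + 0 - 1 - -1 = w by ring]
  · exact zero_mem _

theorem hasWeight_alpha (i : Fin n) : HasWeight (alpha n i) 1 := by
  intro m w v hv
  rw [mode_alpha]
  rcases lt_or_ge m 0 with hm | hm
  · rw [alphaMode_of_neg i hm]
    have h := (isWeightedHomogeneous_X ℂ (fun p : Fin n × ℕ => (p.2 : ℤ) + 1)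
      (i, (-m - 1).toNat)).mul ((mem_weightedHomogeneousSubmodule _ _ _ _).mp hv)
    rw [show (((i, (-m - 1).toNat) : Fin n × ℕ).2 : ℤ) + 1 + w = w + 1 - 1 - m by
      simp only; omega] at h
    exact h
  · rw [alphaMode_of_nonneg i hm]
    rcases hm.eq_or_lt with rfl | hm
    · simp
    refine Submodule.smul_mem _ _ ?_
    exact IsWeightedHomogeneous.pderiv ((mem_weightedHomogeneousSubmodule _ _ _ _).mp hv)
      (by simp only; omega)

theorem HasWeight.circle {a b : VertexOperator ℂ (Fock n)} {h h' : ℤ} (ha : HasWeight a h)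
    (hb : HasWeight b h') (p : ℤ) : HasWeight (circle p a b) (h + h' - p - 1) := by
  intro m w v hv
  obtain ⟨K, hK⟩ := exists_mode_circle_apply p a b m v
  rw [hK K le_rfl]
  refine Submodule.sum_mem _ fun t _ => Submodule.smul_mem _ _ (Submodule.sub_mem _ ?_
    (Submodule.smul_mem _ _ ?_))
  · have := ha (p - t) _ _ (hb (m + t) w v hv)
    rwa [show w + h' - 1 - (m + t) + h - 1 - (p - t) = w + (h + h' - p - 1) - 1 - m by ring]
      at this
  · have := hb (m + p - t) _ _ (ha t w v hv)
    rwa [show w + h - 1 - t + h' - 1 - (m + p - t) = w + (h + h' - p - 1) - 1 - m by ring]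
      at this

theorem HasWeight.wick {a b : VertexOperator ℂ (Fock n)} {h h' : ℤ} (ha : HasWeight a h)
    (hb : HasWeight b h') : HasWeight (wick a b) (h + h') := by
  have := ha.circle hb (-1)
  rwa [show h + h' - -1 - 1 = h + h' by ring] at this

theorem HasWeight.iterate_deriv {a : VertexOperator ℂ (Fock n)} {h : ℤ} (ha : HasWeight a h)
    (k : ℕ) : HasWeight (deriv^[k] a) (h + k) := by
  intro m w v hv
  rw [mode_iterate_deriv]
  have := ha (m - k) w v hv
  rw [show w + h - 1 - (m - k) = w + (h + k) - 1 - m by ring] at this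
  exact Submodule.smul_mem _ _ this

theorem hasWeight_j (b : ℕ) : HasWeight (j n b) (b + 2) := by
  intro m w v hv
  rw [j, omega, mode_sum, LinearMap.sum_apply]
  refine Submodule.sum_mem _ fun i _ => ?_
  have := ((hasWeight_alpha i).wick ((hasWeight_alpha i).iterate_deriv b)) m w v hv
  rwa [show w + (1 + (1 + (b : ℤ))) - 1 - m = w + (b + 2) - 1 - m by ring] at this

/-- The field `∂ᵏj^{2l}`. -/
def genField (n : ℕ) (i : ℕ × ℕ) : VertexOperator ℂ (Fock n) := deriv^[i.2] (j n (2 * i.1))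

theorem genField_mem_invariantVA (i : ℕ × ℕ) : genField n i ∈ invariantVA n :=
  iterate_deriv_mem_invariantVA (j_mem_invariantVA _) _

theorem hasWeight_genField (i : ℕ × ℕ) : HasWeight (genField n i) (genWeight i) := by
  have := (hasWeight_j (n := n) (2 * i.1)).iterate_deriv i.2
  rw [genWeight]
  push_cast at this ⊢
  exact this

theorem gen_mem_weightSpace (i : ℕ × ℕ) {w : ℤ} {v : Fock n} (hv : v ∈ weightSpace n w) :
    gen n i v ∈ weightSpace n (genWeight i + w) := by
  have := hasWeight_j (2 * i.1) (-(i.2 : ℤ) - 1) w v hv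
  rw [genWeight]
  push_cast at this ⊢
  rwa [show w + (2 * (i.1 : ℤ) + 2) - 1 - (-i.2 - 1) = 2 * i.1 + 2 + i.2 + w by ring] at this

/-- The vectors `e_{i₁} ⋯ e_{iₛ} 1`. -/
def word (n : ℕ) (l : List (ℕ × ℕ)) : Fock n := l.foldr (fun i v => gen n i v) 1

theorem word_nil : word n [] = 1 := rfl

theorem word_cons (i : ℕ × ℕ) (l : List (ℕ × ℕ)) : word n (i :: l) = gen n i (word n l) := rfl

/-- The weight of a word. -/
def listWeight (l : List (ℕ × ℕ)) : ℕ := (l.map genWeight).sum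

theorem listWeight_nil : listWeight [] = 0 := rfl

theorem listWeight_cons (i : ℕ × ℕ) (l : List (ℕ × ℕ)) :
    listWeight (i :: l) = genWeight i + listWeight l := List.sum_cons

theorem word_mem_weightSpace (l : List (ℕ × ℕ)) : word n l ∈ weightSpace n (listWeight l) := by
  induction l with
  | nil => exact isWeightedHomogeneous_one ℂ _
  | cons i l ih =>
    rw [word_cons, listWeight_cons, Nat.cast_add]
    exact gen_mem_weightSpace i ih

/-- The span of the words of weight `w` in the modes of `j^{2l}`, `l ∈ Λ`. -/
def wordSpan (n : ℕ) (Λ : Set ℕ) (w : ℤ) : Submodule ℂ (Fock n) :=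
  Submodule.span ℂ {v | ∃ l : List (ℕ × ℕ), (∀ i ∈ l, i.1 ∈ Λ) ∧ (listWeight l : ℤ) = w ∧
    v = word n l}

theorem word_mem_wordSpan {Λ : Set ℕ} {l : List (ℕ × ℕ)} (hl : ∀ i ∈ l, i.1 ∈ Λ) {w : ℤ}
    (hw : (listWeight l : ℤ) = w) : word n l ∈ wordSpan n Λ w :=
  Submodule.subset_span ⟨l, hl, hw, rfl⟩

/-- The component of weight `w` of a combination of words. -/
theorem mem_span_word_of_weight {P : List (ℕ × ℕ) → Prop} {v : Fock n}
    (hv : v ∈ Submodule.span ℂ {v | ∃ l, P l ∧ v = word n l}) {w : ℤ} (hw : v ∈ weightSpace n w) :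
    v ∈ Submodule.span ℂ {v | ∃ l, P l ∧ (listWeight l : ℤ) = w ∧ v = word n l} := by
  have h1 : weightedHomogeneousComponent (fun p : Fin n × ℕ => (p.2 : ℤ) + 1) w v = v :=
    IsWeightedHomogeneous.weightedHomogeneousComponent_same hw
  have h2 := Submodule.mem_map_of_mem
    (f := weightedHomogeneousComponent (R := ℂ) (fun p : Fin n × ℕ => (p.2 : ℤ) + 1) w) hv
  rw [h1, Submodule.map_span] at h2
  refine Submodule.span_le.mpr ?_ h2
  rintro _ ⟨_, ⟨l, hl, rfl⟩, rfl⟩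
  have h3 := word_mem_weightSpace (n := n) l
  by_cases h : (listWeight l : ℤ) = w
  · rw [IsWeightedHomogeneous.weightedHomogeneousComponent_same
      (show IsWeightedHomogeneous _ (word n l) w by rw [← h]; exact h3)]
    exact Submodule.subset_span ⟨l, hl, h, rfl⟩
  · rw [IsWeightedHomogeneous.weightedHomogeneousComponent_ne w h3 (Ne.symm h)]
    exact zero_mem _

theorem gen_mem_wordSpan {Λ : Set ℕ} {i : ℕ × ℕ} (hi : i.1 ∈ Λ) {w : ℤ} {v : Fock n}
    (hv : v ∈ wordSpan n Λ w) : gen n i v ∈ wordSpan n Λ (genWeight i + w) := by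
  have h := Submodule.mem_map_of_mem (f := gen n i) hv
  rw [wordSpan, Submodule.map_span] at h
  refine Submodule.span_le.mpr ?_ h
  rintro _ ⟨_, ⟨l, hl, rfl, rfl⟩, rfl⟩
  refine word_mem_wordSpan (l := i :: l) (List.forall_mem_cons.mpr ⟨hi, hl⟩) ?_
  rw [listWeight_cons, Nat.cast_add]

/-- The span of the scalar products `quad n a b`. -/
def quadSpan (n : ℕ) : Submodule ℂ (Fock n) :=
  Submodule.span ℂ (Set.range fun s : ℕ × ℕ => quad n s.1 s.2)

theorem quad_mem_quadSpan (a b : ℕ) : quad n a b ∈ quadSpan n := Submodule.subset_span ⟨(a, b), rfl⟩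

theorem quadForm_mem_quadSpan (r : ℕ) (χ : Polynomial ℂ) : quadForm n r χ ∈ quadSpan n :=
  Submodule.sum_mem _ fun _ _ => Submodule.smul_mem _ _ (quad_mem_quadSpan _ _)

theorem quadSpan_le_span_gen : quadSpan n ≤
    Submodule.span ℂ (Set.range fun i : ℕ × ℕ => gen n i (1 : Fock n)) := by
  refine Submodule.span_le.mpr ?_
  rintro _ ⟨⟨a, b⟩, rfl⟩
  refine Submodule.span_mono ?_ (quad_mem_span_gen a b)
  rintro _ ⟨i, -, rfl⟩
  exact ⟨i, rfl⟩

theorem shiftDer_mem_quadSpan_pow (r : ℕ) (χ : Polynomial ℂ) (s : ℕ) {f : Fock n}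
    (hf : f ∈ quadSpan n ^ s) : shiftDer n r χ f ∈ quadSpan n ^ s := by
  induction s generalizing f with
  | zero =>
    rw [pow_zero, Submodule.mem_one] at hf
    obtain ⟨c, rfl⟩ := hf
    rw [Derivation.map_algebraMap]
    exact zero_mem _
  | succ s ih =>
    rw [pow_succ'] at hf ⊢
    refine Submodule.mul_induction_on hf (fun p hp q hq => ?_) fun p q hp hq => ?_
    · rw [Derivation.leibniz, smul_eq_mul, smul_eq_mul, mul_comm q]
      refine add_mem (Submodule.mul_mem_mul hp (ih hq)) (Submodule.mul_mem_mul ?_ hq)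
      have h := Submodule.mem_map_of_mem (f := (shiftDer n r χ).toLinearMap) hp
      rw [quadSpan, Submodule.map_span] at h
      refine Submodule.span_le.mpr ?_ h
      rintro _ ⟨_, ⟨⟨a, b⟩, rfl⟩, rfl⟩
      change shiftDer n r χ (quad n a b) ∈ _
      rw [shiftDer_quad]
      exact add_mem (Submodule.smul_mem _ _ (quad_mem_quadSpan _ _))
        (Submodule.smul_mem _ _ (quad_mem_quadSpan _ _))
    · rw [map_add]
      exact add_mem hp hq

theorem gen_sub_mul (i : ℕ × ℕ) (v : Fock n) : gen n i v - gen n i 1 * v =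
    shiftDer n (genWeight i) (jPoly (2 * i.1) (genWeight i)) v := by
  rw [gen_eq_quadOp, quadOp_one, quadOp_apply, add_sub_cancel_left]

/-- Multiplication by e_i 1 differs from the operator e_i by a derivation that preserves the degree
in the scalar products, so the error is covered by induction on s. -/
theorem quadSpan_pow_le_span_word (s : ℕ) :
    quadSpan n ^ s ≤ Submodule.span ℂ {v | ∃ l, True ∧ v = word n l} := by
  induction s with
  | zero =>
    rw [pow_zero, Submodule.one_le]
    exact Submodule.subset_span ⟨[], trivial, rfl⟩
  | succ s ih =>
    rw [pow_succ']
    refine (mul_le_mul_left quadSpan_le_span_gen _).trans ?_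
    refine Submodule.mul_le.mpr fun p hp f hf => ?_
    induction hp using Submodule.span_induction with
    | mem p hp =>
      obtain ⟨i, rfl⟩ := hp
      have h1 : gen n i 1 * f = gen n i f -
          shiftDer n (genWeight i) (jPoly (2 * i.1) (genWeight i)) f := by
        rw [← gen_sub_mul, sub_sub_cancel]
      simp only [h1]
      refine sub_mem ?_ (ih (shiftDer_mem_quadSpan_pow _ _ s hf))
      have h2 := Submodule.mem_map_of_mem (f := gen n i) (ih hf)
      rw [Submodule.map_span] at h2
      refine Submodule.span_mono ?_ h2
      rintro _ ⟨_, ⟨l, -, rfl⟩, rfl⟩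
      exact ⟨i :: l, trivial, rfl⟩
    | zero => rw [zero_mul]; exact zero_mem _
    | add p q _ _ hp hq => rw [add_mul]; exact add_mem hp hq
    | smul c p _ hp => rw [smul_mul_assoc]; exact Submodule.smul_mem _ _ hp

theorem mem_span_word_of_mem_quadAlgebra {p : Fock n} (hp : p ∈ quadAlgebra n) :
    p ∈ Submodule.span ℂ {v | ∃ l, True ∧ v = word n l} := by
  have key : ∀ f ∈ ⨆ s : ℕ, quadSpan n ^ s, p * f ∈ ⨆ s : ℕ, quadSpan n ^ s := by
    induction hp using Algebra.adjoin_induction with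
    | mem p hp =>
      obtain ⟨s, rfl⟩ := hp
      intro f hf
      have h := Submodule.mul_mem_mul (quad_mem_quadSpan s.1 s.2) hf
      rw [Submodule.mul_iSup] at h
      refine (iSup_le fun t => ?_ : _ ≤ ⨆ s : ℕ, quadSpan n ^ s) h
      rw [← pow_succ']
      exact le_iSup (fun s : ℕ => quadSpan n ^ s) (t + 1)
    | algebraMap c =>
      intro f hf
      rw [← Algebra.smul_def]
      exact Submodule.smul_mem _ _ hf
    | add p q _ _ hp hq =>
      intro f hf
      rw [add_mul]
      exact add_mem (hp f hf) (hq f hf)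
    | mul p q _ _ hp hq =>
      intro f hf
      rw [mul_assoc]
      exact hp _ (hq f hf)
  have h1 : (1 : Fock n) ∈ ⨆ s : ℕ, quadSpan n ^ s :=
    (le_iSup (fun s : ℕ => quadSpan n ^ s) 0) (by
      simp only [pow_zero]
      exact Submodule.one_le.mp le_rfl)
  have h2 := key 1 h1
  rw [mul_one] at h2
  exact (iSup_le quadSpan_pow_le_span_word) h2

/-- The vectors in Fock space which are invariant under the orthogonal group. -/
def IsInvariant (v : Fock n) : Prop :=
  ∀ g : Matrix (Fin n) (Fin n) ℂ, g.transpose * g = 1 → fockAction n g v = v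

theorem IsInvariant.mode {a : VertexOperator ℂ (Fock n)} (ha : a ∈ invariantVA n) {v : Fock n}
    (hv : IsInvariant v) (m : ℤ) : IsInvariant (mode a m v) := fun g hg => by
  rw [ha.2 g hg, hv g hg]

theorem isInvariant_one : IsInvariant (1 : Fock n) := fun _ _ => map_one _

theorem isInvariant_word (l : List (ℕ × ℕ)) : IsInvariant (word n l) := by
  induction l with
  | nil => exact isInvariant_one
  | cons i l ih => exact ih.mode (j_mem_invariantVA _) _

theorem IsInvariant.mem_span_word {v : Fock n} (hv : IsInvariant v) :
    v ∈ Submodule.span ℂ {v | ∃ l, True ∧ v = word n l} :=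
  mem_span_word_of_mem_quadAlgebra (mem_quadAlgebra_of_invariant n v hv)

theorem IsInvariant.mem_wordSpan {v : Fock n} (hv : IsInvariant v) {w : ℤ}
    (hw : v ∈ weightSpace n w) : v ∈ wordSpan n Set.univ w := by
  refine Submodule.span_mono ?_ (mem_span_word_of_weight hv.mem_span_word hw)
  rintro _ ⟨l, -, hl, rfl⟩
  exact ⟨l, fun _ _ => trivial, hl, rfl⟩

end Weights

/-! ### Dictionary between Wick monomials and words. -/

section FieldWords

variable {n : ℕ}

/-- The iterated Wick product of the fields `∂ᵏj^{2l}` for the pairs `(l, k)` of a list. -/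
def fieldWord (n : ℕ) (l : List (ℕ × ℕ)) : VertexOperator ℂ (Fock n) :=
  iteratedWick (l.map (genField n))

theorem fieldWord_nil : fieldWord n [] = vac := rfl

theorem fieldWord_cons (i : ℕ × ℕ) (l : List (ℕ × ℕ)) :
    fieldWord n (i :: l) = wick (genField n i) (fieldWord n l) := rfl

theorem fieldWord_mem_invariantVA (l : List (ℕ × ℕ)) : fieldWord n l ∈ invariantVA n := by
  induction l with
  | nil => exact vac_mem_invariantVA
  | cons i l ih => exact circle_mem_invariantVA (genField_mem_invariantVA i) ih _

theorem hasWeight_fieldWord (l : List (ℕ × ℕ)) : HasWeight (fieldWord n l) (listWeight l) := by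
  induction l with
  | nil => exact hasWeight_vac
  | cons i l ih =>
    rw [listWeight_cons, Nat.cast_add]
    exact (hasWeight_genField i).wick ih

theorem mode_genField (i : ℕ × ℕ) (t : ℕ) : mode (genField n i) (-(t : ℤ) - 1) =
    (descPochhammer ℂ i.2).eval ((i.2 : ℂ) + t) • gen n (i.1, t + i.2) := by
  rw [genField, mode_iterate_deriv, neg_one_pow_mul_eval_descPochhammer, gen]
  push_cast
  rw [show (i.2 : ℂ) - 1 - (-t - 1) = i.2 + t by ring,
    show -(t : ℤ) - 1 - i.2 = -(t + i.2) - 1 by ring]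

/-- The mode -1 of ∂ᵏj^{2l} is k! times j^{2l}(-k-1); the scalar is the product of these factorials.
-/
theorem exists_state_fieldWord (l : List (ℕ × ℕ)) :
    ∃ c : ℂ, c ≠ 0 ∧ state n (fieldWord n l) = c • word n l := by
  induction l with
  | nil =>
    refine ⟨1, one_ne_zero, ?_⟩
    rw [state_apply, fieldWord_nil, mode_vac, if_pos rfl, one_smul]
    rfl
  | cons i l ih =>
    obtain ⟨c, hc, h⟩ := ih
    refine ⟨(i.2.factorial : ℂ) * c,
      mul_ne_zero (by exact_mod_cast Nat.factorial_ne_zero _) hc, ?_⟩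
    have hm := mode_genField (n := n) i 0
    rw [Nat.cast_zero, Nat.cast_zero, neg_zero, zero_sub, zero_add, add_zero,
      descPochhammer_eval_eq_descFactorial, Nat.descFactorial_self] at hm
    rw [fieldWord_cons, state_wick (genField_mem_invariantVA i).1 (fieldWord_mem_invariantVA l).1, h,
      hm, map_smul, LinearMap.smul_apply, smul_smul, word_cons, mul_comm]

/-- Relations between states are relations between fields. -/
theorem mem_span_fieldWord {P : List (ℕ × ℕ) → Prop} {a : VertexOperator ℂ (Fock n)}
    (ha : a ∈ heisenbergVA n) (h : state n a ∈ Submodule.span ℂ {v | ∃ l, P l ∧ v = word n l}) :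
    a ∈ Submodule.span ℂ {x | ∃ l, P l ∧ x = fieldWord n l} := by
  have h1 : Submodule.span ℂ {v | ∃ l, P l ∧ v = word n l} ≤
      (Submodule.span ℂ {x | ∃ l, P l ∧ x = fieldWord n l}).map (state n) := by
    refine Submodule.span_le.mpr ?_
    rintro _ ⟨l, hl, rfl⟩
    obtain ⟨c, hc, h⟩ := exists_state_fieldWord (n := n) l
    refine ⟨c⁻¹ • fieldWord n l, Submodule.smul_mem _ _ (Submodule.subset_span ⟨l, hl, rfl⟩), ?_⟩
    rw [map_smul, h, smul_smul, inv_mul_cancel₀ hc, one_smul]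
  obtain ⟨b, hb, hab⟩ := h1 h
  have hb' : b ∈ heisenbergVA n := by
    refine (Submodule.span_le.mpr ?_) hb
    rintro _ ⟨l, -, rfl⟩
    exact (fieldWord_mem_invariantVA l).1
  rwa [eq_of_state_eq ha hb' hab.symm]

theorem state_mem_span_word {P : List (ℕ × ℕ) → Prop} {a : VertexOperator ℂ (Fock n)}
    (h : a ∈ Submodule.span ℂ {x | ∃ l, P l ∧ x = fieldWord n l}) :
    state n a ∈ Submodule.span ℂ {v | ∃ l, P l ∧ v = word n l} := by
  have h1 := Submodule.mem_map_of_mem (f := state n) h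
  rw [Submodule.map_span] at h1
  refine Submodule.span_le.mpr ?_ h1
  rintro _ ⟨_, ⟨l, hl, rfl⟩, rfl⟩
  obtain ⟨c, -, h⟩ := exists_state_fieldWord (n := n) l
  rw [h]
  exact Submodule.smul_mem _ _ (Submodule.subset_span ⟨l, hl, rfl⟩)

theorem normallyOrderedPolynomials_eq (Λ : Set ℕ) :
    normallyOrderedPolynomials {x | ∃ m ∈ Λ, x = j n (2 * m)} =
      Submodule.span ℂ {x | ∃ l : List (ℕ × ℕ), (∀ i ∈ l, i.1 ∈ Λ) ∧ x = fieldWord n l} := by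
  refine le_antisymm (Submodule.span_mono ?_) (Submodule.span_mono ?_)
  · rintro _ ⟨l, hl, rfl⟩
    have key : ∃ l' : List (ℕ × ℕ), (∀ i ∈ l', i.1 ∈ Λ) ∧
        l.map (fun p => deriv^[p.1] p.2) = l'.map (genField n) := by
      induction l with
      | nil => exact ⟨[], by simp, rfl⟩
      | cons p l ih =>
        obtain ⟨l', h1, h2⟩ := ih fun q hq => hl q (List.mem_cons_of_mem _ hq)
        obtain ⟨m, hm, hp⟩ := hl p List.mem_cons_self
        refine ⟨(m, p.1) :: l', List.forall_mem_cons.mpr ⟨hm, h1⟩, ?_⟩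
        rw [List.map_cons, List.map_cons, h2, hp]
        rfl
    obtain ⟨l', h1, h2⟩ := key
    exact ⟨l', h1, by rw [h2, fieldWord]⟩
  · rintro _ ⟨l, hl, rfl⟩
    refine ⟨l.map fun i => (i.2, j n (2 * i.1)), ?_, ?_⟩
    · intro p hp
      obtain ⟨i, hi, rfl⟩ := List.mem_map.mp hp
      exact ⟨i.1, hl i hi, rfl⟩
    · rw [List.map_map]
      rfl

end FieldWords

/-! ### Propagation of the decoupling relation to all weights. -/

section Decoupling

variable {n : ℕ} {Λ : Set ℕ}

/-- Every `e_i 1` of weight at most `R` is a combination of words in the modes of `j^{2l}`,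
`l ∈ Λ`. -/
def DecouplesUpTo (n : ℕ) (Λ : Set ℕ) (R : ℕ) : Prop :=
  ∀ i, genWeight i ≤ R → gen n i 1 ∈ wordSpan n Λ (genWeight i)

theorem gen_bracket_apply (i i' : ℕ × ℕ) (v : Fock n) :
    gen n i (gen n i' v) - gen n i' (gen n i v) ∈ Submodule.span ℂ {u | ∃ t : ℕ × ℕ,
      genWeight t = genWeight i + genWeight i' ∧ 1 ≤ t.2 ∧ u = gen n t v} := by
  have h := Submodule.mem_map_of_mem (f := LinearMap.applyₗ (R := ℂ) v) (gen_bracket (n := n) i i')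
  rw [Submodule.map_span] at h
  refine Submodule.span_mono ?_ h
  rintro _ ⟨_, ⟨t, h1, h2, rfl⟩, rfl⟩
  exact ⟨t, h1, h2, rfl⟩

theorem raise_gen_apply (i : ℕ × ℕ) (v : Fock n) :
    raise n (gen n i v) - gen n i (raise n v) ∈ Submodule.span ℂ {u | ∃ t : ℕ × ℕ,
      genWeight t = genWeight i + 2 ∧ t.1 ≤ i.1 + 1 ∧ u = gen n t v} := by
  have h := Submodule.mem_map_of_mem (f := LinearMap.applyₗ (R := ℂ) v) (raise_gen (n := n) i)
  rw [Submodule.map_span] at h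
  refine Submodule.span_mono ?_ h
  rintro _ ⟨_, ⟨t, h1, h2, rfl⟩, rfl⟩
  exact ⟨t, h1, h2, rfl⟩

/-- Move the new letter to the right until it meets 1. Each commutator is a sum of single letters of
the combined weight acting on a shorter word, which the induction, being over all letters, covers.
-/
theorem DecouplesUpTo.gen_word_mem {R : ℕ} (hR : DecouplesUpTo n Λ R) {l : List (ℕ × ℕ)}
    (hl : ∀ i ∈ l, i.1 ∈ Λ) : ∀ i, genWeight i + listWeight l ≤ R →
      gen n i (word n l) ∈ wordSpan n Λ (genWeight i + listWeight l) := by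
  induction l with
  | nil =>
    intro i hi
    rw [listWeight_nil, Nat.cast_zero, add_zero]
    exact hR i hi
  | cons p l ih =>
    intro i hi
    obtain ⟨hp, hl⟩ := List.forall_mem_cons.mp hl
    rw [listWeight_cons] at hi
    rw [word_cons, listWeight_cons, ← sub_add_cancel (gen n i _) (gen n p (gen n i (word n l)))]
    refine add_mem ?_ ?_
    · refine Submodule.span_le.mpr ?_ (gen_bracket_apply i p (word n l))
      rintro _ ⟨t, ht, -, rfl⟩
      have := ih hl t (by omega)
      rw [ht] at this
      push_cast at this ⊢
      rwa [← add_assoc]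
    · have := gen_mem_wordSpan hp (ih hl i (by omega))
      push_cast
      rwa [add_left_comm]

theorem DecouplesUpTo.word_mem {R : ℕ} (hR : DecouplesUpTo n Λ R) {l : List (ℕ × ℕ)}
    (hl : listWeight l ≤ R) : word n l ∈ wordSpan n Λ (listWeight l) := by
  induction l with
  | nil => exact word_mem_wordSpan (by simp) rfl
  | cons i l ih =>
    rw [listWeight_cons] at hl ⊢
    have h := Submodule.mem_map_of_mem (f := gen n i) (ih (by omega))
    rw [wordSpan, Submodule.map_span] at h
    refine Submodule.span_le.mpr ?_ h
    rintro _ ⟨_, ⟨l', hl', hw, rfl⟩, rfl⟩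
    have hw' : listWeight l' = listWeight l := by exact_mod_cast hw
    have := hR.gen_word_mem hl' i (by omega)
    rw [hw'] at this
    rwa [Nat.cast_add]

theorem DecouplesUpTo.wordSpan_univ_le {R : ℕ} (hR : DecouplesUpTo n Λ R) {w : ℤ} (hw : w ≤ R) :
    wordSpan n Set.univ w ≤ wordSpan n Λ w := by
  refine Submodule.span_le.mpr ?_
  rintro _ ⟨l, -, rfl, rfl⟩
  exact hR.word_mem (by exact_mod_cast hw)

theorem translation_mem_wordSpan {w : ℤ} {v : Fock n} (hv : v ∈ wordSpan n Λ w) :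
    translation n v ∈ wordSpan n Λ (w + 1) := by
  have h := Submodule.mem_map_of_mem (f := (translation n).toLinearMap) hv
  rw [wordSpan, Submodule.map_span] at h
  refine Submodule.span_le.mpr ?_ h
  rintro _ ⟨_, ⟨l, hl, rfl, rfl⟩, rfl⟩
  clear hv h
  change translation n (word n l) ∈ _
  induction l with
  | nil =>
    rw [word_nil, Derivation.map_one_eq_zero]
    exact zero_mem _
  | cons i l ih =>
    obtain ⟨hi, hl⟩ := List.forall_mem_cons.mp hl
    rw [word_cons, translation_gen, listWeight_cons]
    refine add_mem ?_ (Submodule.smul_mem _ _ ?_)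
    · have := gen_mem_wordSpan hi (ih hl)
      push_cast
      rwa [add_assoc]
    · refine word_mem_wordSpan (l := (i.1, i.2 + 1) :: l)
        (List.forall_mem_cons.mpr ⟨hi, hl⟩) ?_
      rw [listWeight_cons, genWeight, genWeight]
      push_cast
      ring

/-- The gain from R to R + 1: in a Wick product either the outer factor acts last by a creation
mode, which raises the weight by at least 2, so that it acts on an invariant vector of weight below
R; or the outer factor acts first by a mode t ≥ 0 and one is left with a shorter word of fields on
another invariant vector. The empty word contributes nothing since its only nonzero mode has k = 0.
-/
theorem DecouplesUpTo.mode_fieldWord_mem {R : ℕ} (hR : DecouplesUpTo n Λ R) {l : List (ℕ × ℕ)}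
    (hl : ∀ i ∈ l, i.1 ∈ Λ) : ∀ (k : ℕ), (l = [] → 1 ≤ k) → ∀ (w : ℤ) (u : Fock n),
      IsInvariant u → u ∈ weightSpace n w → listWeight l + k + w ≤ R + 1 →
      mode (fieldWord n l) (-(k : ℤ) - 1) u ∈ wordSpan n Λ (listWeight l + k + w) := by
  induction l with
  | nil =>
    intro k hk w u _ _ _
    rw [fieldWord_nil, mode_vac, if_neg (by have := hk rfl; omega)]
    exact zero_mem _
  | cons i l ih =>
    intro k _ w u hu hw hle
    obtain ⟨hi, hl⟩ := List.forall_mem_cons.mp hl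
    obtain ⟨K, hK⟩ := mode_wick_apply (genField n i) (fieldWord n l) (-(k : ℤ) - 1) u
    rw [fieldWord_cons, hK K le_rfl]
    rw [listWeight_cons, Nat.cast_add] at hle ⊢
    have hi2 : 2 ≤ genWeight i := by rw [genWeight]; omega
    refine Submodule.sum_mem _ fun t _ => add_mem ?_ ?_
    · rw [mode_genField, LinearMap.smul_apply]
      refine Submodule.smul_mem _ _ ?_
      set u' := mode (fieldWord n l) (-(k : ℤ) - 1 + t) u
      have h1 : u' ∈ weightSpace n (w + listWeight l + k - t) := by
        have := hasWeight_fieldWord l (-(k : ℤ) - 1 + t) w u hw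
        rwa [show w + (listWeight l : ℤ) - 1 - (-k - 1 + t) = w + listWeight l + k - t by ring]
          at this
      have h2 : u' ∈ wordSpan n Λ (w + listWeight l + k - t) :=
        hR.wordSpan_univ_le (by omega)
          ((hu.mode (fieldWord_mem_invariantVA l) _).mem_wordSpan h1)
      have h3 := gen_mem_wordSpan (i := (i.1, t + i.2)) hi h2
      have h4 : (genWeight (i.1, t + i.2) : ℤ) = genWeight i + t := by
        simp only [genWeight]
        push_cast
        ring
      rw [h4] at h3
      rwa [show (genWeight i : ℤ) + t + (w + listWeight l + k - t) =
        genWeight i + listWeight l + k + w by ring] at h3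
    · have h1 := hasWeight_genField i (t : ℤ) w u hw
      have h2 := ih hl (k + 1 + t) (fun _ => by omega) _ _
        (hu.mode (genField_mem_invariantVA i) t) h1 (by push_cast; linarith)
      push_cast at h2
      rwa [show (listWeight l : ℤ) + (k + 1 + t) + (w + genWeight i - 1 - t) =
        genWeight i + listWeight l + k + w by ring,
        show -((k : ℤ) + 1 + t) - 1 = -k - 1 - 1 - t by ring] at h2

/-- A decoupling relation for the field `j^{2L}`. -/
def FieldDecouples (n L : ℕ) : Prop :=
  j n (2 * L) ∈ Submodule.span ℂ {x | ∃ l : List (ℕ × ℕ), ((∀ i ∈ l, i.1 ∈ Set.Iio L) ∧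
    (listWeight l : ℤ) = 2 * L + 2) ∧ x = fieldWord n l}

/-- The relation for j^{2L} is an identity of fields, so taking the mode -k-1 on u is a linear map
that can be applied to both sides. -/
theorem DecouplesUpTo.gen_mem {R L : ℕ} (hR : DecouplesUpTo n (Set.Iio L) R)
    (hL : FieldDecouples n L) (k : ℕ) {w : ℤ} {u : Fock n} (hu : IsInvariant u)
    (hw : u ∈ weightSpace n w) (hle : 2 * L + 2 + k + w ≤ R + 1) :
    gen n (L, k) u ∈ wordSpan n (Set.Iio L) (2 * L + 2 + k + w) := by
  let f : VertexOperator ℂ (Fock n) →ₗ[ℂ] Fock n :=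
    { toFun := fun a => mode a (-(k : ℤ) - 1) u
      map_add' := fun a b => by rw [mode_add, LinearMap.add_apply]
      map_smul' := fun c a => by rw [mode_smul, LinearMap.smul_apply, RingHom.id_apply] }
  have h := Submodule.mem_map_of_mem (f := f) hL
  rw [Submodule.map_span] at h
  refine Submodule.span_le.mpr ?_ h
  rintro _ ⟨_, ⟨l, ⟨hl, hlw⟩, rfl⟩, rfl⟩
  rw [← hlw] at hle ⊢
  refine hR.mode_fieldWord_mem hl k ?_ w u hu hw hle
  rintro rfl
  rw [listWeight_nil] at hlw
  omega

/-- The raising operator kills 1, so only commutators with the letters remain. They have index at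
most L; a letter of index exactly L is rewritten with the decoupling relation. -/
theorem DecouplesUpTo.raise_word_mem {R L : ℕ} (hR : DecouplesUpTo n (Set.Iio L) R)
    (hL : FieldDecouples n L) {l : List (ℕ × ℕ)} (hl : ∀ i ∈ l, i.1 ∈ Set.Iio L)
    (hw : listWeight l + 2 ≤ R + 1) :
    raise n (word n l) ∈ wordSpan n (Set.Iio L) (listWeight l + 2) := by
  induction l with
  | nil =>
    rw [word_nil, raise_one]
    exact zero_mem _
  | cons i l ih =>
    obtain ⟨hi, hl⟩ := List.forall_mem_cons.mp hl
    rw [listWeight_cons] at hw ⊢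
    rw [word_cons, ← sub_add_cancel (raise n _) (gen n i (raise n (word n l)))]
    refine add_mem ?_ ?_
    · refine Submodule.span_le.mpr ?_ (raise_gen_apply i (word n l))
      rintro _ ⟨⟨m, k⟩, ht, hm, rfl⟩
      have hi' : i.1 < L := hi
      rcases (show m ≤ L by simp only at hm; omega).eq_or_lt with rfl | hm'
      · have ht' : 2 * m + 2 + k = genWeight i + 2 := ht
        have := hR.gen_mem hL k (isInvariant_word l) (word_mem_weightSpace l) (by omega)
        rwa [show (2 * m + 2 + k + listWeight l : ℤ) =
          ((genWeight i + listWeight l : ℕ) : ℤ) + 2 by push_cast; omega] at this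
      · refine word_mem_wordSpan (l := (m, k) :: l) (List.forall_mem_cons.mpr ⟨hm', hl⟩) ?_
        rw [listWeight_cons, ht]
        push_cast
        ring
    · have := gen_mem_wordSpan hi (ih hl (by omega))
      push_cast
      rwa [add_assoc]

theorem DecouplesUpTo.quad_mem {R : ℕ} (hR : DecouplesUpTo n Λ R) {a b : ℕ} (hab : a + b + 2 ≤ R) :
    quad n a b ∈ wordSpan n Λ ((a + b + 2 : ℕ) : ℤ) := by
  refine Submodule.span_le.mpr ?_ (quad_mem_span_gen a b)
  rintro _ ⟨i, hi, rfl⟩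
  rw [← hi]
  exact hR i (by omega)

/-- With R = M + 3 the new vectors are combinations of the scalar products with a + b = M + 2.
Translates from weight R connect neighbouring ones, so a single one suffices; it is obtained by
raising the weight of `quad n 0 M` by two. -/
theorem DecouplesUpTo.succ {R L : ℕ} (hR : DecouplesUpTo n (Set.Iio L) R)
    (hL : FieldDecouples n L) (hR2 : 3 ≤ R) : DecouplesUpTo n (Set.Iio L) (R + 1) := by
  obtain ⟨M, rfl⟩ : ∃ M, R = M + 3 := ⟨R - 3, by omega⟩
  set U := wordSpan n (Set.Iio L) ((M + 3 + 1 : ℕ) : ℤ) with hU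
  have hD : ∀ a b, a + b = M + 1 →
      ((a : ℂ) + 1) • quad n (a + 1) b + ((b : ℂ) + 1) • quad n a (b + 1) ∈ U := by
    intro a b hab
    have := translation_mem_wordSpan (hR.quad_mem (a := a) (b := b) (by omega))
    rw [translation_quad, hab] at this
    exact this
  have hraise : raise n (quad n 0 M) ∈ U := by
    have h0 := hR.quad_mem (a := 0) (b := M) (by omega)
    have h := Submodule.mem_map_of_mem (f := raise n) h0
    rw [wordSpan, Submodule.map_span] at h
    refine Submodule.span_le.mpr ?_ h
    rintro _ ⟨_, ⟨l, hl, hw, rfl⟩, rfl⟩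
    have hw' : listWeight l = M + 2 := by
      rw [zero_add] at hw
      exact_mod_cast hw
    have := hR.raise_word_mem hL hl (by omega)
    rw [hw'] at this
    exact this
  -- Raising gives 8 `quad n 2 M` + 2(M+1)(M+2)² `quad n 0 (M + 2)`. Eliminating `quad n 2 M` and
  -- `quad n 1 (M + 1)` by two translates leaves `quad n 0 (M + 2)` with coefficient 2(M+1)(M+2)² +
  -- 4(M+1)(M+2) = 2(M+2)(M+1)(M+4) ≠ 0.
  have h0 : quad n 0 (M + 2) ∈ U := by
    rw [raise_quad] at hraise
    have h1 := hD 0 (M + 1) (by ring)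
    have h2 := hD 1 M (by ring)
    have hc : (2 * ((M : ℂ) + 2) * (M + 1) * (M + 4)) ≠ 0 := by
      have h1 : (M : ℂ) + 2 ≠ 0 := by exact_mod_cast Nat.succ_ne_zero (M + 1)
      have h2 : (M : ℂ) + 1 ≠ 0 := by exact_mod_cast Nat.succ_ne_zero M
      have h3 : (M : ℂ) + 4 ≠ 0 := by exact_mod_cast Nat.succ_ne_zero (M + 3)
      exact mul_ne_zero (mul_ne_zero (mul_ne_zero two_ne_zero h1) h2) h3
    rw [← Submodule.smul_mem_iff U hc]
    have h3 := add_mem (sub_mem hraise (Submodule.smul_mem U (4 : ℂ) h2))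
      (Submodule.smul_mem U (4 * ((M : ℂ) + 1)) h1)
    convert h3 using 1
    push_cast
    simp only [zero_add]
    module
  have hall : ∀ a b, a + b = M + 2 → quad n a b ∈ U := by
    intro a
    induction a with
    | zero =>
      intro b hb
      rw [show b = M + 2 by omega]
      exact h0
    | succ a ih =>
      intro b hb
      have h1 := hD a b (by omega)
      have h2 := ih (b + 1) (by omega)
      have h3 := sub_mem h1 (Submodule.smul_mem U ((b : ℂ) + 1) h2)
      rw [add_sub_cancel_right] at h3
      exact (Submodule.smul_mem_iff U (by exact_mod_cast Nat.succ_ne_zero a)).mp h3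
  intro i hi
  rcases hi.eq_or_lt with hi | hi
  · rw [gen_one, hi]
    refine Submodule.sum_mem _ fun m hm => Submodule.smul_mem _ _ (hall _ _ ?_)
    rw [Finset.mem_range] at hm
    omega
  · exact hR i (by omega)

/-- If `j^{2L}` decouples, then so do all `j^{2r}` with `r ≥ L`. -/
theorem FieldDecouples.wordSpan_eq {L : ℕ} (hL0 : 1 ≤ L) (hL : FieldDecouples n L) (w : ℤ) :
    wordSpan n Set.univ w ≤ wordSpan n (Set.Iio L) w := by
  -- Up to this weight the only letter of index at least L is j^{2L}(-1), and the given relation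
  -- handles it.
  have base : DecouplesUpTo n (Set.Iio L) (2 * L + 2) := by
    intro i hi
    rcases lt_or_ge i.1 L with h | h
    · exact word_mem_wordSpan (l := [i]) (by simpa using h) (by simp [listWeight])
    · have hi' : i = (L, 0) := by
        rw [genWeight] at hi
        exact Prod.ext (by simp only; omega) (by simp only; omega)
      have h1 := state_mem_span_word hL
      subst hi'
      refine Submodule.span_mono ?_ h1
      rintro _ ⟨l, ⟨hl, hw⟩, rfl⟩
      refine ⟨l, hl, ?_, rfl⟩
      rw [hw, genWeight]
      push_cast
      ring
  have all : ∀ R, DecouplesUpTo n (Set.Iio L) (2 * L + 2 + R) := by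
    intro R
    induction R with
    | zero => exact base
    | succ R ih => exact ih.succ hL (by omega)
  exact (all w.toNat).wordSpan_univ_le (by omega)

end Decoupling

/-! ### Strong generation from a decoupling relation. -/

section StrongGeneration

variable {n : ℕ}

theorem jSet_eq {L : ℕ} (hL : n ^ 2 + 3 * n = 2 * L) :
    jSet n = {x | ∃ m ∈ Set.Iio L, x = j n (2 * m)} := by
  ext x
  refine exists_congr fun m => and_congr_left fun _ => ?_
  rw [Set.mem_Iio]
  omega

theorem state_j (l : ℕ) : state n (j n (2 * l)) = word n [(l, 0)] := rfl

/-- The given relation need not be homogeneous; its component in the weight 2L + 2 of j^{2L} is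
again a relation. -/
theorem fieldDecouples_of_mem {L : ℕ}
    (h : j n (2 * L) ∈ normallyOrderedPolynomials {x | ∃ m ∈ Set.Iio L, x = j n (2 * m)}) :
    FieldDecouples n L := by
  rw [normallyOrderedPolynomials_eq] at h
  have h1 := state_mem_span_word h
  have h2 : state n (j n (2 * L)) ∈ weightSpace n (2 * L + 2) := by
    have := word_mem_weightSpace (n := n) [(L, 0)]
    rw [← state_j] at this
    simpa [listWeight, genWeight] using this
  refine mem_span_fieldWord (j_mem_heisenbergVA _) ?_
  simpa only [and_assoc] using mem_span_word_of_weight h1 h2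

theorem FieldDecouples.stronglyGenerates {L : ℕ} (hL0 : 1 ≤ L) (hL : FieldDecouples n L) :
    StronglyGenerates {x | ∃ m ∈ Set.Iio L, x = j n (2 * m)} (invariantVA n) := by
  rw [StronglyGenerates, normallyOrderedPolynomials_eq]
  refine le_antisymm (Submodule.span_le.mpr ?_) fun a ha => ?_
  · rintro _ ⟨l, -, rfl⟩
    exact fieldWord_mem_invariantVA l
  · refine mem_span_fieldWord ha.1 (Submodule.span_le.mpr ?_
      (isInvariant_one.mode ha (-1)).mem_span_word)
    rintro _ ⟨l, -, rfl⟩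
    refine Submodule.span_mono ?_ (hL.wordSpan_eq hL0 (listWeight l)
      (word_mem_wordSpan (fun i _ => Set.mem_univ i.1) rfl))
    rintro _ ⟨l', h, -, rfl⟩
    exact ⟨l', h, rfl⟩

end StrongGeneration

/-! ### Substituting independent linear forms into polynomials. -/

section LinearSubstitution

open MvPolynomial

/-- A linear left inverse of the family v extends to an algebra homomorphism, which is a left
inverse of the substitution. -/
theorem aeval_linear_injective {σ τ : Type*} {v : σ → τ →₀ ℂ} (hv : LinearIndependent ℂ v) :
    Function.Injective (aeval (R := ℂ) fun i =>
      Finsupp.linearCombination ℂ (X : τ → MvPolynomial τ ℂ) (v i)) := by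
  obtain ⟨F, hF⟩ := LinearMap.exists_leftInverse_of_injective _
    (LinearMap.ker_eq_bot.mpr hv)
  set ρ : MvPolynomial τ ℂ →ₐ[ℂ] MvPolynomial σ ℂ := aeval fun t =>
    Finsupp.linearCombination ℂ (X : σ → MvPolynomial σ ℂ) (F (Finsupp.single t 1)) with hρ
  have h1 : ρ.toLinearMap ∘ₗ Finsupp.linearCombination ℂ X =
      Finsupp.linearCombination ℂ X ∘ₗ F := by
    refine Finsupp.lhom_ext' fun t => LinearMap.ext_ring ?_
    simp [hρ]
  have h2 : ρ.comp (aeval (R := ℂ) fun i =>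
      Finsupp.linearCombination ℂ (X : τ → MvPolynomial τ ℂ) (v i)) = AlgHom.id ℂ _ := by
    refine algHom_ext fun i => ?_
    have h3 := LinearMap.congr_fun h1 (v i)
    have h4 := LinearMap.congr_fun hF (Finsupp.single i 1)
    rw [LinearMap.comp_apply, Finsupp.linearCombination_single, one_smul] at h4
    rw [LinearMap.comp_apply, LinearMap.comp_apply, h4, LinearMap.id_apply,
      Finsupp.linearCombination_single, one_smul] at h3
    rw [AlgHom.comp_apply, aeval_X]
    exact h3
  intro p q hpq
  have := congrArg ρ hpq
  rwa [← AlgHom.comp_apply, ← AlgHom.comp_apply, h2] at this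

theorem aeval_isWeightedHomogeneous {σ τ : Type*} {w : σ → ℕ} {w' : τ → ℕ}
    {f : σ → MvPolynomial τ ℂ} (hf : ∀ i, IsWeightedHomogeneous w' (f i) (w i))
    {p : MvPolynomial σ ℂ} {m : ℕ} (hp : IsWeightedHomogeneous w p m) :
    IsWeightedHomogeneous w' (aeval f p) m := by
  rw [aeval_def, eval₂_eq]
  refine IsWeightedHomogeneous.sum _ _ _ fun d hd => ?_
  have h1 := IsWeightedHomogeneous.prod d.support (fun i => f i ^ d i) (fun i => d i • w i)
    fun i _ => (hf i).pow (d i)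
  have h2 : ∑ i ∈ d.support, d i • w i = m := by
    rw [← hp (mem_support_iff.mp hd), Finsupp.weight_apply, Finsupp.sum]
  rw [h2] at h1
  exact IsWeightedHomogeneous.C_mul h1 _

end LinearSubstitution

/-! ### Algebraic independence of the generators in low weight. -/

section FormalGenerators

open MvPolynomial

/-- The linear form in the variables `s(a, b)` which corresponds to `e_i 1`. -/
def formalGen (i : ℕ × ℕ) : Sym2 ℕ →₀ ℂ :=
  ∑ m ∈ Finset.range (genWeight i - 1),
    Finsupp.single s(m, genWeight i - 2 - m)
      ((jPoly (2 * i.1) (genWeight i)).eval ((m : ℂ) + 1) / 2)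

/-- Lagrange interpolation at the nodes `1, …, r - 1`. -/
def nodeBasis (r m : ℕ) : Polynomial ℂ :=
  Lagrange.basis (Finset.range (r - 1)) (fun m : ℕ => (m : ℂ) + 1) m

theorem sum_nodeBasis {r : ℕ} {χ : Polynomial ℂ} (h : χ.degree < ((r - 1 : ℕ) : WithBot ℕ)) :
    ∑ m ∈ Finset.range (r - 1), χ.eval ((m : ℂ) + 1) • nodeBasis r m = χ := by
  have hv : Set.InjOn (fun m : ℕ => (m : ℂ) + 1) (Finset.range (r - 1)) := fun a _ b _ hab => by
    exact_mod_cast add_right_cancel hab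
  have := Lagrange.eq_interpolate hv (f := χ) (by rwa [Finset.card_range])
  rw [Lagrange.interpolate_apply] at this
  simpa only [Polynomial.smul_eq_C_mul, nodeBasis] using this.symm

/-- The coefficient functional which detects the polynomials of weight `r`. -/
def symCoeff (r N : ℕ) : (Sym2 ℕ →₀ ℂ) →ₗ[ℂ] ℂ :=
  Finsupp.linearCombination ℂ (Sym2.lift ⟨fun a b => if a + b + 2 = r then
    (nodeBasis r a + nodeBasis r b).coeff N else 0, fun a b => by
      simp only [add_comm a, add_comm (nodeBasis r a)]⟩)

/-- The linear form stores half the values of the polynomial at the nodes 1, …, r - 1. Its degree is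
at most r - 2, so interpolation recovers it; the two reflected basis polynomials attached to a pair
contribute equally, which compensates the halves. -/
theorem symCoeff_formalGen (r N : ℕ) (i : ℕ × ℕ) : symCoeff r N (formalGen i) =
    if genWeight i = r then (jPoly (2 * i.1) r).coeff N else 0 := by
  have hi : 2 * i.1 + 2 ≤ genWeight i := by rw [genWeight]; omega
  rw [formalGen, map_sum]
  simp only [symCoeff, Finsupp.linearCombination_single, Sym2.lift_mk]
  split_ifs with h
  · subst h
    have hd : (jPoly (2 * i.1) (genWeight i)).degree <
        ((genWeight i - 1 : ℕ) : WithBot ℕ) :=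
      degree_lt_of_natDegree_lt ((natDegree_jPoly_le _ _).trans_lt (by omega))
    have hs := isSymmetricAbout_jPoly (2 * i.1) (genWeight i)
    generalize jPoly (2 * i.1) (genWeight i) = χ at hd hs ⊢
    set r := genWeight i
    have h1 : ∑ m ∈ Finset.range (r - 1), (χ.eval ((m : ℂ) + 1) / 2) *
        (nodeBasis r m).coeff N = χ.coeff N / 2 := by
      nth_rewrite 2 [← sum_nodeBasis hd]
      rw [Polynomial.finsetSum_coeff, Finset.sum_div]
      refine Finset.sum_congr rfl fun m _ => ?_
      rw [Polynomial.coeff_smul, smul_eq_mul]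
      ring
    have h2 : ∑ m ∈ Finset.range (r - 1), (χ.eval ((m : ℂ) + 1) / 2) *
        (nodeBasis r (r - 2 - m)).coeff N = χ.coeff N / 2 := by
      rw [← h1, ← Finset.sum_range_reflect]
      refine Finset.sum_congr rfl fun m hm => ?_
      rw [Finset.mem_range] at hm
      rw [show r - 2 - (r - 1 - 1 - m) = m by omega]
      congr 2
      refine hs.eval ?_
      rw [show r - 1 - 1 - m = r - (m + 2) by omega, Nat.cast_sub (by omega)]
      push_cast
      ring
    rw [← add_halves (χ.coeff N)]
    nth_rewrite 1 [← h1]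
    rw [← h2, ← Finset.sum_add_distrib]
    refine Finset.sum_congr rfl fun m hm => ?_
    rw [Finset.mem_range] at hm
    rw [if_pos (by omega), Polynomial.coeff_add, smul_eq_mul, mul_add]
  · refine Finset.sum_eq_zero fun m hm => ?_
    rw [Finset.mem_range] at hm
    rw [if_neg (by omega), smul_zero]

/-- Within one weight the forms correspond to polynomials of distinct degrees 2l. In a relation,
choose a term with l maximal and read off the coefficient of degree 2l in its weight. -/
theorem linearIndependent_formalGen : LinearIndependent ℂ formalGen := by
  rw [linearIndependent_iff]
  intro c hc
  by_contra hne
  obtain ⟨i, hi, hmax⟩ := Finset.exists_max_image c.support (fun i => i.1)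
    (Finsupp.support_nonempty_iff.mpr hne)
  have h := congrArg (symCoeff (genWeight i) (2 * i.1)) hc
  rw [Finsupp.linearCombination_apply, Finsupp.sum, map_sum, map_zero,
    Finset.sum_eq_single i] at h
  · rw [map_smul, symCoeff_formalGen, if_pos rfl, coeff_jPoly, smul_eq_mul] at h
    exact Finsupp.mem_support_iff.mp hi (by simpa using h)
  · intro i' hi' hii
    rw [map_smul, symCoeff_formalGen]
    split_ifs with hw
    · rcases (hmax i' hi').eq_or_lt with h1 | h1
      · refine absurd (Prod.ext h1 ?_) hii
        rw [genWeight, genWeight] at hw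
        omega
      · rw [Polynomial.coeff_eq_zero_of_natDegree_lt
          ((natDegree_jPoly_le _ _).trans_lt (by omega)), smul_zero]
    · rw [smul_zero]
  · exact fun h => absurd hi h

/-- The substitution of the formal generators. -/
def formalSubst : MvPolynomial (ℕ × ℕ) ℂ →ₐ[ℂ] MvPolynomial (Sym2 ℕ) ℂ :=
  aeval fun i => Finsupp.linearCombination ℂ (X : Sym2 ℕ → MvPolynomial (Sym2 ℕ) ℂ) (formalGen i)

theorem formalSubst_X (i : ℕ × ℕ) : formalSubst (X i) =
    ∑ m ∈ Finset.range (genWeight i - 1),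
      ((jPoly (2 * i.1) (genWeight i)).eval ((m : ℂ) + 1) / 2) •
        X s(m, genWeight i - 2 - m) := by
  rw [formalSubst, aeval_X, formalGen, map_sum]
  simp only [Finsupp.linearCombination_single]

theorem isWeightedHomogeneous_formalSubst {p : MvPolynomial (ℕ × ℕ) ℂ} {w : ℕ}
    (hp : IsWeightedHomogeneous genWeight p w) :
    IsWeightedHomogeneous symWeight (formalSubst p) w := by
  refine aeval_isWeightedHomogeneous (fun i => ?_) hp
  have := formalSubst_X i
  rw [formalSubst, aeval_X] at this
  rw [this]
  refine IsWeightedHomogeneous.sum _ _ _ fun m hm => ?_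
  rw [Finset.mem_range] at hm
  rw [smul_eq_C_mul]
  refine IsWeightedHomogeneous.C_mul ?_ _
  have h := isWeightedHomogeneous_X ℂ symWeight s(m, genWeight i - 2 - m)
  rwa [symWeight_mk, show m + (genWeight i - 2 - m) + 2 = genWeight i by omega] at h

/-- The substitution of the invariants `e_i 1`. -/
def genSubst (n : ℕ) : MvPolynomial (ℕ × ℕ) ℂ →ₐ[ℂ] Fock n := aeval fun i => gen n i 1

theorem eval_genSubst {n : ℕ} (x : Fin n × ℕ → ℂ) (p : MvPolynomial (ℕ × ℕ) ℂ) :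
    eval x (genSubst n p) = eval (gram fun i a => x (i, a)) (formalSubst p) := by
  have : (eval x).comp (genSubst n).toRingHom =
      (eval (gram fun i a => x (i, a))).comp formalSubst.toRingHom := by
    refine ringHom_ext (fun c => ?_) fun i => ?_
    · simp [genSubst, formalSubst]
    · have h1 : genSubst n (X i) = gen n i 1 := aeval_X _ _
      change eval x (genSubst n (X i)) = eval _ (formalSubst (X i))
      rw [h1, gen_one, formalSubst_X, quadForm, map_sum, map_sum]
      refine Finset.sum_congr rfl fun m _ => ?_
      rw [smul_eval, smul_eval, eval_quad, eval_X, gram_mk]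
  exact congrArg (fun F => F p) this

/-- In low weight there are no relations among the invariants `e_i 1`. -/
theorem eq_zero_of_genSubst_eq_zero {n w : ℕ} {p : MvPolynomial (ℕ × ℕ) ℂ}
    (hp : IsWeightedHomogeneous genWeight p w) (hw : w < (n + 1) * (n + 2))
    (h : genSubst n p = 0) : p = 0 := by
  have h1 : VanishesOnGram n (formalSubst p) := fun v => by
    have := eval_genSubst (fun s : Fin n × ℕ => v s.1 s.2) p
    rw [h, map_zero] at this
    exact this.symm
  have h2 := h1.eq_zero_of_weight (isWeightedHomogeneous_formalSubst hp) hw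
  exact aeval_linear_injective linearIndependent_formalGen (h2.trans (map_zero _).symm)

end FormalGenerators

/-! ### Reordering words modulo shorter ones. -/

section Ordering

open MvPolynomial

variable {n : ℕ}

/-- The span of the words of length `s` and weight `w` which are neither empty nor the state of a
field `j^{2l}`. -/
def lowerSpan (n s w : ℕ) : Submodule ℂ (Fock n) :=
  Submodule.span ℂ {v | ∃ l : List (ℕ × ℕ), l.length = s ∧ listWeight l = w ∧ l ≠ [] ∧
    (∀ t, l = [t] → 1 ≤ t.2) ∧ v = word n l}

theorem gen_mem_lowerSpan (i : ℕ × ℕ) {s w : ℕ} {v : Fock n} (hv : v ∈ lowerSpan n s w) :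
    gen n i v ∈ lowerSpan n (s + 1) (genWeight i + w) := by
  have h := Submodule.mem_map_of_mem (f := gen n i) hv
  rw [lowerSpan, Submodule.map_span] at h
  refine Submodule.span_mono ?_ h
  rintro _ ⟨_, ⟨l, rfl, rfl, hne, -, rfl⟩, rfl⟩
  refine ⟨i :: l, rfl, listWeight_cons i l, List.cons_ne_nil _ _, fun t ht => ?_, rfl⟩
  exact absurd (List.cons.inj ht).2 hne

theorem listWeight_perm {l l' : List (ℕ × ℕ)} (h : l.Perm l') : listWeight l = listWeight l' :=
  (h.map genWeight).sum_eq

/-- Words are symmetric modulo shorter words. -/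
theorem word_sub_word_mem {l l' : List (ℕ × ℕ)} (h : l.Perm l') :
    word n l - word n l' ∈ lowerSpan n (l.length - 1) (listWeight l) := by
  induction h with
  | nil =>
    rw [sub_self]
    exact zero_mem _
  | @cons i l l' h ih =>
    rw [word_cons, word_cons, ← map_sub, List.length_cons, listWeight_cons]
    have := gen_mem_lowerSpan i ih
    cases l with
    | nil =>
      rw [List.nil_perm.mp h, sub_self, map_zero]
      exact zero_mem _
    | cons p l => exact this
  -- The commutator merges two letters into one that carries at least one derivative, so even a
  -- one-letter remainder is not a bare j^{2m}(-1).
  | swap i p l =>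
    refine Submodule.span_mono ?_ (gen_bracket_apply p i (word n l))
    rintro _ ⟨t, ht, ht1, rfl⟩
    refine ⟨t :: l, rfl, ?_, List.cons_ne_nil _ _, fun t' ht' => ?_, rfl⟩
    · rw [listWeight_cons, listWeight_cons, listWeight_cons, ht, add_assoc]
    · rw [← (List.cons.inj ht').1]
      exact ht1
  | trans h h' ih ih' =>
    rw [← h.length_eq, ← listWeight_perm h] at ih'
    have := add_mem ih ih'
    rwa [sub_add_sub_cancel] at this

/-- The linear map which sends a monomial to the word with the same letters. -/
def wordMap (n : ℕ) : MvPolynomial (ℕ × ℕ) ℂ →ₗ[ℂ] Fock n :=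
  (basisMonomials (ℕ × ℕ) ℂ).constr ℂ fun d => word n (Finsupp.toMultiset d).toList

theorem wordMap_monomial (d : ℕ × ℕ →₀ ℕ) (c : ℂ) :
    wordMap n (monomial d c) = c • word n (Finsupp.toMultiset d).toList := by
  have h1 : wordMap n (monomial d 1) = word n (Finsupp.toMultiset d).toList := by
    have := (basisMonomials (ℕ × ℕ) ℂ).constr_basis ℂ
      (fun d => word n (Finsupp.toMultiset d).toList) d
    rwa [coe_basisMonomials] at this
  rw [← mul_one c, ← smul_eq_mul, ← smul_monomial, map_smul, h1, smul_eq_mul, mul_one]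

/-- The combinations of ordered words of weight `w` without the word `[i]`. -/
def orderedSpan (n : ℕ) (i : ℕ × ℕ) (w : ℕ) : Submodule ℂ (Fock n) :=
  (weightedHomogeneousSubmodule ℂ genWeight w ⊓
    LinearMap.ker (lcoeff ℂ (Finsupp.single i 1))).map (wordMap n)

theorem weight_toFinsupp (l : List (ℕ × ℕ)) :
    Finsupp.weight genWeight (Multiset.toFinsupp (l : Multiset (ℕ × ℕ))) = listWeight l := by
  induction l with
  | nil => simp [listWeight_nil]
  | cons i l ih =>
    rw [← Multiset.cons_coe, ← Multiset.singleton_add, map_add, map_add, ih, listWeight_cons,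
      Multiset.toFinsupp_singleton, Finsupp.weight_apply, Finsupp.sum_single_index (by simp)]
    simp

/-- Sorting costs only shorter words, treated by induction on length. None of the corrections is the
word [i], because i carries no derivative. -/
theorem word_mem_orderedSpan {i : ℕ × ℕ} (hi : i.2 = 0) (s : ℕ) : ∀ l : List (ℕ × ℕ),
    l.length = s → l ≠ [i] → word n l ∈ orderedSpan n i (listWeight l) := by
  induction s using Nat.strong_induction_on with
  | _ s ih =>
  intro l hls hl
  set d := Multiset.toFinsupp (l : Multiset (ℕ × ℕ)) with hd
  have hperm : l.Perm (Finsupp.toMultiset d).toList := by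
    rw [← Multiset.coe_eq_coe, Multiset.coe_toList, hd, Multiset.toFinsupp_toMultiset]
  rw [← sub_add_cancel (word n l) (word n (Finsupp.toMultiset d).toList)]
  refine add_mem ?_ ⟨monomial d 1, ⟨?_, ?_⟩, ?_⟩
  · cases l with
    | nil =>
      rw [List.nil_perm.mp hperm, sub_self]
      exact zero_mem _
    | cons p l =>
      refine Submodule.span_le.mpr ?_ (word_sub_word_mem hperm)
      rintro _ ⟨l', h1, h2, -, h4, rfl⟩
      rw [← h2]
      refine ih l'.length ?_ l' rfl fun h => ?_
      · rw [h1, ← hls, List.length_cons]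
        omega
      · have := h4 i h
        omega
  · exact isWeightedHomogeneous_monomial _ _ _ (weight_toFinsupp l)
  · change coeff (Finsupp.single i 1) (monomial d 1) = 0
    rw [coeff_monomial, if_neg]
    intro h
    rw [h, Finsupp.toMultiset_single, one_smul, Multiset.toList_singleton] at hperm
    exact hl (List.perm_singleton.mp hperm)
  · rw [wordMap_monomial, one_smul]

end Ordering

/-! ### Symbols of words and independence of ordered words. -/

section Symbols

open MvPolynomial

variable {n : ℕ}

/-- The span of the products of less than `s` scalar products. -/
def quadFiltration (n s : ℕ) : Submodule ℂ (Fock n) := ⨆ t ∈ Finset.range s, quadSpan n ^ t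

theorem quadFiltration_mono {s s' : ℕ} (h : s ≤ s') : quadFiltration n s ≤ quadFiltration n s' :=
  iSup₂_le fun t ht => le_iSup₂_of_le (f := fun t (_ : t ∈ Finset.range s') => quadSpan n ^ t) t
    (Finset.mem_range.mpr ((Finset.mem_range.mp ht).trans_le h)) le_rfl

theorem quadSpan_pow_le {s t : ℕ} (h : t < s) : quadSpan n ^ t ≤ quadFiltration n s :=
  le_iSup₂_of_le (f := fun t (_ : t ∈ Finset.range s) => quadSpan n ^ t) t
    (Finset.mem_range.mpr h) le_rfl

theorem mul_mem_quadFiltration {p v : Fock n} {s : ℕ} (hp : p ∈ quadSpan n)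
    (hv : v ∈ quadFiltration n s) : p * v ∈ quadFiltration n (s + 1) := by
  have h := Submodule.mem_map_of_mem (f := LinearMap.mulLeft ℂ p) hv
  simp only [quadFiltration, Submodule.map_iSup] at h
  refine (iSup₂_le fun t ht => ?_ : _ ≤ quadFiltration n (s + 1)) h
  refine le_trans ?_ (quadSpan_pow_le (t := t + 1) (by
    rw [Finset.mem_range] at ht
    omega))
  rintro _ ⟨f, hf, rfl⟩
  rw [pow_succ']
  exact Submodule.mul_mem_mul hp hf

theorem shiftDer_mem_quadFiltration (r : ℕ) (χ : Polynomial ℂ) {v : Fock n} {s : ℕ}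
    (hv : v ∈ quadFiltration n s) : shiftDer n r χ v ∈ quadFiltration n s := by
  have h := Submodule.mem_map_of_mem (f := (shiftDer n r χ).toLinearMap) hv
  simp only [quadFiltration, Submodule.map_iSup] at h
  refine (iSup₂_le fun t ht => ?_ : _ ≤ quadFiltration n s) h
  refine le_trans ?_ (quadSpan_pow_le (Finset.mem_range.mp ht))
  rintro _ ⟨f, hf, rfl⟩
  exact shiftDer_mem_quadSpan_pow r χ t hf

theorem gen_one_mem_quadSpan (i : ℕ × ℕ) : gen n i (1 : Fock n) ∈ quadSpan n := by
  rw [gen_one]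
  exact quadForm_mem_quadSpan _ _

theorem prod_gen_one_mem (l : List (ℕ × ℕ)) :
    (l.map fun i => gen n i (1 : Fock n)).prod ∈ quadSpan n ^ l.length := by
  induction l with
  | nil => exact Submodule.one_le.mp le_rfl
  | cons i l ih =>
    rw [List.map_cons, List.prod_cons, List.length_cons, pow_succ']
    exact Submodule.mul_mem_mul (gen_one_mem_quadSpan i) ih

/-- The leading part of a word is the product of its letters. -/
theorem word_sub_prod_mem (l : List (ℕ × ℕ)) :
    word n l - (l.map fun i => gen n i (1 : Fock n)).prod ∈ quadFiltration n l.length := by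
  induction l with
  | nil =>
    rw [word_nil, List.map_nil, List.prod_nil, sub_self]
    exact zero_mem _
  | cons i l ih =>
    have h1 : word n l ∈ quadFiltration n (l.length + 1) := by
      rw [← sub_add_cancel (word n l) (l.map fun i => gen n i (1 : Fock n)).prod]
      exact add_mem (quadFiltration_mono (Nat.le_succ _) ih)
        (quadSpan_pow_le (Nat.lt_succ_self _) (prod_gen_one_mem l))
    have h2 : word n (i :: l) - ((i :: l).map fun i => gen n i (1 : Fock n)).prod =
        gen n i 1 * (word n l - (l.map fun i => gen n i (1 : Fock n)).prod) +
          shiftDer n (genWeight i) (jPoly (2 * i.1) (genWeight i)) (word n l) := by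
      rw [← gen_sub_mul, word_cons, List.map_cons, List.prod_cons]
      ring
    rw [h2, List.length_cons]
    exact add_mem (mul_mem_quadFiltration (gen_one_mem_quadSpan i) ih)
      (shiftDer_mem_quadFiltration _ _ h1)

theorem quadSpan_pow_le_homogeneous (s : ℕ) :
    quadSpan n ^ s ≤ homogeneousSubmodule (Fin n × ℕ) ℂ (2 * s) := by
  have h1 : quadSpan n ≤ homogeneousSubmodule (Fin n × ℕ) ℂ 2 := by
    refine Submodule.span_le.mpr ?_
    rintro _ ⟨⟨a, b⟩, rfl⟩
    exact IsHomogeneous.sum _ _ _ fun i _ => (isHomogeneous_X ℂ _).mul (isHomogeneous_X ℂ _)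
  induction s with
  | zero =>
    rw [pow_zero, Submodule.one_le]
    exact isHomogeneous_one _ _
  | succ s ih =>
    rw [pow_succ', Submodule.mul_le]
    intro p hp q hq
    have := IsHomogeneous.mul (h1 hp) (ih hq)
    rwa [show 2 + 2 * s = 2 * (s + 1) by ring] at this

theorem homogeneousComponent_quadFiltration {s : ℕ} {v : Fock n} (hv : v ∈ quadFiltration n s) :
    homogeneousComponent (2 * s) v = 0 := by
  have : quadFiltration n s ≤ LinearMap.ker (homogeneousComponent (R := ℂ) (2 * s)) := by
    refine iSup₂_le fun t ht f hf => ?_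
    rw [Finset.mem_range] at ht
    rw [LinearMap.mem_ker, homogeneousComponent_of_mem (quadSpan_pow_le_homogeneous t hf),
      if_neg (by omega)]
  exact this hv

theorem homogeneousComponent_word (l : List (ℕ × ℕ)) {s : ℕ} (h : l.length ≤ s) :
    homogeneousComponent (2 * s) (word n l) =
      if l.length = s then (l.map fun i => gen n i (1 : Fock n)).prod else 0 := by
  split_ifs with hs
  · subst hs
    have h1 := homogeneousComponent_quadFiltration (word_sub_prod_mem (n := n) l)
    rw [map_sub, sub_eq_zero] at h1
    rw [h1, homogeneousComponent_of_mem (quadSpan_pow_le_homogeneous _ (prod_gen_one_mem l)),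
      if_pos rfl]
  · refine homogeneousComponent_quadFiltration ?_
    rw [← sub_add_cancel (word n l) (l.map fun i => gen n i (1 : Fock n)).prod]
    exact add_mem (quadFiltration_mono h (word_sub_prod_mem l))
      (quadSpan_pow_le (lt_of_le_of_ne h hs) (prod_gen_one_mem l))

/-- A word of length s equals the product of its letters applied to 1 up to fewer scalar products,
that is, up to polynomial degree below 2s. The component of degree 2s is thus the commutative
symbol. -/
theorem homogeneousComponent_wordMap {s : ℕ} {p : MvPolynomial (ℕ × ℕ) ℂ}
    (hp : p.totalDegree ≤ s) : homogeneousComponent (2 * s) (wordMap n p) =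
      genSubst n (homogeneousComponent s p) := by
  conv_lhs => rw [p.as_sum]
  conv_rhs => rw [p.as_sum]
  simp only [map_sum]
  refine Finset.sum_congr rfl fun d hd => ?_
  have hlen : (Finsupp.toMultiset d).toList.length = d.degree := by
    rw [Multiset.length_toList, Finsupp.card_toMultiset]
    rfl
  have hle : (Finsupp.toMultiset d).toList.length ≤ s := by
    rw [hlen]
    exact (le_totalDegree hd).trans hp
  rw [wordMap_monomial, map_smul, homogeneousComponent_word _ hle, hlen,
    homogeneousComponent_of_mem (isHomogeneous_monomial _ rfl)]
  simp only [eq_comm (a := s)]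
  split_ifs
  · rw [genSubst, aeval_monomial, Algebra.smul_def]
    congr 1
    rw [← Multiset.prod_coe, ← Multiset.map_coe, Multiset.coe_toList, Finsupp.toMultiset_map,
      Finsupp.prod_toMultiset, Finsupp.prod_mapDomain_index (by simp) fun _ _ _ => pow_add _ _ _]
  · simp

/-- The ordered words of low weight are linearly independent. -/
theorem eq_zero_of_wordMap_eq_zero {w : ℕ} {p : MvPolynomial (ℕ × ℕ) ℂ}
    (hp : IsWeightedHomogeneous genWeight p w) (hw : w < (n + 1) * (n + 2))
    (h : wordMap n p = 0) : p = 0 := by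
  by_contra hne
  have h1 := homogeneousComponent_wordMap (n := n) (le_refl p.totalDegree)
  rw [h, map_zero] at h1
  have h2 : IsWeightedHomogeneous genWeight (homogeneousComponent p.totalDegree p) w := by
    intro d hd
    rw [coeff_homogeneousComponent] at hd
    exact hp fun h0 => hd (by rw [h0, ite_self])
  have h3 := eq_zero_of_genSubst_eq_zero h2 hw h1.symm
  obtain ⟨d, hd, hdeg⟩ := Finset.exists_mem_eq_sup p.support (support_nonempty.mpr hne)
    fun d => d.sum fun _ e => e
  have h4 := congrArg (coeff d) h3
  rw [coeff_homogeneousComponent, if_pos (by rw [totalDegree, hdeg]; rfl), coeff_zero] at h4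
  exact mem_support_iff.mp hd h4

/-- After sorting, such a membership would make the word map vanish on the variable of (m, 0) minus
a polynomial without that linear monomial. In low weight the word map is injective on weighted
homogeneous polynomials, so this difference would be zero. -/
theorem gen_one_notMem_wordSpan {Λ : Set ℕ} {m : ℕ} (hm : m ∉ Λ)
    (hw : 2 * m + 2 < (n + 1) * (n + 2)) : gen n (m, 0) 1 ∉ wordSpan n Λ (2 * m + 2) := by
  intro h
  have h1 : wordSpan n Λ (2 * m + 2) ≤ orderedSpan n (m, 0) (2 * m + 2) := by
    refine Submodule.span_le.mpr ?_
    rintro _ ⟨l, hl, hlw, rfl⟩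
    rw [← show listWeight l = 2 * m + 2 by exact_mod_cast hlw]
    refine word_mem_orderedSpan rfl _ l rfl ?_
    rintro rfl
    exact hm (hl (m, 0) (List.mem_singleton_self _))
  obtain ⟨p, ⟨hp, hp0⟩, hpe⟩ := h1 h
  have hX : wordMap n (X (m, 0)) = gen n (m, 0) 1 := by
    rw [X, wordMap_monomial, one_smul, Finsupp.toMultiset_single, one_smul,
      Multiset.toList_singleton]
    rfl
  have h2 : X (m, 0) - p = 0 := by
    refine eq_zero_of_wordMap_eq_zero (n := n) (w := 2 * m + 2) (IsWeightedHomogeneous.sub ?_ hp) hw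
      (by rw [map_sub, hX, hpe, sub_self])
    exact isWeightedHomogeneous_X ℂ genWeight (m, 0)
  have h3 := congrArg (coeff (Finsupp.single (m, 0) 1)) h2
  have h4 : coeff (Finsupp.single (m, 0) 1) p = 0 := hp0
  rw [coeff_sub, h4, coeff_X, coeff_zero, sub_zero, if_pos rfl] at h3
  exact one_ne_zero h3

end Symbols

/-! ### Minimality of the generating set. -/

section Minimality

variable {n : ℕ}

theorem FieldDecouples.isMinimal {L : ℕ} (hL0 : 1 ≤ L) (hL : FieldDecouples n L)
    (hLn : 2 * L < (n + 1) * (n + 2)) :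
    IsMinimalStrongGeneratingSet {x | ∃ m ∈ Set.Iio L, x = j n (2 * m)} (invariantVA n) := by
  refine ⟨hL.stronglyGenerates hL0, fun T hT hTg => ?_⟩
  obtain ⟨x, ⟨m, hm, rfl⟩, hxT⟩ := Set.exists_of_ssubset hT
  -- Taking the full preimage of T gives m ∉ Λ directly, without knowing that distinct indices give
  -- distinct fields.
  set Λ : Set ℕ := {l | j n (2 * l) ∈ T}
  have hTΛ : T ⊆ {x | ∃ l ∈ Λ, x = j n (2 * l)} := fun y hy => by
    obtain ⟨l, -, rfl⟩ := hT.1 hy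
    exact ⟨l, hy, rfl⟩
  have h1 : j n (2 * m) ∈ normallyOrderedPolynomials {x | ∃ l ∈ Λ, x = j n (2 * l)} := by
    have h2 : j n (2 * m) ∈ normallyOrderedPolynomials T := by
      rw [show normallyOrderedPolynomials T = invariantVA n from hTg]
      exact j_mem_invariantVA _
    refine Submodule.span_mono ?_ h2
    rintro _ ⟨l, hl, rfl⟩
    exact ⟨l, fun p hp => hTΛ (hl p hp), rfl⟩
  rw [normallyOrderedPolynomials_eq] at h1
  have hw : state n (j n (2 * m)) ∈ weightSpace n (2 * m + 2) := by
    have := word_mem_weightSpace (n := n) [(m, 0)]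
    rw [← state_j] at this
    simpa [listWeight, genWeight] using this
  have hm' : m < L := hm
  exact gen_one_notMem_wordSpan (Λ := Λ) hxT (by omega)
    (mem_span_word_of_weight (state_mem_span_word h1) hw)

end Minimality

end Heisenberg

end

theorem mainTheorem3 (n : ℕ) (hn : 1 ≤ n)
    (hconj : Heisenberg.HasDecouplingRelation n (n ^ 2 + 3 * n)) :
    (∀ r : ℕ, n ^ 2 + 3 * n ≤ 2 * r → Heisenberg.HasDecouplingRelation n (2 * r)) ∧
      Heisenberg.IsMinimalStrongGeneratingSet (Heisenberg.jSet n) (Heisenberg.invariantVA n) := by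
  obtain ⟨L, hL⟩ : ∃ L, n ^ 2 + 3 * n = 2 * L := by
    obtain ⟨k, hk⟩ := Nat.even_mul_succ_self n
    exact ⟨k + n, by linarith [show n * (n + 1) = n ^ 2 + n by ring]⟩
  have hL0 : 1 ≤ L := by nlinarith
  -- The product is n² + 3n + 2, the weight of j^{2L}; all generators in the set lie strictly below
  -- it, where no relations exist.
  have hLn : 2 * L < (n + 1) * (n + 2) := by nlinarith
  rw [Heisenberg.HasDecouplingRelation, hL, Heisenberg.jSet_eq hL] at hconj
  have hF := Heisenberg.fieldDecouples_of_mem hconj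
  refine ⟨fun r _ => ?_, ?_⟩
  · rw [Heisenberg.HasDecouplingRelation, Heisenberg.jSet_eq hL,
      show Heisenberg.normallyOrderedPolynomials _ = _ from hF.stronglyGenerates hL0]
    exact Heisenberg.j_mem_invariantVA _
  · rw [Heisenberg.jSet_eq hL]
    exact hF.isMinimal hL0 hLn
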